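/- Let $\Gamma$ be a discrete group of isometries (orientation-reversing elements and torsion are allowed) of hyperbolic $3$-space $\mathbb{H}^3$ such that the quotient $\mathcal{O}=\mathbb{H}^3/\Gamma$ is compact; that is, $\mathcal{O}$ is a closed hyperbolic $3$-orbifold, equipped with the quotient topology, the quotient metric $d(x,y)=\inf\{d_{\mathbb{H}^3}(p,q) : p\mapsto x,\ q\mapsto y\}$ and the volume induced from $\mathbb{H}^3$. Let $H^1(\mathcal{O})$ be the space of functions $f:\mathcal{O}\to\mathbb{R}$ whose lift $\tilde f$ to $\mathbb{H}^3$ lies in $H^1_{\mathrm{loc}}(\mathbb{H}^3)$. A real number $\mu$ is an eigenvalue of the Laplacian of $\mathcal{O}$ if there is $f\in H^1(\mathcal{O})$, not almost everywhere zero, with $\Delta\tilde f=\mu\tilde f$ weakly on $\mathbb{H}^3$, where $\Delta=-\operatorname{div}\operatorname{grad}$. Then the set of nonzero eigenvalues has a least element $\lambda_1(\mathcal{O})$, and the following holds. Let $U\subset\mathcal{O}$ be open, let $n\ge 0$ be an integer and let $D,V$ be real numbers such that 1. the frontier of $U$ can be partitioned into $n$ subsets (possibly empty), any two points of the same subset being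 at distance at most $D$; 2. both $U$ and $\mathcal{O}\setminus U$ have volume at least $V$; 3. $V>n\,\mathcal{V}_{D+1}$, where $\mathcal{V}_{r}$ denotes the volume of a ball of radius $r$ in $\mathbb{H}^3$. Then $$\lambda_1(\mathcal{O})\le\frac{n\,\mathcal{V}_{D+1}}{V-n\,\mathcal{V}_{D+1}}.$$ -/

import Mathlib

open MeasureTheory Set
open scoped ContDiff

noncomputable section

/-! ### Hyperbolic 3-space: the upper half-space model -/

/-- The coordinate space `ℝ³` with its Euclidean structure; the coordinate `x 2` is the height. -/
abbrev E3 : Type := EuclideanSpace ℝ (Fin 3)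

/-- The open upper half-space in `ℝ³`. -/
def upperHalfSpace : Set E3 := {x | 0 < x 2}

/-- Hyperbolic 3-space `ℍ³`, as the set of points of `ℝ³` of positive height. -/
@[ext]
structure Hyp3 where
  /-- the Euclidean coordinates of the point -/
  val : E3
  pos : 0 < val 2

namespace Hyp3

/-- The hyperbolic distance, `sinh (d(p, q) / 2) = |p - q| / (2 √(h(p) h(q)))`, where `h` is the
height and `|p - q|` the Euclidean distance. -/
instance : Dist Hyp3 :=
  ⟨fun p q => 2 * Real.arsinh (dist p.val q.val / (2 * √(p.val 2 * q.val 2)))⟩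

theorem dist_def (p q : Hyp3) :
    dist p q = 2 * Real.arsinh (dist p.val q.val / (2 * √(p.val 2 * q.val 2))) := rfl

/-- The mirror image of a point in the plane of height `0`. -/
def mirror (p : Hyp3) : E3 := !₂[p.val 0, p.val 1, -p.val 2]

theorem sinh_half_dist (p q : Hyp3) :
    Real.sinh (dist p q / 2) = dist p.val q.val / (2 * √(p.val 2 * q.val 2)) := by
  rw [dist_def, mul_div_cancel_left₀ _ (two_ne_zero' ℝ), Real.sinh_arsinh]

theorem sq_dist_mirror (p q : Hyp3) :
    dist p.val q.mirror ^ 2 = dist p.val q.val ^ 2 + 4 * (p.val 2 * q.val 2) := by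
  rw [EuclideanSpace.dist_eq, EuclideanSpace.dist_eq, Real.sq_sqrt, Real.sq_sqrt]
  · simp only [mirror, Fin.sum_univ_three, Real.dist_eq, sq_abs]
    simp
    ring
  all_goals positivity

theorem cosh_half_dist (p q : Hyp3) :
    Real.cosh (dist p q / 2) = dist p.val q.mirror / (2 * √(p.val 2 * q.val 2)) := by
  have hp := p.pos
  have hq := q.pos
  have hpq : 0 < p.val 2 * q.val 2 := mul_pos hp hq
  rw [← sq_eq_sq₀ (Real.cosh_pos _).le (by positivity), Real.cosh_sq', sinh_half_dist, div_pow,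
    div_pow, sq_dist_mirror, mul_pow, Real.sq_sqrt hpq.le]
  field_simp
  ring

theorem dist_self_mirror (p : Hyp3) : dist p.val p.mirror = 2 * p.val 2 := by
  have hp := p.pos
  rw [← sq_eq_sq₀ dist_nonneg (by positivity), sq_dist_mirror, dist_self]
  ring

protected theorem dist_comm (p q : Hyp3) : dist p q = dist q p := by
  rw [dist_def, dist_def, dist_comm p.val, mul_comm (p.val 2)]

protected theorem dist_triangle (a b c : Hyp3) : dist a c ≤ dist a b + dist b c := by
  have ha := a.pos
  have hb := b.pos
  have hc := c.pos
  have key := EuclideanGeometry.mul_dist_le_mul_dist_add_mul_dist a.val b.val c.val b.mirror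
  rw [dist_self_mirror] at key
  have h : Real.sinh (dist a c / 2) ≤ Real.sinh ((dist a b + dist b c) / 2) := by
    rw [add_div, Real.sinh_add, Hyp3.dist_comm b c, sinh_half_dist, sinh_half_dist a b,
      cosh_half_dist a b, sinh_half_dist c b, cosh_half_dist c b, dist_comm c.val b.val,
      Real.sqrt_mul ha.le, Real.sqrt_mul ha.le, Real.sqrt_mul hc.le]
    have h1 : √(b.val 2) * √(b.val 2) = b.val 2 := Real.mul_self_sqrt hb.le
    have sa : 0 < √(a.val 2) := Real.sqrt_pos.2 ha
    have sb : 0 < √(b.val 2) := Real.sqrt_pos.2 hb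
    have sc : 0 < √(c.val 2) := Real.sqrt_pos.2 hc
    rw [← mul_le_mul_iff_of_pos_left (show (0 : ℝ) <
      (2 * b.val 2) * (2 * (√(a.val 2) * √(c.val 2))) by positivity)]
    have e1 : (2 * b.val 2) * (2 * (√(a.val 2) * √(c.val 2))) *
        (dist a.val c.val / (2 * (√(a.val 2) * √(c.val 2)))) = 2 * b.val 2 * dist a.val c.val := by
      field_simp
    have e2 : (2 * b.val 2) * (2 * (√(a.val 2) * √(c.val 2))) *
        (dist a.val b.val / (2 * (√(a.val 2) * √(b.val 2))) *
            (dist c.val b.mirror / (2 * (√(c.val 2) * √(b.val 2)))) +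
          dist a.val b.mirror / (2 * (√(a.val 2) * √(b.val 2))) *
            (dist b.val c.val / (2 * (√(c.val 2) * √(b.val 2))))) =
        dist a.val b.val * dist c.val b.mirror + dist b.val c.val * dist a.val b.mirror := by
      rw [show 2 * b.val 2 = 2 * (√(b.val 2) * √(b.val 2)) by rw [h1]]
      field_simp
    rw [e1, e2]
    linarith
  have := Real.sinh_le_sinh.1 h
  linarith

/-- `ℍ³` as a metric space; its topology is the one of the hyperbolic distance. -/
instance : MetricSpace Hyp3 where
  dist_self p := by simp [dist_def]
  dist_comm := Hyp3.dist_comm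
  dist_triangle := Hyp3.dist_triangle
  eq_of_dist_eq_zero {p q} h := by
    have hs : √(p.val 2 * q.val 2) ≠ 0 := (Real.sqrt_pos.2 (mul_pos p.pos q.pos)).ne'
    rw [dist_def] at h
    have h' : dist p.val q.val = 0 := by simpa [hs] using h
    exact Hyp3.ext (dist_eq_zero.1 h')

/-- The measurable structure of `ℍ³` as a subset of `ℝ³`. -/
instance : MeasurableSpace Hyp3 := MeasurableSpace.comap Hyp3.val inferInstance

/-- The Riemannian volume of `ℍ³`: the measure `dx₀ dx₁ dx₂ / x₂³`. -/
def vol : Measure Hyp3 :=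
  Measure.comap Hyp3.val
    ((volume : Measure E3).withDensity fun x => ENNReal.ofReal (1 / x 2 ^ 3))

/-- The base point `(0, 0, 1)`. -/
def origin : Hyp3 := ⟨!₂[0, 0, 1], by simp⟩

/-- The volume of a ball of radius `r` in `ℍ³`. -/
def ballVolume (r : ℝ) : ℝ := (vol (Metric.ball origin r)).toReal

/-- A function on `ℍ³` in coordinates (extended by zero to all of `ℝ³`). -/
def inCoords (u : Hyp3 → ℝ) : E3 → ℝ :=
  open Classical in fun x => if h : 0 < x 2 then u ⟨x, h⟩ else 0

end Hyp3

/-! ### Weak derivatives and the weak Laplacian on hyperbolic 3-space -/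

/-- Smooth functions on `ℝ³` with compact support inside the upper half-space. -/
def IsTestFunction (φ : E3 → ℝ) : Prop :=
  ContDiff ℝ ∞ φ ∧ HasCompactSupport φ ∧ tsupport φ ⊆ upperHalfSpace

/-- `L²_loc` on the upper half-space. The hyperbolic and the Euclidean metric are comparable on
compact sets, so this is also `L²_loc(ℍ³)`. -/
def MemL2Loc {F : Type*} [NormedAddCommGroup F] (u : E3 → F) : Prop :=
  ∀ K : Set E3, IsCompact K → K ⊆ upperHalfSpace → MemLp u 2 (volume.restrict K)

/-- `u ∈ H¹_loc(ℍ³)` with Euclidean weak gradient `G`: both `u` and `G` are in `L²_loc`, and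
`∫ u ∂ᵥφ = - ∫ ⟨G, v⟩ φ` for all test functions `φ` and all directions `v`. -/
def HasWeakGradient (u : E3 → ℝ) (G : E3 → E3) : Prop :=
  MemL2Loc u ∧ MemL2Loc G ∧ ∀ φ : E3 → ℝ, IsTestFunction φ → ∀ v : E3,
    ∫ x in upperHalfSpace, u x * fderiv ℝ φ x v =
      - ∫ x in upperHalfSpace, inner ℝ (G x) v * φ x

/-- `u ∈ H¹_loc(ℍ³)` and `Δ u = g` weakly, for the positive Laplacian `Δ = - div grad` of `ℍ³`:
`∫ ⟨∇u, ∇φ⟩ dvol = ∫ g φ dvol` for all test functions `φ`. For the hyperbolic metric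
`|dx|² / x₂²` the product of the hyperbolic gradients of `u` and `φ` is `x₂²` times that of the
Euclidean gradients, and the volume form is `dx / x₂³`. -/
def HasWeakLaplacian (u g : E3 → ℝ) : Prop :=
  ∃ G : E3 → E3, HasWeakGradient u G ∧ ∀ φ : E3 → ℝ, IsTestFunction φ →
    ∫ x in upperHalfSpace, (x 2 ^ 2 * inner ℝ (G x) (gradient φ x)) / x 2 ^ 3 =
      ∫ x in upperHalfSpace, (g x * φ x) / x 2 ^ 3

/-! ### Hyperbolic 3-orbifolds -/

/-- A group of isometries of `ℍ³` is discrete if it is discrete in the topology of pointwise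
convergence (which, on isometries, is also the compact-open topology). -/
def IsDiscreteGroup (Γ : Subgroup (Hyp3 ≃ᵢ Hyp3)) : Prop :=
  IsDiscrete ((fun γ : Hyp3 ≃ᵢ Hyp3 => (γ : Hyp3 → Hyp3)) '' (Γ : Set (Hyp3 ≃ᵢ Hyp3)))

/-- The equivalence relation of lying in the same `Γ`-orbit. -/
def orbitSetoid (Γ : Subgroup (Hyp3 ≃ᵢ Hyp3)) : Setoid Hyp3 where
  r p q := ∃ γ ∈ Γ, γ p = q
  iseqv :=
    { refl := fun p => ⟨1, Γ.one_mem, rfl⟩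
      symm := by
        rintro p q ⟨γ, hγ, rfl⟩
        exact ⟨γ⁻¹, Γ.inv_mem hγ, γ.symm_apply_apply p⟩
      trans := by
        rintro p q r ⟨γ, hγ, rfl⟩ ⟨δ, hδ, rfl⟩
        exact ⟨δ * γ, Γ.mul_mem hδ hγ, rfl⟩ }

/-- The quotient `ℍ³ / Γ`. -/
def Orbifold (Γ : Subgroup (Hyp3 ≃ᵢ Hyp3)) : Type := Quotient (orbitSetoid Γ)

namespace Orbifold

variable (Γ : Subgroup (Hyp3 ≃ᵢ Hyp3))

/-- The projection `ℍ³ → ℍ³ / Γ`. -/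
def proj (p : Hyp3) : Orbifold Γ := Quotient.mk (orbitSetoid Γ) p

/-- The quotient topology. -/
instance : TopologicalSpace (Orbifold Γ) :=
  inferInstanceAs (TopologicalSpace (Quotient (orbitSetoid Γ)))

variable {Γ}

/-- The quotient distance: the infimum of the distances between points of the two orbits. -/
def qdist (x y : Orbifold Γ) : ℝ :=
  sInf {d : ℝ | ∃ p q : Hyp3, proj Γ p = x ∧ proj Γ q = y ∧ d = dist p q}

/-- The set `S` has diameter at most `D` in the quotient distance. -/
def DiamLE (S : Set (Orbifold Γ)) (D : ℝ) : Prop := ∀ x ∈ S, ∀ y ∈ S, qdist x y ≤ D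

/-- The volume of a (Borel) set `A` in `ℍ³ / Γ`: the largest volume of a measurable subset of `ℍ³`
that the projection maps injectively into `A`. -/
def vol (A : Set (Orbifold Γ)) : ENNReal :=
  ⨆ (B : Set Hyp3) (_ : MeasurableSet B) (_ : InjOn (proj Γ) B) (_ : MapsTo (proj Γ) B A),
    Hyp3.vol B

/-- The lift to `ℍ³` of a function on `ℍ³ / Γ`, in coordinates. -/
def lift (f : Orbifold Γ → ℝ) : E3 → ℝ := Hyp3.inCoords fun p => f (proj Γ p)

variable (Γ)

/-- `μ` is an eigenvalue of the Laplacian of `ℍ³ / Γ`: there is a function `f ∈ H¹(ℍ³ / Γ)`, that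
is, one whose lift is in `H¹_loc(ℍ³)`, which is not almost everywhere zero and whose lift
satisfies `Δ f = μ f`. -/
def IsEigenvalue (μ : ℝ) : Prop :=
  ∃ f : Orbifold Γ → ℝ, (¬ ∀ᵐ p ∂Hyp3.vol, f (proj Γ p) = 0) ∧
    HasWeakLaplacian (lift f) (fun x => μ * lift f x)

/-- The first nonzero eigenvalue `λ₁` of the Laplacian of `ℍ³ / Γ`. -/
def lambdaOne : ℝ := sInf {μ : ℝ | μ ≠ 0 ∧ IsEigenvalue Γ μ}

end Orbifold

end

/-! ### Hyperbolic space in coordinates: chords, topology, metric balls. -/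

noncomputable section

open Filter Topology

/-! The bound is the variational one. Let W be n times the volume of a ball of radius D + 1. On each
of U and its complement take the distance to the frontier, cut off at 1 and extended by zero
(`collar`). Such a function is 1-Lipschitz, and its gradient vanishes outside the 1-neighbourhood of
the frontier. That neighbourhood is covered by the projections of n balls of radius D + 1, so the
energy is at most W (`cell_neighbourhood_le`, `exists_collar`). The function equals 1 on the rest of
its side, so its integral and its square integral are at least V - W. The two functions have
disjoint supports, hence some combination of them has mean zero and Rayleigh quotient at most W / (V
- W) (`le_div_of_disjoint`).

It remains to identify the least nonzero eigenvalue with the minimum of the Rayleigh quotient over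
functions of mean value zero (`IsPartition.exists_isLeast`). Analysis on the quotient is done
upstairs with a nonnegative test function χ whose translates under Γ sum to one
(`IsDiscreteGroup.exists_isPartition`). The measure χ dvol, called `cell χ`, replaces a fundamental
domain: integrals over the whole space unfold to integrals over the cell
(`IsPartition.integral_eq`). Torsion does no harm, because a nontrivial isometry fixes only a null
set (`vol_fixedPoints`).

The space H¹ of the orbifold is the space of pairs (function, weak gradient of its lift), with the
mass form and the Dirichlet form of the cell. The abstract lemma
`LinearMap.BilinForm.exists_minimizer` yields a minimizer from completeness (`exists_limit`) and
relative compactness (`exists_compactness`); the latter is Rellich's theorem, obtained from the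
Poincaré inequality on the cubes of a fine grid. The minimizer is a weak eigenfunction on the
covering space, since testing against φ there is testing against the orbit sum of φ on the quotient.
Its eigenvalue is not zero because a function with vanishing gradient is constant.

Conversely let u be a weak solution with eigenvalue μ ≠ 0. Testing with χ shows that u has mean
zero; testing with χ u, through approximation by test functions, shows that its energy is μ times
its mass. Hence no nonzero eigenvalue lies below the minimum. -/

theorem isOpen_upperHalfSpace : IsOpen upperHalfSpace :=
  isOpen_lt continuous_const (by fun_prop)

theorem measurableSet_upperHalfSpace : MeasurableSet upperHalfSpace :=
  isOpen_upperHalfSpace.measurableSet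

theorem continuous_height : Continuous fun x : E3 => x 2 := by fun_prop

theorem EuclideanSpace.real_dist_sq_eq' {n : Type*} [Fintype n] (x y : EuclideanSpace ℝ n) :
    dist x y ^ 2 = ∑ i, (x i - y i) ^ 2 := by
  rw [dist_eq_norm, EuclideanSpace.real_norm_sq_eq]
  rfl

theorem abs_apply_sub_le_dist (x y : E3) (i : Fin 3) : |x i - y i| ≤ dist x y := by
  have := PiLp.norm_apply_le (x - y) i
  simpa [dist_eq_norm] using this

namespace Hyp3

theorem range_val : range Hyp3.val = upperHalfSpace := by
  ext x
  exact ⟨by rintro ⟨p, rfl⟩; exact p.pos, fun h => ⟨⟨x, h⟩, rfl⟩⟩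

theorem val_injective : Function.Injective Hyp3.val := fun _ _ h => Hyp3.ext h

/-- `2 (cosh d(p, q) - 1)`. -/
def chord (p q : Hyp3) : ℝ := dist p.val q.val ^ 2 / (p.val 2 * q.val 2)

theorem cosh_dist (p q : Hyp3) : Real.cosh (dist p q) = 1 + chord p q / 2 := by
  have h0 : 0 < p.val 2 * q.val 2 := mul_pos p.pos q.pos
  rw [show dist p q = 2 * (dist p q / 2) by ring, Real.cosh_two_mul, Real.cosh_sq', sinh_half_dist,
    div_pow, mul_pow, Real.sq_sqrt h0.le, chord]
  field_simp
  ring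

theorem chord_map (γ : Hyp3 ≃ᵢ Hyp3) (p q : Hyp3) : chord (γ p) (γ q) = chord p q := by
  have h1 := cosh_dist (γ p) (γ q)
  rw [γ.isometry.dist_eq, cosh_dist] at h1
  linarith

theorem dist_le_of_chord (p q : Hyp3) : dist p q ≤ dist p.val q.val / √(p.val 2 * q.val 2) := by
  have h0 : 0 < √(p.val 2 * q.val 2) := Real.sqrt_pos.2 (mul_pos p.pos q.pos)
  have h2 : dist p q / 2 ≤ Real.sinh (dist p q / 2) :=
    Real.self_le_sinh_iff.2 (by positivity)
  rw [sinh_half_dist] at h2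
  have : dist p.val q.val / (2 * √(p.val 2 * q.val 2)) =
    dist p.val q.val / √(p.val 2 * q.val 2) / 2 := by field_simp
  linarith

theorem sq_dist_val (p q : Hyp3) :
    dist p.val q.val ^ 2 = 2 * (p.val 2 * q.val 2) * (Real.cosh (dist p q) - 1) := by
  have hp := p.pos
  have hq := q.pos
  rw [cosh_dist, chord]
  field_simp
  ring

/-- The height difference is at most the Euclidean distance, which `sq_dist_val` expresses through
the two heights; one factor of the height of q then cancels. This controls the Euclidean size of
hyperbolic balls. -/
theorem height_le (p q : Hyp3) : q.val 2 ≤ p.val 2 * (2 * Real.cosh (dist p q)) := by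
  have hp := p.pos
  have hq := q.pos
  have h1 := sq_dist_val p q
  have h2 := abs_apply_sub_le_dist p.val q.val 2
  have h3 : (p.val 2 - q.val 2) ^ 2 ≤ dist p.val q.val ^ 2 := by
    rw [← sq_abs]
    exact pow_le_pow_left₀ (abs_nonneg _) h2 2
  rw [h1] at h3
  have h4 : q.val 2 * q.val 2 ≤ (p.val 2 * (2 * Real.cosh (dist p q))) * q.val 2 := by
    nlinarith [sq_nonneg (p.val 2)]
  exact le_of_mul_le_mul_right h4 hq

theorem sq_dist_val_le (p q : Hyp3) :
    dist p.val q.val ^ 2 ≤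
      4 * p.val 2 ^ 2 * Real.cosh (dist p q) * (Real.cosh (dist p q) - 1) := by
  rw [sq_dist_val]
  have h1 := height_le p q
  have h2 : 0 ≤ Real.cosh (dist p q) - 1 := by linarith [Real.one_le_cosh (dist p q)]
  have hp := p.pos
  calc 2 * (p.val 2 * q.val 2) * (Real.cosh (dist p q) - 1)
      ≤ 2 * (p.val 2 * (p.val 2 * (2 * Real.cosh (dist p q)))) * (Real.cosh (dist p q) - 1) := by
        gcongr
    _ = _ := by ring

theorem continuous_val : Continuous Hyp3.val := by
  rw [continuous_iff_continuousAt]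
  intro p
  rw [ContinuousAt, tendsto_iff_dist_tendsto_zero]
  have h1 : Tendsto (fun q : Hyp3 => √(4 * p.val 2 ^ 2 * Real.cosh (dist p q) *
      (Real.cosh (dist p q) - 1))) (𝓝 p) (𝓝 0) := by
    have : Continuous fun q : Hyp3 => √(4 * p.val 2 ^ 2 * Real.cosh (dist p q) *
      (Real.cosh (dist p q) - 1)) := by fun_prop
    simpa using this.tendsto p
  refine squeeze_zero (fun _ => dist_nonneg) (fun q => ?_) h1
  rw [dist_comm]
  exact Real.le_sqrt_of_sq_le (sq_dist_val_le p q)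

/-- Continuity comes from bounding the Euclidean distance by the hyperbolic one, and the converse
from `dist_le_of_chord`, whose right side tends to zero with the Euclidean distance. -/
theorem isInducing_val : IsInducing Hyp3.val := by
  rw [isInducing_iff_nhds]
  intro p
  refine le_antisymm continuous_val.continuousAt.tendsto.le_comap ?_
  have h0 := p.pos
  have key : Tendsto (fun q : Hyp3 => dist q p) (comap Hyp3.val (𝓝 p.val)) (𝓝 0) := by
    have h1 : Tendsto (fun x : E3 => dist x p.val / √(x 2 * p.val 2)) (𝓝 p.val) (𝓝 0) := by
      have : ContinuousAt (fun x : E3 => dist x p.val / √(x 2 * p.val 2)) p.val := by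
        refine ContinuousAt.div (by fun_prop) (by fun_prop) ?_
        exact (Real.sqrt_pos.2 (mul_pos h0 h0)).ne'
      simpa [ContinuousAt] using this
    exact squeeze_zero (fun _ => dist_nonneg) (fun q => dist_le_of_chord q p)
      (h1.comp tendsto_comap)
  exact tendsto_iff_dist_tendsto_zero.2 key

theorem isOpenEmbedding_val : IsOpenEmbedding Hyp3.val :=
  ⟨⟨isInducing_val, val_injective⟩, by rw [range_val]; exact isOpen_upperHalfSpace⟩

instance : BorelSpace Hyp3 := by
  refine ⟨?_⟩
  rw [show (instMeasurableSpace : MeasurableSpace Hyp3) = MeasurableSpace.comap Hyp3.val (borel E3)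
    by rw [← BorelSpace.measurable_eq (α := E3)]; rfl]
  have h : MeasurableSpace.comap Hyp3.val (borel E3) =
    @borel Hyp3 (TopologicalSpace.induced Hyp3.val inferInstance) := borel_comap.symm
  rw [h, ← isInducing_val.eq_induced]

theorem measurableEmbedding_val : MeasurableEmbedding Hyp3.val :=
  isOpenEmbedding_val.measurableEmbedding

/-- Closed balls of `ℍ³` are compact. -/
theorem isCompact_closedBall (p : Hyp3) (r : ℝ) : IsCompact (Metric.closedBall p r) := by
  have hp := p.pos
  set c := Real.cosh r with hc
  have hc1 : 1 ≤ c := Real.one_le_cosh r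
  -- The lower bound on the height is `height_le` with the points exchanged; it keeps K away from
  -- the boundary plane.
  let K : Set E3 := Metric.closedBall p.val √(4 * p.val 2 ^ 2 * c * (c - 1)) ∩
    {x | p.val 2 / (2 * c) ≤ x 2}
  have hK : IsCompact K := (ProperSpace.isCompact_closedBall p.val _).inter_right
    (isClosed_le continuous_const continuous_height)
  have hKr : K ⊆ range Hyp3.val := by
    rw [range_val]
    rintro x ⟨-, hx⟩
    exact lt_of_lt_of_le (show 0 < p.val 2 / (2 * c) by positivity) hx
  have h1 : IsCompact (Hyp3.val ⁻¹' K) := isInducing_val.isCompact_preimage_iff hKr |>.2 hK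
  refine h1.of_isClosed_subset Metric.isClosed_closedBall fun q hq => ?_
  rw [Metric.mem_closedBall] at hq
  have hcosh : Real.cosh (dist q p) ≤ c := by
    rw [hc, Real.cosh_le_cosh, abs_of_nonneg dist_nonneg]
    exact hq.trans (le_abs_self r)
  have hcosh' : Real.cosh (dist p q) ≤ c := by rwa [dist_comm]
  have h1' := Real.one_le_cosh (dist p q)
  constructor
  · rw [Metric.mem_closedBall, dist_comm]
    refine Real.le_sqrt_of_sq_le ((sq_dist_val_le p q).trans ?_)
    have : 0 ≤ Real.cosh (dist p q) - 1 := by linarith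
    gcongr
  · have := height_le q p
    have hq := q.pos
    change p.val 2 / (2 * c) ≤ q.val 2
    rw [div_le_iff₀ (by positivity)]
    exact this.trans (by gcongr)

/-- In coordinates the ball is the part of positive height where |x - p|² is less than a constant
multiple of the height of x, a convex condition. Connectedness is what produces a frontier point
between a point of a set and a point outside it. -/
theorem isPreconnected_ball (p : Hyp3) (r : ℝ) : IsPreconnected (Metric.ball p r) := by
  rcases le_or_gt r 0 with hr | hr
  · rw [Metric.ball_eq_empty.2 hr]; exact isPreconnected_empty
  have hp := p.pos
  set C := 2 * (Real.cosh r - 1) with hC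
  let S : Set E3 := {x | 0 < x 2} ∩ {x | dist x p.val ^ 2 - C * p.val 2 * x 2 < 0}
  have hS : Convex ℝ S := by
    refine Convex.inter ?_ ?_
    · have : IsLinearMap ℝ (fun x : E3 => x 2) := ⟨fun _ _ => rfl, fun _ _ => rfl⟩
      exact convex_halfSpace_gt this 0
    · have h1 : ConvexOn ℝ univ (fun x : E3 => dist x p.val ^ 2) := by
        have := convexOn_dist p.val (convex_univ (𝕜 := ℝ) (E := E3))
        exact this.pow (fun _ _ => dist_nonneg) 2
      have h2 : ConvexOn ℝ univ (fun x : E3 => -(C * p.val 2 * x 2)) := by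
        refine ⟨convex_univ, fun x _ y _ a b _ _ _ => ?_⟩
        simp
        apply le_of_eq
        ring
      have := (h1.add h2).convex_lt 0
      simpa [sub_eq_add_neg] using this
  have h3 : Metric.ball p r = Hyp3.val ⁻¹' S := by
    ext q
    have hq := q.pos
    have h4 : q.val ∈ S ↔ chord q p < C := by
      simp only [S, mem_inter_iff, mem_ofPred_eq, hq, true_and, chord]
      rw [div_lt_iff₀ (by positivity)]
      constructor <;> intro h <;> linarith
    rw [mem_preimage, h4, Metric.mem_ball]
    have h5 := cosh_dist q p
    have h6 : Real.cosh (dist q p) < Real.cosh r ↔ dist q p < r := by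
      rw [Real.cosh_lt_cosh, abs_of_nonneg dist_nonneg, abs_of_pos hr]
    rw [← h6]
    constructor <;> intro h <;> linarith
  rw [h3]
  refine (isInducing_val.isPreconnected_image).1 ?_
  rw [image_preimage_eq_of_subset]
  · exact hS.isPreconnected
  · rw [range_val]; exact fun x hx => hx.1

/-! ### Isometries in coordinates are smooth and conformal. -/

/-- The action of an isometry in coordinates. -/
def act (γ : Hyp3 ≃ᵢ Hyp3) (x : E3) : E3 :=
  open Classical in if h : 0 < x 2 then (γ ⟨x, h⟩).val else x

theorem act_val (γ : Hyp3 ≃ᵢ Hyp3) (p : Hyp3) : act γ p.val = (γ p).val := by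
  simp [act, p.pos]

theorem act_of_mem (γ : Hyp3 ≃ᵢ Hyp3) {x : E3} (hx : x ∈ upperHalfSpace) :
    act γ x = (γ ⟨x, hx⟩).val := act_val γ ⟨x, hx⟩

theorem act_mem (γ : Hyp3 ≃ᵢ Hyp3) {x : E3} (hx : x ∈ upperHalfSpace) :
    act γ x ∈ upperHalfSpace := by rw [act_of_mem γ hx]; exact (γ _).pos

theorem act_mul (γ δ : Hyp3 ≃ᵢ Hyp3) {x : E3} (hx : x ∈ upperHalfSpace) :
    act (γ * δ) x = act γ (act δ x) := by
  rw [act_of_mem _ hx, act_of_mem δ hx, act_val]; rfl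

theorem act_inv_act (γ : Hyp3 ≃ᵢ Hyp3) {x : E3} (hx : x ∈ upperHalfSpace) :
    act γ⁻¹ (act γ x) = x := by
  rw [← act_mul _ _ hx, inv_mul_cancel, act_of_mem _ hx]; rfl

theorem act_act_inv (γ : Hyp3 ≃ᵢ Hyp3) {x : E3} (hx : x ∈ upperHalfSpace) :
    act γ (act γ⁻¹ x) = x := by
  rw [← act_mul _ _ hx, mul_inv_cancel, act_of_mem _ hx]; rfl

theorem act_image (γ : Hyp3 ≃ᵢ Hyp3) : act γ '' upperHalfSpace = upperHalfSpace := by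
  ext y
  exact ⟨by rintro ⟨x, hx, rfl⟩; exact act_mem γ hx,
    fun hy => ⟨act γ⁻¹ y, act_mem _ hy, act_act_inv γ hy⟩⟩

theorem act_injOn (γ : Hyp3 ≃ᵢ Hyp3) : InjOn (act γ) upperHalfSpace := fun x hx y hy h => by
  rw [← act_inv_act γ hx, h, act_inv_act γ hy]

theorem contDiffOn_chord (q : Hyp3) :
    ContDiffOn ℝ ∞ (fun x : E3 => dist x q.val ^ 2 / (x 2 * q.val 2)) upperHalfSpace := by
  refine ContDiffOn.div ?_ ?_ ?_
  · simp_rw [dist_eq_norm]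
    exact ((contDiff_id.sub contDiff_const).norm_sq ℝ).contDiffOn
  · exact ContDiff.contDiffOn (by fun_prop)
  · exact fun x hx => (mul_pos hx q.pos).ne'

/-- No classification of isometries is needed. The chord from γ p to a fixed point r is the chord
from p to γ⁻¹ r, a smooth function of p, and the coordinates of γ p are rational functions of its
chords to four reference points. -/
theorem contDiffOn_act (γ : Hyp3 ≃ᵢ Hyp3) : ContDiffOn ℝ ∞ (act γ) upperHalfSpace := by
  let r : Fin 4 → Hyp3 := ![⟨!₂[0, 0, 1], by simp⟩, ⟨!₂[1, 0, 1], by simp⟩, ⟨!₂[0, 1, 1], by simp⟩,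
    ⟨!₂[0, 0, 2], by simp⟩]
  let C : Fin 4 → E3 → ℝ := fun j x =>
    dist x (γ⁻¹ (r j)).val ^ 2 / (x 2 * (γ⁻¹ (r j)).val 2)
  have hC : ∀ j, ContDiffOn ℝ ∞ (C j) upperHalfSpace := fun j => contDiffOn_chord _
  have hCe : ∀ j, ∀ p : Hyp3, C j p.val = chord (γ p) (r j) := by
    intro j p
    have : chord (γ p) (γ (γ⁻¹ (r j))) = chord p (γ⁻¹ (r j)) := chord_map γ _ _
    rw [show γ (γ⁻¹ (r j)) = r j from γ.apply_symm_apply _] at this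
    rw [this]; rfl
  -- The quadratic terms cancel between the two reference points on the vertical axis, which leaves
  -- the height of γ p; the differences `hs1` and `hs2` then give its horizontal coordinates.
  have hs : ∀ p : Hyp3, 2 * C 3 p.val - C 0 p.val + 2 = 3 / (γ p).val 2 := by
    intro p
    have h := (γ p).pos
    rw [hCe, hCe]
    simp only [chord, EuclideanSpace.real_dist_sq_eq', Fin.sum_univ_three]
    simp [r]
    field_simp
    ring
  have hs1 : ∀ p : Hyp3, C 1 p.val - C 0 p.val = (1 - 2 * (γ p).val 0) / (γ p).val 2 := by
    intro p
    have h := (γ p).pos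
    rw [hCe, hCe]
    simp only [chord, EuclideanSpace.real_dist_sq_eq', Fin.sum_univ_three]
    simp [r]
    field_simp
    ring
  have hs2 : ∀ p : Hyp3, C 2 p.val - C 0 p.val = (1 - 2 * (γ p).val 1) / (γ p).val 2 := by
    intro p
    have h := (γ p).pos
    rw [hCe, hCe]
    simp only [chord, EuclideanSpace.real_dist_sq_eq', Fin.sum_univ_three]
    simp [r]
    field_simp
    ring
  have hne : ∀ x ∈ upperHalfSpace, 2 * C 3 x - C 0 x + 2 ≠ 0 := by
    intro x hx
    have := hs ⟨x, hx⟩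
    rw [this]
    have := (γ ⟨x, hx⟩).pos
    positivity
  have h2 : ContDiffOn ℝ ∞ (fun x => 3 / (2 * C 3 x - C 0 x + 2)) upperHalfSpace :=
    contDiffOn_const.div (((contDiffOn_const.mul (hC 3)).sub (hC 0)).add contDiffOn_const) hne
  rw [contDiffOn_euclidean]
  intro i
  fin_cases i
  · refine ((contDiffOn_const.sub (((hC 1).sub (hC 0)).mul h2)).div_const 2).congr
      (f := fun x => (1 - (C 1 x - C 0 x) * (3 / (2 * C 3 x - C 0 x + 2))) / 2) fun x hx => ?_
    have h := (γ ⟨x, hx⟩).pos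
    simp only [act_of_mem γ hx, hs1 ⟨x, hx⟩, hs ⟨x, hx⟩]
    simp only [Fin.zero_eta]
    field_simp
    ring
  · refine ((contDiffOn_const.sub (((hC 2).sub (hC 0)).mul h2)).div_const 2).congr
      (f := fun x => (1 - (C 2 x - C 0 x) * (3 / (2 * C 3 x - C 0 x + 2))) / 2) fun x hx => ?_
    have h := (γ ⟨x, hx⟩).pos
    simp only [act_of_mem γ hx, hs2 ⟨x, hx⟩, hs ⟨x, hx⟩]
    simp only [Fin.mk_one]
    field_simp
    ring
  · refine h2.congr fun x hx => ?_
    have h := (γ ⟨x, hx⟩).pos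
    simp only [act_of_mem γ hx, hs ⟨x, hx⟩]
    simp only [Fin.reduceFinMk]
    field_simp

theorem contDiffAt_act (γ : Hyp3 ≃ᵢ Hyp3) {x : E3} (hx : x ∈ upperHalfSpace) :
    ContDiffAt ℝ ∞ (act γ) x :=
  (contDiffOn_act γ).contDiffAt (isOpen_upperHalfSpace.mem_nhds hx)

theorem hasFDerivAt_act (γ : Hyp3 ≃ᵢ Hyp3) {x : E3} (hx : x ∈ upperHalfSpace) :
    HasFDerivAt (act γ) (fderiv ℝ (act γ) x) x :=
  ((contDiffAt_act γ hx).differentiableAt (by simp)).hasFDerivAt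

/-- The conformal factor of an isometry. -/
def scale (γ : Hyp3 ≃ᵢ Hyp3) (x : E3) : ℝ := act γ x 2 / x 2

theorem scale_pos (γ : Hyp3 ≃ᵢ Hyp3) {x : E3} (hx : x ∈ upperHalfSpace) : 0 < scale γ x :=
  div_pos (act_mem γ hx) hx

/-- Invariance of chords makes the norm of each difference quotient equal to ‖v‖ times the square
root of a ratio of heights, and that ratio tends to `scale γ x ^ 2`. -/
theorem norm_fderiv_act (γ : Hyp3 ≃ᵢ Hyp3) {x : E3} (hx : x ∈ upperHalfSpace) (v : E3) :
    ‖fderiv ℝ (act γ) x v‖ = scale γ x * ‖v‖ := by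
  have hx2 : 0 < x 2 := hx
  have hA : 0 < act γ x 2 := act_mem γ hx
  have h1 : Tendsto (fun t : ℝ => ‖t⁻¹ • (act γ (x + t • v) - act γ x)‖) (𝓝[≠] 0)
      (𝓝 ‖fderiv ℝ (act γ) x v‖) := by
    have := ((hasFDerivAt_act γ hx).hasLineDerivAt v).tendsto_slope_zero.norm
    simpa using this
  have hc : ContinuousAt (fun t : ℝ => act γ (x + t • v)) 0 := by
    have h3 : ContinuousAt (act γ) (x + (0 : ℝ) • v) := by
      simpa using (contDiffAt_act γ hx).continuousAt
    exact ContinuousAt.comp (f := fun t : ℝ => x + t • v) h3 (by fun_prop)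
  have hc2 : ContinuousAt (fun t : ℝ => act γ (x + t • v) 2) 0 :=
    continuous_height.continuousAt.comp hc
  have hev : ∀ᶠ t : ℝ in 𝓝 0, x + t • v ∈ upperHalfSpace := by
    have : Continuous fun t : ℝ => x + t • v := by fun_prop
    exact this.continuousAt.preimage_mem_nhds (by simpa using isOpen_upperHalfSpace.mem_nhds hx)
  have h2 : Tendsto (fun t : ℝ => √((act γ (x + t • v) 2 * act γ x 2) /
      ((x + t • v) 2 * x 2)) * ‖v‖) (𝓝[≠] 0) (𝓝 (scale γ x * ‖v‖)) := by
    have h4 : ContinuousAt (fun t : ℝ => √((act γ (x + t • v) 2 * act γ x 2) /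
      ((x + t • v) 2 * x 2)) * ‖v‖) 0 := by
      refine ContinuousAt.mul (ContinuousAt.sqrt (ContinuousAt.div (hc2.mul continuousAt_const)
        (by fun_prop) ?_)) continuousAt_const
      simp [hx2.ne']
    have h5 := h4.tendsto
    have h6 : √((act γ (x + (0:ℝ) • v) 2 * act γ x 2) / ((x + (0:ℝ) • v) 2 * x 2)) = scale γ x := by
      rw [zero_smul, add_zero, scale, Real.sqrt_eq_iff_mul_self_eq (by positivity) (by positivity)]
      field_simp
    rw [h6] at h5
    exact h5.mono_left nhdsWithin_le_nhds
  refine tendsto_nhds_unique h1 (h2.congr' ?_)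
  filter_upwards [nhdsWithin_le_nhds hev, self_mem_nhdsWithin] with t ht ht0
  have ht0' : t ≠ 0 := ht0
  have ht2 : 0 < (x + t • v) 2 := ht
  have hAt : 0 < act γ (x + t • v) 2 := act_mem γ ht
  have h7 := chord_map γ ⟨_, ht⟩ ⟨x, hx⟩
  simp only [chord, ← act_val] at h7
  rw [← sq_eq_sq₀ (by positivity) (by positivity), mul_pow, Real.sq_sqrt (by positivity), norm_smul,
    mul_pow, ← dist_eq_norm]
  rw [dist_self_add_left, norm_smul] at h7
  rw [div_eq_iff (by positivity)] at h7
  rw [h7]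
  simp only [norm_inv, Real.norm_eq_abs, inv_pow, mul_pow, sq_abs]
  field_simp

theorem inner_fderiv_act (γ : Hyp3 ≃ᵢ Hyp3) {x : E3} (hx : x ∈ upperHalfSpace) (v w : E3) :
    inner ℝ (fderiv ℝ (act γ) x v) (fderiv ℝ (act γ) x w) = scale γ x ^ 2 * inner ℝ v w := by
  have h1 := norm_fderiv_act γ hx (v + w)
  rw [map_add] at h1
  have h2 := norm_add_sq_real (fderiv ℝ (act γ) x v) (fderiv ℝ (act γ) x w)
  rw [h1, norm_fderiv_act γ hx, norm_fderiv_act γ hx, mul_pow, norm_add_sq_real] at h2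
  linarith

/-- The transpose of the derivative of an isometry in coordinates. -/
def coact (γ : Hyp3 ≃ᵢ Hyp3) (x : E3) : E3 →L[ℝ] E3 :=
  ContinuousLinearMap.adjoint (fderiv ℝ (act γ) x)

theorem coact_comp_fderiv (γ : Hyp3 ≃ᵢ Hyp3) {x : E3} (hx : x ∈ upperHalfSpace) :
    coact γ x ∘L fderiv ℝ (act γ) x = scale γ x ^ 2 • ContinuousLinearMap.id ℝ E3 := by
  ext1 v
  refine ext_inner_right ℝ fun w => ?_
  simp only [coact, ContinuousLinearMap.comp_apply, ContinuousLinearMap.adjoint_inner_left,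
    inner_fderiv_act γ hx, smul_apply, ContinuousLinearMap.id_apply,
    inner_smul_left, conj_trivial]

/-- In finite dimension a left inverse is a right inverse. -/
theorem fderiv_comp_coact (γ : Hyp3 ≃ᵢ Hyp3) {x : E3} (hx : x ∈ upperHalfSpace) :
    fderiv ℝ (act γ) x ∘L coact γ x = scale γ x ^ 2 • ContinuousLinearMap.id ℝ E3 := by
  have hs := scale_pos γ hx
  have h1 : (((scale γ x ^ 2)⁻¹ • coact γ x : E3 →L[ℝ] E3) : E3 →ₗ[ℝ] E3) ∘ₗ
      (fderiv ℝ (act γ) x : E3 →ₗ[ℝ] E3) = LinearMap.id := by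
    ext1 v
    have := congrArg (fun L : E3 →L[ℝ] E3 => L v) (coact_comp_fderiv γ hx)
    simp only [ContinuousLinearMap.comp_apply, smul_apply,
      ContinuousLinearMap.id_apply] at this
    simp [this, smul_smul, hs.ne']
  have h2 := (LinearMap.comp_eq_id_comm _ _).1 h1
  ext1 v
  have := congrArg (fun L : E3 →ₗ[ℝ] E3 => scale γ x ^ 2 • L v) h2
  simpa [smul_smul, hs.ne'] using this

theorem inner_coact (γ : Hyp3 ≃ᵢ Hyp3) {x : E3} (hx : x ∈ upperHalfSpace) (v w : E3) :
    inner ℝ (coact γ x v) (coact γ x w) = scale γ x ^ 2 * inner ℝ v w := by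
  have := congrArg (fun L : E3 →L[ℝ] E3 => L w) (fderiv_comp_coact γ hx)
  simp only [ContinuousLinearMap.comp_apply, smul_apply,
      ContinuousLinearMap.id_apply] at this
  conv_lhs => rw [coact, ContinuousLinearMap.adjoint_inner_left, ← coact, this]
  rw [inner_smul_right]

theorem abs_det_fderiv_act (γ : Hyp3 ≃ᵢ Hyp3) {x : E3} (hx : x ∈ upperHalfSpace) :
    |(fderiv ℝ (act γ) x).det| = scale γ x ^ 3 := by
  have hs := scale_pos γ hx
  -- Divided by the conformal factor, the derivative is a linear isometry, of determinant ±1; the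
  -- exponent 3 is the dimension.
  let L : E3 →ₗᵢ[ℝ] E3 := ⟨(scale γ x)⁻¹ • (fderiv ℝ (act γ) x : E3 →ₗ[ℝ] E3), fun v => by
    have := norm_fderiv_act γ hx v
    simp [norm_smul, this, abs_of_pos hs, hs.ne']⟩
  have h1 : ((fderiv ℝ (act γ) x : E3 →L[ℝ] E3) : E3 →ₗ[ℝ] E3) = scale γ x • L.toLinearMap := by
    simp [L, smul_smul, hs.ne']
  have h2 : |LinearMap.det L.toLinearMap| = 1 := by
    rw [← LinearMap.normDet_eq_abs_det, L.normDet_eq_one]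
  rw [ContinuousLinearMap.det, h1, LinearMap.det_smul, abs_mul, h2, mul_one, abs_pow,
    abs_of_pos hs]
  simp

/-! ### Hyperbolic volume: invariance, comparison with Lebesgue measure, null sets. -/

/-- The Riemannian volume of `ℍ³` in coordinates. -/
def hvol : Measure E3 :=
  (volume.restrict upperHalfSpace).withDensity fun x => ENNReal.ofReal (1 / x 2 ^ 3)

theorem measurable_density : Measurable fun x : E3 => ENNReal.ofReal (1 / x 2 ^ 3) := by
  fun_prop

theorem map_val_vol : Measure.map Hyp3.val vol = hvol := by
  rw [vol, measurableEmbedding_val.map_comap, range_val, restrict_withDensity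
    measurableSet_upperHalfSpace, hvol]

theorem vol_preimage (s : Set E3) : vol (Hyp3.val ⁻¹' s) = hvol s := by
  rw [← map_val_vol, measurableEmbedding_val.map_apply]

theorem vol_eq_hvol_image (B : Set Hyp3) : vol B = hvol (Hyp3.val '' B) := by
  rw [← vol_preimage, preimage_image_eq _ val_injective]

theorem measurable_act (γ : Hyp3 ≃ᵢ Hyp3) : Measurable (act γ) := by
  classical
  have h : act γ = upperHalfSpace.piecewise (act γ) id := by
    ext1 x
    by_cases hx : x ∈ upperHalfSpace
    · simp [hx]
    · have : ¬ 0 < x 2 := hx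
      simp [hx, act, this]
  rw [h]
  exact measurable_of_restrict_of_restrict_compl measurableSet_upperHalfSpace
    (by
      rw [domRestrict_piecewise]
      exact (continuousOn_iff_continuous_domRestrict.1 (contDiffOn_act γ).continuousOn).measurable)
    (by
      rw [domRestrict_piecewise_compl]
      exact measurable_id.comp measurable_subtype_coe)

theorem lintegral_hvol (F : E3 → ENNReal) :
    ∫⁻ x, F x ∂hvol = ∫⁻ x in upperHalfSpace, ENNReal.ofReal (1 / x 2 ^ 3) * F x := by
  rw [hvol, lintegral_withDensity_eq_lintegral_mul_non_measurable _ measurable_density]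
  · rfl
  · exact Eventually.of_forall fun x => ENNReal.ofReal_lt_top

theorem integral_hvol (F : E3 → ℝ) :
    ∫ x, F x ∂hvol = ∫ x in upperHalfSpace, F x / x 2 ^ 3 := by
  rw [hvol, integral_withDensity_eq_integral_toReal_smul measurable_density
    (Eventually.of_forall fun x => ENNReal.ofReal_lt_top)]
  refine setIntegral_congr_fun measurableSet_upperHalfSpace fun x hx => ?_
  have hx2 : 0 < x 2 := hx
  change (ENNReal.ofReal (1 / x 2 ^ 3)).toReal • F x = _
  rw [ENNReal.toReal_ofReal (by positivity), smul_eq_mul]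
  field_simp

/-- In the change of variables the Jacobian is the cube of the ratio of heights, and it cancels
against the change of the density. -/
theorem measurePreserving_act (γ : Hyp3 ≃ᵢ Hyp3) : MeasurePreserving (act γ) hvol hvol := by
  refine ⟨measurable_act γ, ?_⟩
  ext s hs
  rw [Measure.map_apply (measurable_act γ) hs]
  rw [← lintegral_indicator_one hs, ← lintegral_indicator_one (measurable_act γ hs),
    lintegral_hvol, lintegral_hvol]
  conv_rhs => rw [← act_image γ]
  rw [lintegral_image_eq_lintegral_abs_det_fderiv_mul volume measurableSet_upperHalfSpace
    (fun x hx => (hasFDerivAt_act γ hx).hasFDerivWithinAt) (act_injOn γ)]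
  refine setLIntegral_congr_fun measurableSet_upperHalfSpace fun x hx => ?_
  have hs := scale_pos γ hx
  have hx2 : 0 < x 2 := hx
  have hA : 0 < act γ x 2 := act_mem γ hx
  change _ = ENNReal.ofReal |(fderiv ℝ (act γ) x).det| * (_ * _)
  rw [abs_det_fderiv_act γ hx, ← mul_assoc, ← ENNReal.ofReal_mul (by positivity)]
  rw [scale, show (act γ x 2 / x 2) ^ 3 * (1 / act γ x 2 ^ 3) = 1 / x 2 ^ 3 by field_simp]
  rfl

theorem measurePreserving_vol (γ : Hyp3 ≃ᵢ Hyp3) : MeasurePreserving γ vol vol := by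
  refine ⟨γ.continuous.measurable, ?_⟩
  ext s hs
  rw [Measure.map_apply γ.continuous.measurable hs, vol_eq_hvol_image s,
    vol_eq_hvol_image (γ ⁻¹' s)]
  have h1 := (measurePreserving_act γ).measure_preimage
    (measurableEmbedding_val.measurableSet_image.2 hs).nullMeasurableSet
  rw [← h1, ← vol_preimage (act γ ⁻¹' _)]
  rw [← vol_preimage, preimage_image_eq _ val_injective]
  congr 1
  ext p
  simp [act_val, val_injective.eq_iff]

/-- The similarity `x ↦ h x + (a₀, a₁, 0)` of the upper half-space taking `origin` to `a`,
whose height is `h`. -/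
def similarity (a : Hyp3) : Hyp3 ≃ᵢ Hyp3 where
  toFun p := ⟨a.val 2 • p.val + !₂[a.val 0, a.val 1, 0], by
    have := mul_pos a.pos p.pos
    simpa using this⟩
  invFun p := ⟨(a.val 2)⁻¹ • (p.val - !₂[a.val 0, a.val 1, 0]), by
    have := mul_pos (inv_pos.2 a.pos) p.pos
    simpa using this⟩
  left_inv p := by
    have := a.pos.ne'
    ext1
    simp [smul_smul, this]
  right_inv p := by
    have := a.pos.ne'
    ext1
    simp [smul_smul, this]
  isometry_toFun := Isometry.of_dist_eq fun p q => by
    have ha := a.pos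
    have hp := p.pos
    have hq := q.pos
    rw [dist_def, dist_def]
    congr 2
    simp only [dist_add_right, dist_smul₀, Real.norm_eq_abs, abs_of_pos ha]
    rw [show (a.val 2 • p.val + !₂[a.val 0, a.val 1, 0]) 2 *
      (a.val 2 • q.val + !₂[a.val 0, a.val 1, 0]) 2 = a.val 2 ^ 2 * (p.val 2 * q.val 2) by
        simp; ring, Real.sqrt_mul (by positivity), Real.sqrt_sq ha.le]
    field_simp

theorem similarity_origin (a : Hyp3) : similarity a origin = a := by
  ext1
  change a.val 2 • origin.val + !₂[a.val 0, a.val 1, 0] = a.val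
  ext i
  fin_cases i <;> simp [origin]

/-- Isometries preserve volume and `similarity a` carries the base point to a. -/
theorem vol_ball (a : Hyp3) (r : ℝ) : vol (Metric.ball a r) = vol (Metric.ball origin r) := by
  have h := (measurePreserving_vol (similarity a)).measure_preimage
    (Metric.isOpen_ball (x := a) (ε := r)).measurableSet.nullMeasurableSet
  rw [← h]
  congr 1
  ext p
  rw [mem_preimage, Metric.mem_ball, Metric.mem_ball]
  rw [← (similarity a).isometry.dist_eq p origin, similarity_origin]

/-- On a compact set, the hyperbolic volume is comparable with the Euclidean one. -/
theorem exists_height_bounds {K : Set E3} (hK : IsCompact K) (hKH : K ⊆ upperHalfSpace) :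
    ∃ c > 0, ∀ x ∈ K, c ≤ x 2 := by
  rcases K.eq_empty_or_nonempty with rfl | hne
  · exact ⟨1, one_pos, by simp⟩
  obtain ⟨x, hx, hm⟩ := hK.exists_isMinOn hne continuous_height.continuousOn
  exact ⟨x 2, hKH hx, fun y hy => hm hy⟩

theorem hvol_restrict_le {K : Set E3} (hK : IsCompact K) (hKH : K ⊆ upperHalfSpace) :
    ∃ C : NNReal, hvol.restrict K ≤ C • (volume.restrict K : Measure E3) := by
  obtain ⟨c, hc, hcK⟩ := exists_height_bounds hK hKH
  refine ⟨Real.toNNReal (1 / c ^ 3), ?_⟩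
  rw [hvol, restrict_withDensity hK.measurableSet, Measure.restrict_restrict hK.measurableSet,
    inter_eq_left.2 hKH]
  change _ ≤ ((1 / c ^ 3).toNNReal : ENNReal) • volume.restrict K
  rw [← withDensity_const]
  refine withDensity_mono ?_
  filter_upwards [ae_restrict_mem hK.measurableSet] with x hx
  have := hcK x hx
  change ENNReal.ofReal _ ≤ ENNReal.ofReal _
  gcongr

theorem volume_restrict_le {K : Set E3} (hK : IsCompact K) (hKH : K ⊆ upperHalfSpace) :
    ∃ C : NNReal, (volume.restrict K : Measure E3) ≤ C • hvol.restrict K := by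
  obtain ⟨c, hc⟩ := (hK.image continuous_height).bddAbove
  refine ⟨Real.toNNReal (c ^ 3), ?_⟩
  rw [hvol, restrict_withDensity hK.measurableSet, Measure.restrict_restrict hK.measurableSet,
    inter_eq_left.2 hKH]
  change _ ≤ ((c ^ 3).toNNReal : ENNReal) • (volume.restrict K).withDensity _
  rw [← withDensity_smul _ measurable_density]
  conv_lhs => rw [← withDensity_one (μ := volume.restrict K)]
  refine withDensity_mono ?_
  filter_upwards [ae_restrict_mem hK.measurableSet] with x hx
  have h1 : x 2 ≤ c := hc (mem_image_of_mem _ hx)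
  have h2 : 0 < x 2 := hKH hx
  have h3 : 0 < c := h2.trans_le h1
  change 1 ≤ ENNReal.ofReal _ * ENNReal.ofReal _
  rw [← ENNReal.ofReal_mul (by positivity), ENNReal.one_le_ofReal, mul_one_div,
    one_le_div (by positivity)]
  gcongr

theorem hvol_lt_top {K : Set E3} (hK : IsCompact K) (hKH : K ⊆ upperHalfSpace) : hvol K < ⊤ := by
  obtain ⟨C, hC⟩ := hvol_restrict_le hK hKH
  have := hC K
  simp only [Measure.restrict_apply_self, Measure.smul_apply] at this
  refine this.trans_lt ?_
  exact ENNReal.mul_lt_top ENNReal.coe_lt_top hK.measure_lt_top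

theorem vol_ball_lt_top (a : Hyp3) (r : ℝ) : vol (Metric.ball a r) < ⊤ := by
  refine (measure_mono Metric.ball_subset_closedBall).trans_lt ?_
  rw [vol_eq_hvol_image]
  refine hvol_lt_top ((isCompact_closedBall a r).image continuous_val) ?_
  rw [← range_val]
  exact image_subset_range _ _

/-- In coordinates the locus lies in a Euclidean plane if a and b have the same height, and
otherwise in a Euclidean sphere; both are Lebesgue null. -/
theorem vol_equidistant {a b : Hyp3} (hab : a ≠ b) : vol {p | dist p a = dist p b} = 0 := by
  have hsub : {p : Hyp3 | dist p a = dist p b} ⊆ Hyp3.val ⁻¹'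
      {x : E3 | b.val 2 * dist x a.val ^ 2 = a.val 2 * dist x b.val ^ 2} := by
    intro p (hp : dist p a = dist p b)
    have h1 := cosh_dist p a
    rw [hp, cosh_dist] at h1
    have h2 : chord p b = chord p a := by linarith
    have ha := a.pos
    have hb := b.pos
    have hp := p.pos
    rw [chord, chord] at h2
    field_simp at h2
    change _ = _
    linarith
  refine measure_mono_null hsub ?_
  rw [vol_preimage]
  refine (withDensity_absolutelyContinuous _ _) (Measure.restrict_le_self.absolutelyContinuous ?_)
  rcases eq_or_ne (a.val 2) (b.val 2) with h | h
  · have hne : AffineSubspace.perpBisector a.val b.val ≠ ⊤ := by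
      rw [Ne, AffineSubspace.perpBisector_eq_top]
      exact fun h => hab (val_injective h)
    refine measure_mono_null (fun x hx => ?_) (Measure.addHaar_affineSubspace volume _ hne)
    rw [SetLike.mem_coe, AffineSubspace.mem_perpBisector_iff_dist_eq]
    have hx' : b.val 2 * dist x a.val ^ 2 = a.val 2 * dist x b.val ^ 2 := hx
    rw [h] at hx'
    exact (sq_eq_sq₀ dist_nonneg dist_nonneg).1 (mul_left_cancel₀ b.pos.ne' hx')
  · have h' : b.val 2 - a.val 2 ≠ 0 := sub_ne_zero.2 h.symm
    set s := (b.val 2 - a.val 2)⁻¹ with hs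
    have hs1 : s * (b.val 2 - a.val 2) = 1 := inv_mul_cancel₀ h'
    -- Centre and squared radius come from completing the square in the equation of the locus.
    set c : E3 := s • (b.val 2 • a.val - a.val 2 • b.val) with hc
    set ρ := ‖c‖ ^ 2 - s * (b.val 2 * ‖a.val‖ ^ 2 - a.val 2 * ‖b.val‖ ^ 2)
    refine measure_mono_null (t := Metric.sphere c √ρ) (fun x hx => ?_)
      (Measure.addHaar_sphere volume _ _)
    have hx' : b.val 2 * dist x a.val ^ 2 = a.val 2 * dist x b.val ^ 2 := hx
    rw [dist_eq_norm, dist_eq_norm, norm_sub_sq_real, norm_sub_sq_real] at hx'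
    have h2 : dist x c ^ 2 = ρ := by
      rw [dist_eq_norm, norm_sub_sq_real]
      have : inner ℝ x c = s * (b.val 2 * inner ℝ x a.val - a.val 2 * inner ℝ x b.val) := by
        rw [hc, inner_smul_right, inner_sub_right, inner_smul_right, inner_smul_right]
      rw [this]
      simp only [ρ]
      linear_combination s * hx' - ‖x‖ ^ 2 * hs1
    rw [Metric.mem_sphere, ← h2, Real.sqrt_sq dist_nonneg]

/-- If γ moves q, then every fixed point is equidistant from q and γ q. -/
theorem vol_fixedPoints {γ : Hyp3 ≃ᵢ Hyp3} (hγ : γ ≠ 1) : vol {p | γ p = p} = 0 := by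
  obtain ⟨q, hq⟩ : ∃ q, γ q ≠ q := by
    by_contra! h
    exact hγ (IsometryEquiv.ext h)
  refine measure_mono_null (fun p hp => ?_) (vol_equidistant hq)
  change γ p = p at hp
  change dist p (γ q) = dist p q
  rw [← γ.isometry.dist_eq p q, hp]

end Hyp3
end

/-! ### Mollification in L². -/

noncomputable section

open Filter Topology
open scoped Convolution ENNReal

theorem sq_eLpNorm_two {α F : Type*} [MeasurableSpace α] [NormedAddCommGroup F] (f : α → F)
    (μ : Measure α) : eLpNorm f 2 μ ^ 2 = ∫⁻ x, ‖f x‖ₑ ^ 2 ∂μ := by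
  have := eLpNorm_nnreal_pow_eq_lintegral (f := f) (μ := μ) (p := 2) two_ne_zero
  simpa using this

/-- This is the continuity at zero of the translation action on L². -/
theorem exists_forall_eLpNorm_translate_le {F : Type*} [NormedAddCommGroup F] {w : E3 → F}
    (hw : MemLp w 2 volume) {ε : ℝ≥0∞} (hε : 0 < ε) :
    ∃ δ > 0, ∀ y : E3, ‖y‖ < δ → eLpNorm (fun x => w (x - y) - w x) 2 volume ≤ ε := by
  have : Fact ((2 : ℝ≥0∞) ≠ ⊤) := ⟨by simp⟩
  let f := hw.toLp w
  have hc : Continuous fun y : E3 => DomAddAct.mk y +ᵥ f :=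
    Continuous.vadd DomAddAct.continuous_mk continuous_const
  have h0 : Tendsto (fun y : E3 => edist (DomAddAct.mk y +ᵥ f) f) (𝓝 0) (𝓝 0) := by
    have h := (hc.edist continuous_const).tendsto (x := (0 : E3))
      (f := fun y : E3 => edist (DomAddAct.mk y +ᵥ f) f)
    simpa using h
  obtain ⟨δ, hδ, h⟩ := Metric.eventually_nhds_iff.1 (h0.eventually_le_const hε)
  refine ⟨δ, hδ, fun y hy => ?_⟩
  have h1 := @h (-y) (by simpa using hy)
  rw [DomAddAct.mk_vadd_toLp, Lp.edist_toLp_toLp] at h1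
  convert! h1 using 3
  simp [sub_eq_neg_add]

theorem sq_lintegral_le {α : Type*} [MeasurableSpace α] {ν : Measure α} [IsProbabilityMeasure ν]
    {g : α → ℝ≥0∞} (hg : AEMeasurable g ν) : (∫⁻ y, g y ∂ν) ^ 2 ≤ ∫⁻ y, g y ^ 2 ∂ν := by
  have h := ENNReal.lintegral_mul_le_Lp_mul_Lq ν Real.HolderConjugate.two_two hg
    (aemeasurable_const (b := (1 : ℝ≥0∞)))
  simp only [Pi.mul_apply, mul_one, ENNReal.one_rpow, lintegral_const, measure_univ] at h
  calc (∫⁻ y, g y ∂ν) ^ 2 ≤ ((∫⁻ y, g y ^ (2 : ℝ) ∂ν) ^ (1 / 2 : ℝ)) ^ 2 := by gcongr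
    _ = ∫⁻ y, g y ^ 2 ∂ν := by
      rw [← ENNReal.rpow_natCast, ← ENNReal.rpow_mul]
      simp

/-- Mollifications converge in `L²`. -/
theorem exists_forall_eLpNorm_mollify_le {F : Type*} [NormedAddCommGroup F] [NormedSpace ℝ F]
    [CompleteSpace F] {w : E3 → F} (hw : MemLp w 2 volume) {ε : ℝ≥0∞} (hε : 0 < ε) :
    ∃ δ > 0, ∀ φ : ContDiffBump (0 : E3), φ.rOut < δ →
      eLpNorm (fun x => (φ.normed volume ⋆[ContinuousLinearMap.lsmul ℝ ℝ, volume] w) x - w x)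
        2 volume ≤ ε := by
  -- Changing w on a null set changes neither the convolution nor the norm; strong measurability is
  -- needed for the exchange of integrals below.
  wlog hsm : StronglyMeasurable w generalizing w
  · have hae := hw.1.ae_eq_mk
    obtain ⟨δ, hδ, h⟩ := this (hw.ae_eq hae) hw.1.stronglyMeasurable_mk
    refine ⟨δ, hδ, fun φ hφ => (le_of_eq ?_).trans (h φ hφ)⟩
    refine eLpNorm_congr_ae ?_
    filter_upwards [hae] with x hx
    rw [← hx]
    congr 1
    refine integral_congr_ae ?_
    have := (Measure.measurePreserving_sub_left volume x).quasiMeasurePreserving.ae_eq_comp hae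
    filter_upwards [this] with y hy
    simp only [Function.comp_apply] at hy
    rw [hy]
  obtain ⟨δ, hδ, h⟩ := exists_forall_eLpNorm_translate_le hw hε
  refine ⟨δ, hδ, fun φ hφ => ?_⟩
  have hφc : Continuous (φ.normed volume) := φ.continuous_normed
  -- The error of mollification is an average, over this probability measure, of the differences
  -- between w and its translates. Jensen's inequality and Tonelli's theorem then reduce it to small
  -- translations.
  let ν : Measure E3 := volume.withDensity fun y => ENNReal.ofReal (φ.normed volume y)
  have hm : Measurable fun y => ENNReal.ofReal (φ.normed volume y) := by fun_prop
  have hν : IsProbabilityMeasure ν := ⟨by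
    rw [withDensity_apply _ MeasurableSet.univ, Measure.restrict_univ,
      ← ofReal_integral_eq_lintegral_ofReal, φ.integral_normed, ENNReal.ofReal_one]
    · exact φ.integrable_normed
    · exact Eventually.of_forall φ.nonneg_normed⟩
  have hwm : Measurable fun p : E3 × E3 => ‖w (p.1 - p.2) - w p.1‖ₑ :=
    ((hsm.comp_measurable (measurable_fst.sub measurable_snd)).sub
      (hsm.comp_measurable measurable_fst)).enorm
  have hloc : LocallyIntegrable w volume := hw.locallyIntegrable (by norm_num)
  have hpt : ∀ x, ‖(φ.normed volume ⋆[ContinuousLinearMap.lsmul ℝ ℝ, volume] w) x - w x‖ₑ ≤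
      ∫⁻ y, ‖w (x - y) - w x‖ₑ ∂ν := by
    intro x
    have hex := φ.hasCompactSupport_normed.convolutionExists_left
      (ContinuousLinearMap.lsmul ℝ ℝ) hφc hloc x (μ := volume)
    have hi2 : Integrable (fun y => φ.normed volume y • w x) :=
      φ.integrable_normed.smul_const _
    have h1 : (φ.normed volume ⋆[ContinuousLinearMap.lsmul ℝ ℝ, volume] w) x - w x =
        ∫ y, φ.normed volume y • (w (x - y) - w x) := by
      simp_rw [smul_sub]
      have hex' : Integrable (fun y => φ.normed volume y • w (x - y)) := hex
      rw [integral_sub hex' hi2, φ.integral_normed_smul]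
      rfl
    have h2 : Measurable fun y => ‖w (x - y) - w x‖ₑ := hwm.comp measurable_prodMk_left
    rw [h1, lintegral_withDensity_eq_lintegral_mul _ hm h2]
    refine (enorm_integral_le_lintegral_enorm _).trans (le_of_eq (lintegral_congr fun y => ?_))
    simp only [Pi.mul_apply, enorm_smul, Real.enorm_eq_ofReal (φ.nonneg_normed y)]
  have hsq : ∫⁻ x, ‖(φ.normed volume ⋆[ContinuousLinearMap.lsmul ℝ ℝ, volume] w) x - w x‖ₑ ^ 2 ≤
      ε ^ 2 := by
    calc _ ≤ ∫⁻ x, ∫⁻ y, ‖w (x - y) - w x‖ₑ ^ 2 ∂ν := lintegral_mono fun x =>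
          (pow_le_pow_left₀ zero_le (hpt x) 2).trans
            (sq_lintegral_le (hwm.comp measurable_prodMk_left).aemeasurable)
      _ = ∫⁻ y, (∫⁻ x, ‖w (x - y) - w x‖ₑ ^ 2) ∂ν :=
          lintegral_lintegral_swap (hwm.pow_const 2).aemeasurable
      _ ≤ ∫⁻ _, ε ^ 2 ∂ν := by
          refine lintegral_mono_ae ?_
          have hsupp : ∀ᵐ y ∂ν, ‖y‖ < δ := by
            rw [ae_withDensity_iff hm]
            refine Eventually.of_forall fun y hy => ?_
            have : y ∈ Function.support (φ.normed volume) := by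
              intro h0
              simp [h0] at hy
            rw [φ.support_normed_eq, mem_ball_zero_iff] at this
            exact this.trans hφ
          filter_upwards [hsupp] with y hy
          rw [← sq_eLpNorm_two (fun x => w (x - y) - w x)]
          exact pow_le_pow_left₀ zero_le (h y hy) 2
      _ = ε ^ 2 := by simp
  rw [← sq_eLpNorm_two] at hsq
  exact (ENNReal.pow_le_pow_left_iff two_ne_zero).1 hsq
end

/-! ### Cut-offs, local square integrability, approximation by test functions. -/

noncomputable section

open Filter Topology
open scoped Convolution ENNReal

/-- The value 1 is attained on a neighbourhood of K, so that the gradient of the cut-off vanishes on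
K as well. -/
theorem exists_cutoff {K : Set E3} (hK : IsCompact K) (hKH : K ⊆ upperHalfSpace) :
    ∃ η : E3 → ℝ, IsTestFunction η ∧ (∀ x, 0 ≤ η x) ∧ (∀ x, η x ≤ 1) ∧
      ∃ V, IsOpen V ∧ K ⊆ V ∧ ∀ x ∈ V, η x = 1 := by
  obtain ⟨δ, hδ, hδH⟩ := hK.exists_cthickening_subset_open isOpen_upperHalfSpace hKH
  obtain ⟨η, h1, h2, h3, h4⟩ := exists_contMDiff_support_eq_eq_one_iff (n := (⊤ : ℕ∞))
    (modelWithCornersSelf ℝ E3)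
    (Metric.isOpen_thickening (δ := δ) (E := K)) (Metric.isClosed_cthickening (δ := δ / 2) (E := K))
    (Metric.cthickening_subset_thickening' hδ (half_lt_self hδ) K)
  have hts : tsupport η ⊆ Metric.cthickening δ K := by
    rw [tsupport, h3]
    exact closure_minimal (Metric.thickening_subset_cthickening _ _) Metric.isClosed_cthickening
  refine ⟨η, ⟨h1.contDiff, ?_, hts.trans hδH⟩, fun x => (h2 (mem_range_self x)).1,
    fun x => (h2 (mem_range_self x)).2, Metric.thickening (δ / 2) K, Metric.isOpen_thickening,
    Metric.self_subset_thickening (half_pos hδ) K, fun x hx => (h4 x).1 ?_⟩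
  · exact hK.cthickening.of_isClosed_subset (isClosed_tsupport _) hts
  · exact Metric.thickening_subset_cthickening _ _ hx

theorem continuous_gradient {φ : E3 → ℝ} (hφ : ContDiff ℝ ∞ φ) : Continuous (gradient φ) :=
  (LinearIsometryEquiv.continuous _).comp (hφ.continuous_fderiv (by simp))

theorem support_gradient_subset (φ : E3 → ℝ) : Function.support (gradient φ) ⊆ tsupport φ := by
  intro x hx
  apply support_fderiv_subset ℝ
  intro h
  apply hx
  simp [gradient, h]

theorem gradient_eq_zero_of_notMem {φ : E3 → ℝ} {x : E3} (hx : x ∉ tsupport φ) :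
    gradient φ x = 0 := by
  by_contra h
  exact hx (support_gradient_subset φ h)

namespace IsTestFunction

variable {φ : E3 → ℝ}

theorem continuous (h : IsTestFunction φ) : Continuous φ := h.1.continuous

theorem differentiable (h : IsTestFunction φ) : Differentiable ℝ φ := h.1.differentiable (by simp)

theorem smul_left (h : IsTestFunction φ) {ψ : E3 → ℝ} (hψ : ContDiff ℝ ∞ ψ) :
    IsTestFunction fun x => ψ x * φ x :=
  ⟨hψ.mul h.1, h.2.1.mul_left, (tsupport_mul_subset_right (f := ψ)).trans h.2.2⟩

theorem eq_zero_of_notMem (h : IsTestFunction φ) {x : E3} (hx : x ∉ upperHalfSpace) : φ x = 0 :=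
  image_eq_zero_of_notMem_tsupport fun h' => hx (h.2.2 h')

theorem gradient_eq_zero (h : IsTestFunction φ) {x : E3} (hx : x ∉ upperHalfSpace) :
    gradient φ x = 0 := gradient_eq_zero_of_notMem fun h' => hx (h.2.2 h')

theorem fderiv_eq_zero (h : IsTestFunction φ) {x : E3} (hx : x ∉ upperHalfSpace) :
    fderiv ℝ φ x = 0 := by
  rw [← toDual_gradient, h.gradient_eq_zero hx, map_zero]

end IsTestFunction

namespace MemL2Loc

variable {F : Type*} [NormedAddCommGroup F] {u v : E3 → F}

theorem add (hu : MemL2Loc u) (hv : MemL2Loc v) : MemL2Loc (fun x => u x + v x) :=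
  fun K hK hKH => (hu K hK hKH).add (hv K hK hKH)

theorem sub (hu : MemL2Loc u) (hv : MemL2Loc v) : MemL2Loc (fun x => u x - v x) :=
  fun K hK hKH => (hu K hK hKH).sub (hv K hK hKH)

theorem const_smul [NormedSpace ℝ F] (hu : MemL2Loc u) (c : ℝ) : MemL2Loc (fun x => c • u x) :=
  fun K hK hKH => (hu K hK hKH).const_smul c

theorem _root_.ContinuousOn.memL2Loc (hu : ContinuousOn u upperHalfSpace) :
    MemL2Loc u := fun K hK hKH => by
  have : IsFiniteMeasure (volume.restrict K : Measure E3) := ⟨by simpa using hK.measure_lt_top⟩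
  obtain ⟨C, hC⟩ := hK.exists_bound_of_continuousOn (hu.mono hKH)
  refine MemLp.of_bound ((hu.mono hKH).aestronglyMeasurable_of_isCompact hK hK.measurableSet) C ?_
  filter_upwards [ae_restrict_mem hK.measurableSet] with x hx using hC x hx

theorem memLp_smul [NormedSpace ℝ F] (hu : MemL2Loc u) {g : E3 → ℝ} (hg : Continuous g)
    (hgc : HasCompactSupport g) (hgH : tsupport g ⊆ upperHalfSpace) :
    MemLp (fun x => g x • u x) 2 volume := by
  have h1 := (memLp_indicator_iff_restrict hgc.isCompact.measurableSet).2
    (hu _ hgc.isCompact hgH)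
  obtain ⟨C, hC⟩ := hgc.exists_bound_of_continuous hg
  have he : (fun x => g x • u x) = fun x => g x • (tsupport g).indicator u x := by
    ext1 x
    by_cases hx : x ∈ tsupport g
    · simp [hx]
    · simp [image_eq_zero_of_notMem_tsupport hx]
  rw [he]
  refine h1.of_le_mul (c := C) (hg.aestronglyMeasurable.smul h1.1)
    (Eventually.of_forall fun x => ?_)
  rw [norm_smul]
  exact mul_le_mul_of_nonneg_right (hC x) (norm_nonneg _)

theorem integrable_smul [NormedSpace ℝ F] (hu : MemL2Loc u) {g : E3 → ℝ} (hg : Continuous g)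
    (hgc : HasCompactSupport g) (hgH : tsupport g ⊆ upperHalfSpace) :
    Integrable (fun x => g x • u x) volume := by
  have h1 := hu.memLp_smul hg hgc hgH
  have : IsFiniteMeasure (volume.restrict (tsupport g) : Measure E3) :=
    ⟨by simpa using hgc.isCompact.measure_lt_top⟩
  have h2 : IntegrableOn (fun x => g x • u x) (tsupport g) volume :=
    (h1.restrict _).integrable (by norm_num)
  rwa [integrableOn_iff_integrable_of_support_subset] at h2
  refine Function.support_subset_iff'.2 fun x hx => ?_
  simp [image_eq_zero_of_notMem_tsupport hx]

theorem locallyIntegrableOn (hu : MemL2Loc u) : LocallyIntegrableOn u upperHalfSpace volume := by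
  rw [locallyIntegrableOn_iff isOpen_upperHalfSpace.isLocallyClosed]
  intro K hKH hK
  have : IsFiniteMeasure (volume.restrict K : Measure E3) := ⟨by simpa using hK.measure_lt_top⟩
  exact (hu K hK hKH).integrable (by norm_num)

end MemL2Loc

/-- A compactly supported `H¹` function is a limit of test functions in `H¹`. -/
theorem exists_seq_testFunction {w : E3 → ℝ} {W : E3 → E3} (hw : MemLp w 2 volume)
    (hW : MemLp W 2 volume) {K : Set E3} (hK : IsCompact K) (hKH : K ⊆ upperHalfSpace)
    (hwK : ∀ x ∉ K, w x = 0)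
    (hweak : ∀ φ : E3 → ℝ, ContDiff ℝ ∞ φ → HasCompactSupport φ → ∀ v : E3,
      ∫ x, w x * fderiv ℝ φ x v = - ∫ x, inner ℝ (W x) v * φ x) :
    ∃ (K' : Set E3) (φ : ℕ → E3 → ℝ), IsCompact K' ∧ K' ⊆ upperHalfSpace ∧
      (∀ n, IsTestFunction (φ n)) ∧ (∀ n, tsupport (φ n) ⊆ K') ∧
      Tendsto (fun n => eLpNorm (fun x => φ n x - w x) 2 volume) atTop (𝓝 0) ∧
      Tendsto (fun n => eLpNorm (fun x => gradient (φ n) x - W x) 2 volume) atTop (𝓝 0) := by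
  obtain ⟨δ, hδ, hδH⟩ := hK.exists_cthickening_subset_open isOpen_upperHalfSpace hKH
  have hwl : LocallyIntegrable w volume := hw.locallyIntegrable (by norm_num)
  have hWl : LocallyIntegrable W volume := hW.locallyIntegrable (by norm_num)
  -- Differentiation falls on the bump, and the weak identity is applied to y ↦ ρ (x - y). The sign
  -- from this reflection cancels the sign of the integration by parts.
  have hgrad : ∀ ρ : ContDiffBump (0 : E3), ∀ x,
      gradient (ρ.normed volume ⋆[ContinuousLinearMap.lsmul ℝ ℝ, volume] w) x =
        (ρ.normed volume ⋆[ContinuousLinearMap.lsmul ℝ ℝ, volume] W) x := by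
    intro ρ x
    refine ext_inner_right ℝ fun v => ?_
    have hρ1 : ContDiff ℝ 1 (ρ.normed (volume : Measure E3)) := ρ.contDiff_normed
    have hd := ρ.hasCompactSupport_normed.hasFDerivAt_convolution_left
      (ContinuousLinearMap.lsmul ℝ ℝ) (μ := (volume : Measure E3)) hρ1 hwl x
    have hex := (ρ.hasCompactSupport_normed (μ := (volume : Measure E3)).fderiv
      (𝕜 := ℝ)).convolutionExists_left
      ((ContinuousLinearMap.lsmul ℝ ℝ : ℝ →L[ℝ] ℝ →L[ℝ] ℝ).precompL E3)
      (hρ1.continuous_fderiv (by simp)) hwl x (μ := volume)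
    rw [inner_gradient_left, hd.fderiv, convolution_def, ContinuousLinearMap.integral_apply hex]
    have hexW : Integrable (fun t => ρ.normed volume t • W (x - t)) :=
      ρ.hasCompactSupport_normed.convolutionExists_left
      (ContinuousLinearMap.lsmul ℝ ℝ) ρ.continuous_normed hWl x (μ := volume)
    rw [convolution_def, real_inner_comm]
    simp only [ContinuousLinearMap.precompL_apply, ContinuousLinearMap.lsmul_apply, smul_eq_mul]
    rw [← integral_inner hexW]
    have h1 := hweak (fun y => ρ.normed volume (x - y)) (ρ.contDiff_normed.comp (by fun_prop))
      (by
        have := ρ.hasCompactSupport_normed (μ := (volume : Measure E3))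
        exact this.comp_homeomorph (Homeomorph.subLeft x)) v
    have h2 : ∀ y, fderiv ℝ (fun y => ρ.normed volume (x - y)) y v =
        - fderiv ℝ (ρ.normed volume) (x - y) v := by
      intro y
      have hd1 : HasFDerivAt (ρ.normed volume) (fderiv ℝ (ρ.normed volume) (x - y)) (x - y) :=
        ((hρ1.differentiable (by simp)) _).hasFDerivAt
      have hd2 : HasFDerivAt (fun y : E3 => x - y) (-ContinuousLinearMap.id ℝ E3) y :=
        (hasFDerivAt_id y).const_sub x
      have hd3 := (hd1.comp y hd2).fderiv
      change fderiv ℝ (ρ.normed volume ∘ fun y => x - y) y v = _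
      rw [hd3]
      simp
    simp only [h2, mul_neg, integral_neg, neg_inj] at h1
    rw [← integral_sub_left_eq_self _ volume x]
    rw [← integral_sub_left_eq_self (fun t => inner ℝ v (ρ.normed volume t • W (x - t))) volume x]
    simp only [sub_sub_cancel]
    simp only [mul_comm (w _)] at h1
    rw [h1]
    refine integral_congr_ae (Eventually.of_forall fun y => ?_)
    simp only [inner_smul_right, real_inner_comm v]
    ring
  have hkey : ∀ n : ℕ, ∃ φ : E3 → ℝ, IsTestFunction φ ∧ tsupport φ ⊆ Metric.cthickening δ K ∧
      eLpNorm (fun x => φ x - w x) 2 volume ≤ ENNReal.ofReal (1 / (n + 1)) ∧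
      eLpNorm (fun x => gradient φ x - W x) 2 volume ≤ ENNReal.ofReal (1 / (n + 1)) := by
    intro n
    have hε : 0 < ENNReal.ofReal (1 / ((n : ℝ) + 1)) := by
      rw [ENNReal.ofReal_pos]; positivity
    obtain ⟨δ₁, hδ₁, h₁⟩ := exists_forall_eLpNorm_mollify_le hw hε
    obtain ⟨δ₂, hδ₂, h₂⟩ := exists_forall_eLpNorm_mollify_le hW hε
    -- The bound δ keeps the support inside the thickening of K; δ₁ and δ₂ make both errors small.
    set r := min δ (min δ₁ δ₂) / 2 with hr
    have hr0 : 0 < r := by positivity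
    have hrlt : r < min δ (min δ₁ δ₂) := half_lt_self (by positivity)
    let ρ : ContDiffBump (0 : E3) := ⟨r / 2, r, half_pos hr0, half_lt_self hr0⟩
    have hts : tsupport (ρ.normed volume ⋆[ContinuousLinearMap.lsmul ℝ ℝ, volume] w) ⊆
        Metric.cthickening δ K := by
      refine closure_minimal ((support_convolution_subset _).trans ?_) Metric.isClosed_cthickening
      rintro _ ⟨a, ha, b, hb, rfl⟩
      rw [ρ.support_normed_eq, mem_ball_zero_iff] at ha
      have hbK : b ∈ K := by
        by_contra h
        exact hb (hwK b h)
      refine Metric.mem_cthickening_of_dist_le _ b _ _ hbK ?_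
      simp only [dist_add_self_left]
      exact ha.le.trans (hrlt.le.trans (min_le_left _ _))
    refine ⟨ρ.normed volume ⋆[ContinuousLinearMap.lsmul ℝ ℝ, volume] w, ⟨?_, ?_, hts.trans hδH⟩,
      hts, ?_, ?_⟩
    · exact ρ.hasCompactSupport_normed.contDiff_convolution_left _ ρ.contDiff_normed hwl
    · exact hK.cthickening.of_isClosed_subset (isClosed_tsupport _) hts
    · exact h₁ ρ (hrlt.trans_le ((min_le_right _ _).trans (min_le_left _ _)))
    · simp_rw [hgrad ρ]
      exact h₂ ρ (hrlt.trans_le ((min_le_right _ _).trans (min_le_right _ _)))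
  choose φ h1 h2 h3 h4 using hkey
  have hlim : Tendsto (fun n : ℕ => ENNReal.ofReal (1 / ((n : ℝ) + 1))) atTop (𝓝 0) := by
    simpa [Function.comp_def] using (ENNReal.continuous_ofReal.tendsto 0).comp
      (tendsto_one_div_add_atTop_nhds_zero_nat (𝕜 := ℝ))
  exact ⟨_, φ, hK.cthickening, hδH, h1, h2,
    tendsto_of_tendsto_of_tendsto_of_le_of_le tendsto_const_nhds hlim (fun _ => zero_le) h3,
    tendsto_of_tendsto_of_tendsto_of_le_of_le tendsto_const_nhds hlim (fun _ => zero_le) h4⟩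

end

/-! ### Calculus of weak gradients. -/

noncomputable section

open Filter Topology
open scoped Convolution ENNReal

theorem tendsto_integral_inner {α F : Type*} [MeasurableSpace α] {μ : Measure α}
    [NormedAddCommGroup F] [InnerProductSpace ℝ F] {f g : ℕ → α → F} {f₀ g₀ : α → F}
    (hf : ∀ n, MemLp (f n) 2 μ) (hg : ∀ n, MemLp (g n) 2 μ) (hf₀ : MemLp f₀ 2 μ)
    (hg₀ : MemLp g₀ 2 μ)
    (hfl : Tendsto (fun n => eLpNorm (fun x => f n x - f₀ x) 2 μ) atTop (𝓝 0))
    (hgl : Tendsto (fun n => eLpNorm (fun x => g n x - g₀ x) 2 μ) atTop (𝓝 0)) :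
    Tendsto (fun n => ∫ x, inner ℝ (f n x) (g n x) ∂μ) atTop
      (𝓝 (∫ x, inner ℝ (f₀ x) (g₀ x) ∂μ)) := by
  have h1 : Tendsto (fun n => (hf n).toLp) atTop (𝓝 hf₀.toLp) :=
    (Lp.tendsto_Lp_iff_tendsto_eLpNorm'' f hf f₀ hf₀).2 hfl
  have h2 : Tendsto (fun n => (hg n).toLp) atTop (𝓝 hg₀.toLp) :=
    (Lp.tendsto_Lp_iff_tendsto_eLpNorm'' g hg g₀ hg₀).2 hgl
  have h3 := h1.inner (𝕜 := ℝ) h2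
  have key : ∀ {a b : α → F} (ha : MemLp a 2 μ) (hb : MemLp b 2 μ),
      inner ℝ ha.toLp hb.toLp = ∫ x, inner ℝ (a x) (b x) ∂μ := by
    intro a b ha hb
    rw [L2.inner_def]
    refine integral_congr_ae ?_
    filter_upwards [ha.coeFn_toLp, hb.coeFn_toLp] with x hx hx'
    rw [hx, hx']
  simpa only [key] using h3

theorem tendsto_integral_mul {α : Type*} [MeasurableSpace α] {μ : Measure α}
    {f g : ℕ → α → ℝ} {f₀ g₀ : α → ℝ}
    (hf : ∀ n, MemLp (f n) 2 μ) (hg : ∀ n, MemLp (g n) 2 μ) (hf₀ : MemLp f₀ 2 μ)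
    (hg₀ : MemLp g₀ 2 μ)
    (hfl : Tendsto (fun n => eLpNorm (fun x => f n x - f₀ x) 2 μ) atTop (𝓝 0))
    (hgl : Tendsto (fun n => eLpNorm (fun x => g n x - g₀ x) 2 μ) atTop (𝓝 0)) :
    Tendsto (fun n => ∫ x, f n x * g n x ∂μ) atTop (𝓝 (∫ x, f₀ x * g₀ x ∂μ)) := by
  simpa [mul_comm] using tendsto_integral_inner hf hg hf₀ hg₀ hfl hgl

theorem MemL2Loc.memLp_smul_continuous {F : Type*} [NormedAddCommGroup F] [NormedSpace ℝ F]
    {u : E3 → ℝ} (hu : MemL2Loc u) {g : E3 → F} (hg : Continuous g)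
    (hgc : HasCompactSupport g) (hgH : tsupport g ⊆ upperHalfSpace) :
    MemLp (fun x => u x • g x) 2 volume := by
  obtain ⟨θ, hθ, -, -, V, -, hKV, hV⟩ := exists_cutoff hgc.isCompact hgH
  have h1 := hu.memLp_smul hθ.continuous hθ.2.1 hθ.2.2
  obtain ⟨C, hC⟩ := hgc.exists_bound_of_continuous hg
  have he : (fun x => u x • g x) = fun x => (θ x • u x) • g x := by
    ext1 x
    by_cases hx : x ∈ tsupport g
    · simp [hV x (hKV hx)]
    · simp [image_eq_zero_of_notMem_tsupport hx]
  rw [he]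
  refine h1.of_le_mul (c := C) (h1.1.smul hg.aestronglyMeasurable)
    (Eventually.of_forall fun x => ?_)
  rw [norm_smul, mul_comm]
  exact mul_le_mul_of_nonneg_right (hC x) (norm_nonneg _)

theorem hasCompactSupport_gradient {φ : E3 → ℝ} (hφ : HasCompactSupport φ) :
    HasCompactSupport (gradient φ) :=
  hφ.mono' (support_gradient_subset φ)

theorem tsupport_gradient_subset (φ : E3 → ℝ) : tsupport (gradient φ) ⊆ tsupport φ :=
  closure_minimal (support_gradient_subset φ) (isClosed_tsupport φ)

theorem tsupport_fderiv_apply_subset' (φ : E3 → ℝ) (v : E3) :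
    tsupport (fun x => fderiv ℝ φ x v) ⊆ tsupport φ := by
  refine closure_minimal (fun x hx => ?_) (isClosed_tsupport φ)
  apply support_fderiv_subset ℝ
  intro h
  exact hx (by simp [h])

theorem IsTestFunction.hasCompactSupport_fderiv_apply {φ : E3 → ℝ} (hφ : IsTestFunction φ)
    (v : E3) : HasCompactSupport (fun x => fderiv ℝ φ x v) :=
  hφ.2.1.mono' ((subset_tsupport _).trans (tsupport_fderiv_apply_subset' φ v))

theorem IsTestFunction.continuous_fderiv_apply {φ : E3 → ℝ} (hφ : IsTestFunction φ)
    (v : E3) : Continuous (fun x => fderiv ℝ φ x v) :=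
  (hφ.1.continuous_fderiv (by simp)).clm_apply continuous_const

namespace MemL2Loc

variable {F : Type*} [NormedAddCommGroup F] [NormedSpace ℝ F] {u : E3 → F} {φ : E3 → ℝ}

theorem integrable_smul_test (hu : MemL2Loc u) (hφ : IsTestFunction φ) :
    Integrable (fun x => φ x • u x) volume :=
  hu.integrable_smul hφ.continuous hφ.2.1 hφ.2.2

theorem integrable_fderiv_smul_test (hu : MemL2Loc u) (hφ : IsTestFunction φ) (v : E3) :
    Integrable (fun x => fderiv ℝ φ x v • u x) volume :=
  hu.integrable_smul (hφ.continuous_fderiv_apply v) (hφ.hasCompactSupport_fderiv_apply v)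
    ((tsupport_fderiv_apply_subset' φ v).trans hφ.2.2)

theorem inner_const {G : E3 → E3} (hG : MemL2Loc G) (v : E3) :
    MemL2Loc fun x => inner ℝ (G x) v :=
  fun K hK hKH => (hG K hK hKH).inner_const v

end MemL2Loc

namespace HasWeakGradient

variable {u : E3 → ℝ} {G : E3 → E3}

theorem integral_eq (h : HasWeakGradient u G) {φ : E3 → ℝ} (hφ : IsTestFunction φ) (v : E3) :
    ∫ x, u x * fderiv ℝ φ x v = - ∫ x, inner ℝ (G x) v * φ x := by
  have := h.2.2 φ hφ v
  rwa [setIntegral_eq_integral_of_forall_compl_eq_zero,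
    setIntegral_eq_integral_of_forall_compl_eq_zero] at this
  · intro x hx
    rw [hφ.eq_zero_of_notMem hx, mul_zero]
  · intro x hx
    rw [hφ.fderiv_eq_zero hx]
    simp

theorem memLp_cutoff (h : HasWeakGradient u G) {η : E3 → ℝ} (hη : IsTestFunction η) :
    MemLp (fun x => η x * u x) 2 volume :=
  h.1.memLp_smul hη.continuous hη.2.1 hη.2.2

theorem memLp_gradient_cutoff (h : HasWeakGradient u G) {η : E3 → ℝ} (hη : IsTestFunction η) :
    MemLp (fun x => η x • G x + u x • gradient η x) 2 volume :=
  (h.2.1.memLp_smul hη.continuous hη.2.1 hη.2.2).add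
    (h.1.memLp_smul_continuous (continuous_gradient hη.1) (hasCompactSupport_gradient hη.2.1)
      ((tsupport_gradient_subset η).trans hη.2.2))

/-- The product rule for a weakly differentiable function and a test function. -/
theorem integral_cutoff (h : HasWeakGradient u G) {η : E3 → ℝ} (hη : IsTestFunction η)
    {φ : E3 → ℝ} (hφ : ContDiff ℝ ∞ φ) (v : E3) :
    ∫ x, (η x * u x) * fderiv ℝ φ x v =
      - ∫ x, inner ℝ (η x • G x + u x • gradient η x) v * φ x := by
  -- The weak identity for u is tested with φ η, a test function although φ need not have compact
  -- support.
  have hηφ : IsTestFunction fun x => φ x * η x := hη.smul_left hφ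
  have hφd : Differentiable ℝ φ := hφ.differentiable (by simp)
  have h1 := h.integral_eq hηφ v
  have h2 : ∀ x, fderiv ℝ (fun x => φ x * η x) x v =
      φ x * fderiv ℝ η x v + η x * fderiv ℝ φ x v := by
    intro x
    rw [fderiv_fun_mul (hφd x) (hη.differentiable x)]
    simp
  have i1 : Integrable (fun x => u x * (φ x * fderiv ℝ η x v)) := by
    have := h.1.integrable_smul (g := fun x => φ x * fderiv ℝ η x v)
      (hφ.continuous.mul (hη.continuous_fderiv_apply v)) (hη.hasCompactSupport_fderiv_apply v).mul_left
      ((tsupport_mul_subset_right (f := φ)).trans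
        ((tsupport_fderiv_apply_subset' η v).trans hη.2.2))
    simpa [mul_comm] using this
  have i2 : Integrable (fun x => u x * (η x * fderiv ℝ φ x v)) := by
    have := h.1.integrable_smul (g := fun x => η x * fderiv ℝ φ x v)
      (hη.continuous.mul ((hφ.continuous_fderiv (by simp)).clm_apply continuous_const))
      hη.2.1.mul_right ((tsupport_mul_subset_left (f := η)).trans hη.2.2)
    simpa [mul_comm] using this
  have i3 : Integrable (fun x => inner ℝ (G x) v * (φ x * η x)) := by
    simpa [mul_comm] using (h.2.1.inner_const v).integrable_smul_test hηφ
  simp only [h2, mul_add] at h1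
  rw [integral_add i1 i2] at h1
  have h3 : ∀ x, inner ℝ (η x • G x + u x • gradient η x) v * φ x =
      inner ℝ (G x) v * (φ x * η x) + u x * (φ x * fderiv ℝ η x v) := by
    intro x
    rw [inner_add_left, real_inner_smul_left, real_inner_smul_left, inner_gradient_left]
    ring
  simp only [h3]
  rw [integral_add i3 i1]
  have h4 : ∀ x, η x * u x * fderiv ℝ φ x v = u x * (η x * fderiv ℝ φ x v) := fun x => by ring
  simp only [h4]
  linarith

/-- All the approximants are supported in one compact set, so integrals weighted by powers of the
height pass to the limit too. -/
theorem exists_seq_cutoff (h : HasWeakGradient u G) {η : E3 → ℝ} (hη : IsTestFunction η) :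
    ∃ (K' : Set E3) (φ : ℕ → E3 → ℝ), IsCompact K' ∧ K' ⊆ upperHalfSpace ∧
      (∀ n, IsTestFunction (φ n)) ∧ (∀ n, tsupport (φ n) ⊆ K') ∧
      Tendsto (fun n => eLpNorm (fun x => φ n x - η x * u x) 2 volume) atTop (𝓝 0) ∧
      Tendsto (fun n => eLpNorm (fun x => gradient (φ n) x -
        (η x • G x + u x • gradient η x)) 2 volume) atTop (𝓝 0) :=
  exists_seq_testFunction (h.memLp_cutoff hη) (h.memLp_gradient_cutoff hη) hη.2.1.isCompact hη.2.2
    (fun x hx => by rw [image_eq_zero_of_notMem_tsupport hx, zero_mul])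
    fun _ hφ _ v => h.integral_cutoff hη hφ v

/-- Weakly differentiable functions are approximated by test functions on compact sets. -/
theorem exists_seq (h : HasWeakGradient u G) {K : Set E3} (hK : IsCompact K)
    (hKH : K ⊆ upperHalfSpace) : ∃ φ : ℕ → E3 → ℝ, (∀ n, IsTestFunction (φ n)) ∧
      Tendsto (fun n => eLpNorm (fun x => φ n x - u x) 2 (volume.restrict K)) atTop (𝓝 0) ∧
      Tendsto (fun n => eLpNorm (fun x => gradient (φ n) x - G x) 2 (volume.restrict K))
        atTop (𝓝 0) := by
  obtain ⟨η, hη, -, -, V, hVo, hKV, hV⟩ := exists_cutoff hK hKH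
  obtain ⟨-, φ, -, -, h1, -, h2, h3⟩ := h.exists_seq_cutoff hη
  refine ⟨φ, h1, tendsto_of_tendsto_of_tendsto_of_le_of_le tendsto_const_nhds h2
    (fun _ => zero_le) fun n => ?_, tendsto_of_tendsto_of_tendsto_of_le_of_le tendsto_const_nhds h3
    (fun _ => zero_le) fun n => ?_⟩
  · refine (eLpNorm_congr_ae ?_).trans_le (eLpNorm_mono_measure _ Measure.restrict_le_self)
    filter_upwards [ae_restrict_mem hK.measurableSet] with x hx
    rw [hV x (hKV hx), one_mul]
  · refine (eLpNorm_congr_ae ?_).trans_le (eLpNorm_mono_measure _ Measure.restrict_le_self)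
    filter_upwards [ae_restrict_mem hK.measurableSet] with x hx
    have : η =ᶠ[𝓝 x] fun _ => 1 := by
      filter_upwards [hVo.mem_nhds (hKV hx)] with y hy using hV y hy
    have h0 : gradient η x = 0 := by
      rw [this.gradient_eq]
      simp [gradient]
    rw [hV x (hKV hx), h0, one_smul, smul_zero, add_zero]

/-- The difference of the two fields integrates to zero against every test function. Uniqueness is
what makes the gradient of an invariant function equivariant. -/
theorem ext_ae {G' : E3 → E3} (h : HasWeakGradient u G) (h' : HasWeakGradient u G') :
    ∀ᵐ x, x ∈ upperHalfSpace → G x = G' x := by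
  have := isOpen_upperHalfSpace.ae_eq_zero_of_integral_contDiff_smul_eq_zero
    (h.2.1.sub h'.2.1).locallyIntegrableOn (fun φ h1 h2 h3 => by
      have hφ : IsTestFunction φ := ⟨h1, h2, h3⟩
      refine ext_inner_right ℝ fun v => ?_
      rw [real_inner_comm, ← integral_inner ((h.2.1.sub h'.2.1).integrable_smul_test hφ),
        inner_zero_left]
      have e1 := h.integral_eq hφ v
      rw [h'.integral_eq hφ v, neg_inj] at e1
      have i1 : Integrable (fun x => inner ℝ (G x) v * φ x) := by
        simpa [mul_comm] using (h.2.1.inner_const v).integrable_smul_test hφ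
      have i2 : Integrable (fun x => inner ℝ (G' x) v * φ x) := by
        simpa [mul_comm] using (h'.2.1.inner_const v).integrable_smul_test hφ
      have e2 : ∀ x, inner ℝ v (φ x • (G x - G' x)) =
          inner ℝ (G x) v * φ x - inner ℝ (G' x) v * φ x := by
        intro x
        rw [inner_smul_right, inner_sub_right, real_inner_comm v, real_inner_comm v]
        ring
      simp only [e2]
      rw [integral_sub i1 i2, e1, sub_self])
  filter_upwards [this] with x hx hxH
  exact sub_eq_zero.1 (hx hxH)

end HasWeakGradient

/-- A `C¹` function on the upper half-space is weakly differentiable. -/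
theorem ContDiffOn.hasWeakGradient {u : E3 → ℝ} (hu : ContDiffOn ℝ 1 u upperHalfSpace) :
    HasWeakGradient u (gradient u) := by
  have hG : ContinuousOn (gradient u) upperHalfSpace :=
    (LinearIsometryEquiv.continuous _).comp_continuousOn
      (hu.continuousOn_fderiv_of_isOpen isOpen_upperHalfSpace (by simp))
  refine ⟨hu.continuousOn.memL2Loc, hG.memL2Loc, fun φ hφ v => ?_⟩
  rw [setIntegral_eq_integral_of_forall_compl_eq_zero (fun x hx => by
    rw [hφ.fderiv_eq_zero hx]; simp),
    setIntegral_eq_integral_of_forall_compl_eq_zero (fun x hx => by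
      rw [hφ.eq_zero_of_notMem hx, mul_zero])]
  simp only [inner_gradient_left]
  have hd : ∀ x ∈ upperHalfSpace, DifferentiableAt ℝ u x := fun x hx =>
    (hu.differentiableOn (by simp)).differentiableAt (isOpen_upperHalfSpace.mem_nhds hx)
  refine integral_mul_fderiv_eq_neg_fderiv_mul_of_integrable ?_ ?_ ?_
    (fun x hx => hd x (hφ.2.2 hx)) fun x _ => hφ.differentiable x
  · simpa [mul_comm] using (hG.memL2Loc.inner_const v).integrable_smul_test hφ
  · simpa [mul_comm] using hu.continuousOn.memL2Loc.integrable_fderiv_smul_test hφ v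
  · simpa [mul_comm] using hu.continuousOn.memL2Loc.integrable_smul_test hφ

end

/-! ### Pull-back of weak gradients by isometries. -/

noncomputable section

open Filter Topology
open scoped Convolution ENNReal

namespace Hyp3

variable (γ : Hyp3 ≃ᵢ Hyp3)

theorem act_of_notMem {x : E3} (hx : x ∉ upperHalfSpace) : act γ x = x := by
  have : ¬ 0 < x 2 := hx
  simp [act, this]

/-- The action of an isometry on `ℝ³` as a measurable equivalence. -/
def actEquiv : E3 ≃ᵐ E3 where
  toFun := act γ
  invFun := act γ⁻¹
  left_inv x := by
    by_cases hx : x ∈ upperHalfSpace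
    · exact act_inv_act γ hx
    · rw [act_of_notMem γ hx, act_of_notMem _ hx]
  right_inv x := by
    by_cases hx : x ∈ upperHalfSpace
    · exact act_act_inv γ hx
    · rw [act_of_notMem _ hx, act_of_notMem _ hx]
  measurable_toFun := measurable_act γ
  measurable_invFun := measurable_act γ⁻¹

theorem measurableEmbedding_act : MeasurableEmbedding (act γ) :=
  (actEquiv γ).measurableEmbedding

theorem isCompact_act_image {K : Set E3} (hK : IsCompact K) (hKH : K ⊆ upperHalfSpace) :
    IsCompact (act γ '' K) :=
  hK.image_of_continuousOn ((contDiffOn_act γ).continuousOn.mono hKH)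

theorem act_image_subset {K : Set E3} (hKH : K ⊆ upperHalfSpace) : act γ '' K ⊆ upperHalfSpace := by
  rintro _ ⟨x, hx, rfl⟩
  exact act_mem γ (hKH hx)

/-- The isometry preserves the hyperbolic volume, which is comparable with Lebesgue measure on K and
on its image. -/
theorem exists_eLpNorm_comp_act_le {K : Set E3} (hK : IsCompact K) (hKH : K ⊆ upperHalfSpace)
    (F : Type*) [NormedAddCommGroup F] :
    ∃ C : ℝ≥0∞, C ≠ ⊤ ∧ ∀ f : E3 → F, eLpNorm (fun x => f (act γ x)) 2 (volume.restrict K) ≤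
      C * eLpNorm f 2 (volume.restrict (act γ '' K)) := by
  obtain ⟨C₁, h₁⟩ := volume_restrict_le hK hKH
  obtain ⟨C₂, h₂⟩ := hvol_restrict_le (isCompact_act_image γ hK hKH) (act_image_subset γ hKH)
  refine ⟨(C₁ : ℝ≥0∞) ^ (1 / (2 : ℝ≥0∞)).toReal * (C₂ : ℝ≥0∞) ^ (1 / (2 : ℝ≥0∞)).toReal,
    ENNReal.mul_ne_top (by simp) (by simp), fun f => ?_⟩
  have hmp := (measurePreserving_act γ).restrict_image_emb (measurableEmbedding_act γ) K
  have h3 : eLpNorm (fun x => f (act γ x)) 2 (hvol.restrict K) =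
      eLpNorm f 2 (hvol.restrict (act γ '' K)) := by
    rw [← hmp.map_eq, (measurableEmbedding_act γ).eLpNorm_map_measure]
    rfl
  refine (eLpNorm_le_of_measure_le_smul (c := C₁) h₁).trans ?_
  rw [h3, smul_eq_mul, mul_assoc]
  gcongr
  exact eLpNorm_le_of_measure_le_smul (c := C₂) h₂

theorem _root_.MemL2Loc.comp_act {F : Type*} [NormedAddCommGroup F] {f : E3 → F}
    (hf : MemL2Loc f) : MemL2Loc fun x => f (act γ x) := fun K hK hKH => by
  obtain ⟨C₁, h₁⟩ := volume_restrict_le hK hKH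
  obtain ⟨C₂, h₂⟩ := hvol_restrict_le (isCompact_act_image γ hK hKH) (act_image_subset γ hKH)
  have hmp := (measurePreserving_act γ).restrict_image_emb (measurableEmbedding_act γ) K
  exact (((hf _ (isCompact_act_image γ hK hKH) (act_image_subset γ hKH)).of_measure_le_smul
    (c := C₂) (by simp) h₂).comp_measurePreserving hmp).of_measure_le_smul (c := C₁) (by simp) h₁

theorem norm_coact {x : E3} (hx : x ∈ upperHalfSpace) (v : E3) :
    ‖coact γ x v‖ = scale γ x * ‖v‖ := by
  have hs := scale_pos γ hx
  rw [← sq_eq_sq₀ (norm_nonneg _) (by positivity), ← real_inner_self_eq_norm_sq, inner_coact γ hx,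
    real_inner_self_eq_norm_sq, mul_pow]

theorem continuousOn_coact : ContinuousOn (coact γ) upperHalfSpace :=
  (LinearIsometryEquiv.continuous _).comp_continuousOn
    ((contDiffOn_act γ).continuousOn_fderiv_of_isOpen isOpen_upperHalfSpace (by simp))

theorem continuousOn_scale : ContinuousOn (scale γ) upperHalfSpace :=
  (continuous_height.comp_continuousOn (contDiffOn_act γ).continuousOn).div
    continuous_height.continuousOn fun x hx => (show 0 < x 2 from hx).ne'

/-- The pull-back of a gradient field by an isometry. -/
def pull (G : E3 → E3) (x : E3) : E3 := coact γ x (G (act γ x))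

theorem exists_eLpNorm_pull_le {K : Set E3} (hK : IsCompact K) (hKH : K ⊆ upperHalfSpace) :
    ∃ C : ℝ≥0∞, C ≠ ⊤ ∧ ∀ G : E3 → E3, eLpNorm (pull γ G) 2 (volume.restrict K) ≤
      C * eLpNorm G 2 (volume.restrict (act γ '' K)) := by
  obtain ⟨C, hC, h⟩ := exists_eLpNorm_comp_act_le γ hK hKH E3
  obtain ⟨S, hS⟩ := hK.exists_bound_of_continuousOn ((continuousOn_scale γ).mono hKH)
  refine ⟨ENNReal.ofReal S * C, ENNReal.mul_ne_top (by simp) hC, fun G => ?_⟩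
  rw [mul_assoc]
  refine (eLpNorm_le_mul_eLpNorm_of_ae_le_mul (c := S) (g := fun x => G (act γ x)) ?_ _).trans
    (by gcongr; exact h G)
  filter_upwards [ae_restrict_mem hK.measurableSet] with x hx
  rw [pull, norm_coact γ (hKH hx)]
  gcongr
  exact (le_abs_self _).trans (hS x hx)

theorem _root_.MemL2Loc.pull {G : E3 → E3} (hG : MemL2Loc G) : MemL2Loc (pull γ G) :=
    fun K hK hKH => by
  obtain ⟨S, hS⟩ := hK.exists_bound_of_continuousOn ((continuousOn_scale γ).mono hKH)
  have h1 := hG.comp_act γ K hK hKH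
  refine h1.of_le_mul (c := S) ?_ ?_
  · have h2 : AEStronglyMeasurable (coact γ) (volume.restrict K) :=
      ((continuousOn_coact γ).mono hKH).aestronglyMeasurable_of_isCompact hK hK.measurableSet
    exact ContinuousLinearMap.aestronglyMeasurable_comp₂
      (ContinuousLinearMap.id ℝ (E3 →L[ℝ] E3)) h2 h1.1
  · filter_upwards [ae_restrict_mem hK.measurableSet] with x hx
    rw [Hyp3.pull, norm_coact γ (hKH hx)]
    gcongr
    exact (le_abs_self _).trans (hS x hx)

theorem gradient_comp_act {φ : E3 → ℝ} {x : E3} (hx : x ∈ upperHalfSpace)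
    (hφ : DifferentiableAt ℝ φ (act γ x)) :
    gradient (fun y => φ (act γ y)) x = pull γ (gradient φ) x := by
  refine ext_inner_right ℝ fun v => ?_
  rw [inner_gradient_left, pull, coact, ContinuousLinearMap.adjoint_inner_left,
    inner_gradient_left]
  have := (hφ.hasFDerivAt.comp x (hasFDerivAt_act γ hx)).fderiv
  change fderiv ℝ (φ ∘ act γ) x v = _
  rw [this]
  rfl

end Hyp3

open Hyp3

theorem HasWeakGradient.congr {u u' : E3 → ℝ} {G : E3 → E3} (h : HasWeakGradient u G)
    (hu : ∀ x ∈ upperHalfSpace, u' x = u x) : HasWeakGradient u' G := by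
  refine ⟨fun K hK hKH => (h.1 K hK hKH).ae_eq ?_, h.2.1, fun φ hφ v => ?_⟩
  · filter_upwards [ae_restrict_mem hK.measurableSet] with x hx using (hu x (hKH hx)).symm
  · rw [← h.2.2 φ hφ v]
    exact setIntegral_congr_fun measurableSet_upperHalfSpace fun x hx => by simp only [hu x hx]

/-- For test functions this is the chain rule. In general u is approximated on the image of the
support of φ, and pulling back is continuous in L² over that support. -/
theorem HasWeakGradient.comp_act {u : E3 → ℝ} {G : E3 → E3} (h : HasWeakGradient u G)
    (γ : Hyp3 ≃ᵢ Hyp3) : HasWeakGradient (fun x => u (act γ x)) (pull γ G) := by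
  refine ⟨h.1.comp_act γ, h.2.1.pull γ, fun φ hφ v => ?_⟩
  set K := tsupport φ with hKdef
  have hK : IsCompact K := hφ.2.1.isCompact
  have hKH : K ⊆ upperHalfSpace := hφ.2.2
  have hfd : ∀ x ∉ K, fderiv ℝ φ x v = 0 := fun x hx => by
    rw [← inner_gradient_left, gradient_eq_zero_of_notMem hx, inner_zero_left]
  have hred1 : ∀ f : E3 → ℝ, ∫ x in upperHalfSpace, f x * fderiv ℝ φ x v =
      ∫ x in K, f x * fderiv ℝ φ x v := by
    intro f
    rw [setIntegral_eq_integral_of_forall_compl_eq_zero (fun x hx => by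
      rw [hfd x fun h => hx (hKH h), mul_zero]),
      setIntegral_eq_integral_of_forall_compl_eq_zero (fun x hx => by
      rw [hfd x hx, mul_zero])]
  have hred2 : ∀ f : E3 → E3, ∫ x in upperHalfSpace, inner ℝ (f x) v * φ x =
      ∫ x in K, inner ℝ (f x) (φ x • v) := by
    intro f
    rw [setIntegral_eq_integral_of_forall_compl_eq_zero (fun x hx => by
      rw [hφ.eq_zero_of_notMem hx, mul_zero]),
      setIntegral_eq_integral_of_forall_compl_eq_zero (fun x hx => by
      rw [image_eq_zero_of_notMem_tsupport hx, zero_smul, inner_zero_right])]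
    simp only [inner_smul_right, mul_comm]
  rw [hred1, hred2]
  obtain ⟨ψ, hψ, l1, l2⟩ := h.exists_seq (isCompact_act_image γ hK hKH) (act_image_subset γ hKH)
  obtain ⟨C₁, hC₁, hb1⟩ := exists_eLpNorm_comp_act_le γ hK hKH ℝ
  obtain ⟨C₂, hC₂, hb2⟩ := exists_eLpNorm_pull_le γ hK hKH
  have hsm : ∀ n, ContDiffOn ℝ ∞ (fun x => ψ n (act γ x)) upperHalfSpace := fun n =>
    (hψ n).1.comp_contDiffOn (contDiffOn_act γ)
  have hg : ∀ n, ∀ x ∈ upperHalfSpace, gradient (fun x => ψ n (act γ x)) x =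
      pull γ (gradient (ψ n)) x := fun n x hx =>
    gradient_comp_act γ hx ((hψ n).differentiable _)
  have hψ1 : ∀ n, MemL2Loc (ψ n) := fun n => (hψ n).continuous.continuousOn.memL2Loc
  have hψ2 : ∀ n, MemL2Loc (gradient (ψ n)) := fun n =>
    (continuous_gradient (hψ n).1).continuousOn.memL2Loc
  have hn : ∀ n, ∫ x in K, ψ n (act γ x) * fderiv ℝ φ x v =
      - ∫ x in K, inner ℝ (pull γ (gradient (ψ n)) x) (φ x • v) := by
    intro n
    have h0 := ((hsm n).of_le (m := 1) (by simp)).hasWeakGradient.2.2 φ hφ v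
    rw [hred1, hred2] at h0
    rw [h0]
    congr 1
    exact setIntegral_congr_fun hK.measurableSet fun x hx => by simp only [hg n x (hKH hx)]
  have t1 : Tendsto (fun n => ∫ x in K, ψ n (act γ x) * fderiv ℝ φ x v) atTop
      (𝓝 (∫ x in K, u (act γ x) * fderiv ℝ φ x v)) := by
    have hm := (hφ.continuous_fderiv_apply v).continuousOn.memL2Loc K hK hKH
    refine tendsto_integral_mul (fun n => (hψ1 n).comp_act γ K hK hKH) (fun _ => hm)
      (h.1.comp_act γ K hK hKH) hm ?_ (by simp)
    refine tendsto_of_tendsto_of_tendsto_of_le_of_le tendsto_const_nhds ?_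
      (fun _ => zero_le) fun n => hb1 fun x => ψ n x - u x
    simpa using ENNReal.Tendsto.const_mul l1 (Or.inr hC₁)
  have t2 : Tendsto (fun n => ∫ x in K, inner ℝ (pull γ (gradient (ψ n)) x) (φ x • v)) atTop
      (𝓝 (∫ x in K, inner ℝ (pull γ G x) (φ x • v))) := by
    have hm : MemLp (fun x => φ x • v) 2 (volume.restrict K) :=
      (hφ.continuous.smul continuous_const).continuousOn.memL2Loc K hK hKH
    refine tendsto_integral_inner (fun n => (hψ2 n).pull γ K hK hKH) (fun _ => hm)
      (h.2.1.pull γ K hK hKH) hm ?_ (by simp)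
    refine tendsto_of_tendsto_of_tendsto_of_le_of_le tendsto_const_nhds
      (h := fun n => C₂ * eLpNorm (fun x => gradient (ψ n) x - G x) 2
        (volume.restrict (act γ '' K))) ?_ (fun _ => zero_le) fun n => ?_
    · simpa using ENNReal.Tendsto.const_mul l2 (Or.inr hC₂)
    · refine le_trans (le_of_eq ?_) (hb2 fun x => gradient (ψ n) x - G x)
      congr 1
      ext1 x
      simp only [pull, map_sub]
  simp only [hn] at t1
  exact tendsto_nhds_unique t1 t2.neg

/-- The weak gradient of an invariant function is equivariant. -/
theorem HasWeakGradient.ae_eq_pull {u : E3 → ℝ} {G : E3 → E3} (h : HasWeakGradient u G)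
    {γ : Hyp3 ≃ᵢ Hyp3} (hu : ∀ x ∈ upperHalfSpace, u (act γ x) = u x) :
    ∀ᵐ x, x ∈ upperHalfSpace → G x = pull γ G x :=
  h.ext_ae ((h.comp_act γ).congr fun x hx => (hu x hx).symm)

end

/-! ### The Poincaré inequality on convex sets. -/

noncomputable section

open Filter Topology
open scoped Convolution ENNReal

/-- The fundamental theorem of calculus along the segment, followed by Jensen's inequality on the
unit interval. -/
theorem sq_enorm_sub_le_lintegral {φ : E3 → ℝ} (hφ : ContDiff ℝ ∞ φ) (x z : E3) :
    ‖φ (x + z) - φ x‖ₑ ^ 2 ≤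
      ∫⁻ t in Icc (0 : ℝ) 1, ‖z‖ₑ ^ 2 * ‖gradient φ (x + t • z)‖ₑ ^ 2 := by
  have hc : Continuous fun t : ℝ => fderiv ℝ φ (x + t • z) z :=
    ((hφ.continuous_fderiv (by simp)).comp (by fun_prop)).clm_apply continuous_const
  have hd : ∀ t : ℝ, HasDerivAt (fun t : ℝ => φ (x + t • z)) (fderiv ℝ φ (x + t • z) z) t := by
    intro t
    have h1 : HasDerivAt (fun t : ℝ => x + t • z) z t := by
      simpa using ((hasDerivAt_id t).smul_const z).const_add x
    exact ((hφ.differentiable (by simp)) (x + t • z)).hasFDerivAt.comp_hasDerivAt t h1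
  have hF : φ (x + z) - φ x = ∫ t in (0 : ℝ)..1, fderiv ℝ φ (x + t • z) z := by
    rw [intervalIntegral.integral_eq_sub_of_hasDerivAt (fun t _ => hd t)
      (hc.intervalIntegrable _ _)]
    simp
  have hprob : IsProbabilityMeasure (volume.restrict (Ioc (0 : ℝ) 1)) := ⟨by simp⟩
  rw [hF, intervalIntegral.integral_of_le zero_le_one, setLIntegral_congr Ioc_ae_eq_Icc.symm]
  calc _ ≤ (∫⁻ t in Ioc (0 : ℝ) 1, ‖fderiv ℝ φ (x + t • z) z‖ₑ) ^ 2 := by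
        gcongr
        exact enorm_integral_le_lintegral_enorm _
    _ ≤ ∫⁻ t in Ioc (0 : ℝ) 1, ‖fderiv ℝ φ (x + t • z) z‖ₑ ^ 2 :=
        sq_lintegral_le hc.enorm.measurable.aemeasurable
    _ ≤ _ := by
        refine lintegral_mono fun t => ?_
        rw [← mul_pow, ← inner_gradient_left]
        gcongr
        rw [mul_comm, ← enorm_norm, ← enorm_norm (gradient _ _), ← enorm_norm z, ← enorm_mul]
        exact enorm_le_iff_norm_le.2
          (by simpa using norm_inner_le_norm (𝕜 := ℝ) (gradient φ (x + t • z)) z)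

/-- Write y = x + z, with z in the ball of radius d. By convexity the segment from x to y stays in
Q, so the gradient may be cut off to Q; Tonelli and translation invariance in x then leave its
integral over Q for each z and t. -/
theorem lintegral_sq_sub_le {φ : E3 → ℝ} (hφ : ContDiff ℝ ∞ φ) {Q : Set E3}
    (hQ : MeasurableSet Q) (hconv : Convex ℝ Q) {d : ℝ} (hd : ∀ x ∈ Q, ∀ y ∈ Q, dist x y ≤ d) :
    ∫⁻ x in Q, ∫⁻ y in Q, ‖φ y - φ x‖ₑ ^ 2 ≤
      volume (Metric.closedBall (0 : E3) d) * ENNReal.ofReal d ^ 2 *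
        ∫⁻ x in Q, ‖gradient φ x‖ₑ ^ 2 := by
  set g : E3 → ℝ≥0∞ := Q.indicator fun x => ‖gradient φ x‖ₑ ^ 2 with hg
  have hgm : Measurable g := ((continuous_gradient hφ).enorm.measurable.pow_const 2).indicator hQ
  set B := Metric.closedBall (0 : E3) d with hB
  have hpt : ∀ x, ∀ z, Q.indicator (fun x => Q.indicator (fun y => ‖φ y - φ x‖ₑ ^ 2) (x + z)) x ≤
      B.indicator (fun _ => ENNReal.ofReal d ^ 2 *
        ∫⁻ t in Icc (0 : ℝ) 1, g (x + t • z)) z := by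
    intro x z
    by_cases hx : x ∈ Q
    swap; · simp [hx]
    by_cases hz : x + z ∈ Q
    swap; · simp [hx, hz]
    have hdz : ‖z‖ ≤ d := by simpa using hd (x + z) hz x hx
    have hzB : z ∈ B := by simpa [hB] using hdz
    simp only [hx, hz, hzB, indicator_of_mem]
    refine (sq_enorm_sub_le_lintegral hφ x z).trans ?_
    rw [← lintegral_const_mul]
    · refine setLIntegral_mono' measurableSet_Icc fun t ht => ?_
      have hmem : x + t • z ∈ Q := by
        have := hconv hx hz (sub_nonneg.2 ht.2) ht.1 (by ring)
        convert! this using 1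
        module
      rw [hg, indicator_of_mem hmem, ← ofReal_norm z]
      gcongr
    · exact hgm.comp (by fun_prop)
  have hm1 : Measurable fun p : E3 × E3 =>
      Q.indicator (fun x => Q.indicator (fun y => ‖φ y - φ x‖ₑ ^ 2) (x + p.2)) p.1 := by
    have h1 : Measurable fun p : E3 × E3 => ‖φ (p.1 + p.2) - φ p.1‖ₑ ^ 2 := by
      have := hφ.continuous
      fun_prop
    have h2 := (h1.indicator ((measurable_fst.add measurable_snd) hQ)).indicator
      (measurable_fst hQ)
    convert! h2 using 2 with p
  calc ∫⁻ x in Q, ∫⁻ y in Q, ‖φ y - φ x‖ₑ ^ 2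
      = ∫⁻ x, ∫⁻ z, Q.indicator (fun x => Q.indicator (fun y => ‖φ y - φ x‖ₑ ^ 2) (x + z)) x := by
        rw [← lintegral_indicator hQ]
        refine lintegral_congr fun x => ?_
        by_cases hx : x ∈ Q
        · simp only [hx, indicator_of_mem]
          rw [← lintegral_indicator hQ, lintegral_add_left_eq_self
            (Q.indicator fun y => ‖φ y - φ x‖ₑ ^ 2) x]
        · simp [hx]
    _ ≤ ∫⁻ x, ∫⁻ z, B.indicator (fun _ => ENNReal.ofReal d ^ 2 *
        ∫⁻ t in Icc (0 : ℝ) 1, g (x + t • z)) z :=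
        lintegral_mono fun x => lintegral_mono fun z => hpt x z
    _ = ∫⁻ x, ∫⁻ z in B, ENNReal.ofReal d ^ 2 * ∫⁻ t in Icc (0 : ℝ) 1, g (x + t • z) := by
        refine lintegral_congr fun x => ?_
        rw [← lintegral_indicator measurableSet_closedBall]
        rfl
    _ = ∫⁻ z in B, (∫⁻ x, ENNReal.ofReal d ^ 2 * ∫⁻ t in Icc (0 : ℝ) 1, g (x + t • z)) := by
        refine lintegral_lintegral_swap ?_
        refine (Measurable.const_mul ?_ _).aemeasurable
        refine Measurable.lintegral_prod_right'
          (f := fun q : (E3 × E3) × ℝ => g (q.1.1 + q.2 • q.1.2)) ?_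
        exact hgm.comp (by fun_prop)
    _ = ∫⁻ z in B, ENNReal.ofReal d ^ 2 * ∫⁻ x in Q, ‖gradient φ x‖ₑ ^ 2 := by
        refine lintegral_congr fun z => ?_
        rw [lintegral_const_mul']
        swap; · finiteness
        congr 1
        rw [lintegral_lintegral_swap]
        · simp only [lintegral_add_right_eq_self g]
          rw [hg, lintegral_indicator hQ]
          simp
        · refine Measurable.aemeasurable ?_
          exact hgm.comp (by fun_prop)
    _ = _ := by
        rw [setLIntegral_const]
        ring

theorem integral_sub_const_sq {α : Type*} [MeasurableSpace α] {μ : Measure α} [IsFiniteMeasure μ]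
    {φ : α → ℝ} (hφ : MemLp φ 2 μ) (a : ℝ) :
    ∫ x, (φ x - a) ^ 2 ∂μ = (∫ x, φ x ^ 2 ∂μ) - 2 * a * (∫ x, φ x ∂μ) + μ.real univ * a ^ 2 := by
  have i1 : Integrable (fun x => 2 * a * φ x) μ := (hφ.integrable (by norm_num)).const_mul _
  have i2 : Integrable (fun x => φ x ^ 2) μ := hφ.integrable_sq
  have i3 : Integrable (fun x => φ x ^ 2 - 2 * a * φ x) μ := i2.sub i1
  have he : ∀ x, (φ x - a) ^ 2 = φ x ^ 2 - 2 * a * φ x + a ^ 2 := fun x => by ring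
  simp only [he]
  rw [integral_add i3 (integrable_const _), integral_sub i2 i1, integral_const_mul, integral_const,
    smul_eq_mul]

/-- Expanding the square turns the double integral into a variance, in a form that involves no
division by the total mass. -/
theorem lintegral_sq_sub_eq {α : Type*} [MeasurableSpace α] {μ : Measure α} [IsFiniteMeasure μ]
    {φ : α → ℝ} (hφ : MemLp φ 2 μ) :
    ∫⁻ x, ∫⁻ y, ‖φ y - φ x‖ₑ ^ 2 ∂μ ∂μ =
      ENNReal.ofReal (2 * (μ.real univ * (∫ x, φ x ^ 2 ∂μ) - (∫ x, φ x ∂μ) ^ 2)) := by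
  have i1 : Integrable φ μ := hφ.integrable (by norm_num)
  have i2 : Integrable (fun x => φ x ^ 2) μ := hφ.integrable_sq
  have hin : ∀ x, ∫⁻ y, ‖φ y - φ x‖ₑ ^ 2 ∂μ = ENNReal.ofReal (∫ y, (φ y - φ x) ^ 2 ∂μ) := by
    intro x
    have i0 : Integrable (fun y => (φ y - φ x) ^ 2) μ := (hφ.sub (memLp_const (φ x))).integrable_sq
    rw [ofReal_integral_eq_lintegral_ofReal i0
      (Eventually.of_forall fun y => sq_nonneg _)]
    refine lintegral_congr fun y => ?_
    rw [Real.enorm_eq_ofReal_abs, ← ENNReal.ofReal_pow (abs_nonneg _), sq_abs]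
  have hnn : ∀ x, 0 ≤ ∫ y, (φ y - φ x) ^ 2 ∂μ := fun x => integral_nonneg fun y => sq_nonneg _
  simp only [hin]
  simp only [integral_sub_const_sq hφ] at hnn ⊢
  set m := ∫ x, φ x ∂μ
  set s := ∫ x, φ x ^ 2 ∂μ
  have i4 : Integrable (fun x => 2 * φ x * m) μ := (i1.const_mul 2).mul_const m
  have i5 : Integrable (fun x => s - 2 * φ x * m) μ := (integrable_const _).sub i4
  have i6 : Integrable (fun x => s - 2 * φ x * m + μ.real univ * φ x ^ 2) μ :=
    i5.add (i2.const_mul _)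
  rw [← ofReal_integral_eq_lintegral_ofReal i6 (Eventually.of_forall hnn)]
  congr 1
  rw [integral_add i5 (i2.const_mul _), integral_sub (integrable_const _) i4, integral_const,
    smul_eq_mul, integral_mul_const, integral_const_mul, integral_const_mul]
  change μ.real univ * s - 2 * m * m + μ.real univ * s = _
  ring

theorem poincare_testFunction {φ : E3 → ℝ} (hφ : IsTestFunction φ) {Q : Set E3}
    (hQ : MeasurableSet Q) (hQf : volume Q ≠ ⊤) (hconv : Convex ℝ Q) {d : ℝ} (hd0 : 0 ≤ d)
    (hd : ∀ x ∈ Q, ∀ y ∈ Q, dist x y ≤ d) :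
    2 * (volume.real Q * (∫ x in Q, φ x ^ 2) - (∫ x in Q, φ x) ^ 2) ≤
      volume.real (Metric.closedBall (0 : E3) d) * d ^ 2 * ∫ x in Q, ‖gradient φ x‖ ^ 2 := by
  have hfin : IsFiniteMeasure (volume.restrict Q : Measure E3) := ⟨by simpa using hQf.lt_top⟩
  have h1 : MemLp φ 2 (volume.restrict Q) :=
    (hφ.continuous.memLp_of_hasCompactSupport hφ.2.1).restrict Q
  have h2 : MemLp (gradient φ) 2 (volume.restrict Q) :=
    ((continuous_gradient hφ.1).memLp_of_hasCompactSupport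
      (hasCompactSupport_gradient hφ.2.1)).restrict Q
  have key := lintegral_sq_sub_le hφ.1 hQ hconv hd
  rw [lintegral_sq_sub_eq h1] at key
  have h3 : ∫⁻ x in Q, ‖gradient φ x‖ₑ ^ 2 = ENNReal.ofReal (∫ x in Q, ‖gradient φ x‖ ^ 2) := by
    rw [ofReal_integral_eq_lintegral_ofReal (h2.integrable_norm_pow two_ne_zero)
      (Eventually.of_forall fun x => by positivity)]
    refine lintegral_congr fun x => ?_
    rw [← ofReal_norm, ENNReal.ofReal_pow (norm_nonneg _)]
  have h4 : volume (Metric.closedBall (0 : E3) d) =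
      ENNReal.ofReal (volume.real (Metric.closedBall (0 : E3) d)) :=
    (ENNReal.ofReal_toReal measure_closedBall_lt_top.ne).symm
  have h5 : 0 ≤ ∫ x in Q, ‖gradient φ x‖ ^ 2 := integral_nonneg fun x => by positivity
  rw [h3, h4, ← ENNReal.ofReal_pow hd0, ← ENNReal.ofReal_mul (by positivity),
    ← ENNReal.ofReal_mul (by positivity), ENNReal.ofReal_le_ofReal_iff (by positivity)] at key
  simpa using key

/-- The Poincaré inequality on a convex set. -/
theorem HasWeakGradient.poincare {u : E3 → ℝ} {G : E3 → E3} (h : HasWeakGradient u G) {K Q : Set E3}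
    (hK : IsCompact K) (hKH : K ⊆ upperHalfSpace) (hQK : Q ⊆ K) (hQ : MeasurableSet Q)
    (hconv : Convex ℝ Q) {d : ℝ} (hd0 : 0 ≤ d) (hd : ∀ x ∈ Q, ∀ y ∈ Q, dist x y ≤ d) :
    2 * (volume.real Q * (∫ x in Q, u x ^ 2) - (∫ x in Q, u x) ^ 2) ≤
      volume.real (Metric.closedBall (0 : E3) d) * d ^ 2 * ∫ x in Q, ‖G x‖ ^ 2 := by
  have hQf : volume Q ≠ ⊤ := ((measure_mono hQK).trans_lt hK.measure_lt_top).ne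
  have hfin : IsFiniteMeasure (volume.restrict Q : Measure E3) := ⟨by simpa using hQf.lt_top⟩
  have hle : (volume.restrict Q : Measure E3) ≤ volume.restrict K := Measure.restrict_mono_set _ hQK
  obtain ⟨φ, hφ, l1, l2⟩ := h.exists_seq hK hKH
  have hu : MemLp u 2 (volume.restrict Q) := (h.1 K hK hKH).mono_measure hle
  have hG : MemLp G 2 (volume.restrict Q) := (h.2.1 K hK hKH).mono_measure hle
  have m1 : ∀ n, MemLp (φ n) 2 (volume.restrict Q) := fun n =>
    ((hφ n).continuous.memLp_of_hasCompactSupport (hφ n).2.1).restrict Q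
  have m2 : ∀ n, MemLp (gradient (φ n)) 2 (volume.restrict Q) := fun n =>
    ((continuous_gradient (hφ n).1).memLp_of_hasCompactSupport
      (hasCompactSupport_gradient (hφ n).2.1)).restrict Q
  have l1' : Tendsto (fun n => eLpNorm (fun x => φ n x - u x) 2 (volume.restrict Q)) atTop (𝓝 0) :=
    tendsto_of_tendsto_of_tendsto_of_le_of_le tendsto_const_nhds l1 (fun _ => zero_le)
      fun n => eLpNorm_mono_measure _ hle
  have l2' : Tendsto (fun n => eLpNorm (fun x => gradient (φ n) x - G x) 2 (volume.restrict Q))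
      atTop (𝓝 0) :=
    tendsto_of_tendsto_of_tendsto_of_le_of_le tendsto_const_nhds l2 (fun _ => zero_le)
      fun n => eLpNorm_mono_measure _ hle
  have mc : MemLp (fun _ : E3 => (1 : ℝ)) 2 (volume.restrict Q) := memLp_const 1
  have t1 := tendsto_integral_mul m1 m1 hu hu l1' l1'
  have t2 := tendsto_integral_mul m1 (fun _ => mc) hu mc l1' (by simp)
  have t3 := tendsto_integral_inner m2 m2 hG hG l2' l2'
  simp only [mul_one, ← sq, real_inner_self_eq_norm_sq] at t1 t2 t3
  exact le_of_tendsto_of_tendsto' (((t1.const_mul _).sub (t2.pow 2)).const_mul 2) (t3.const_mul _)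
    fun n => poincare_testFunction (hφ n) hQ hQf hconv hd0 hd

/-- A function with vanishing weak gradient is constant. -/
theorem HasWeakGradient.exists_ae_eq_const {u : E3 → ℝ} {G : E3 → E3} (h : HasWeakGradient u G)
    (hG : ∀ᵐ x, x ∈ upperHalfSpace → G x = 0) : ∃ c, ∀ᵐ x, x ∈ upperHalfSpace → u x = c := by
  -- Convex compact sets exhausting the half-space. The Poincaré inequality gives a constant on
  -- each, and the constants agree because they all hold on `Q 0`, which has positive measure.
  let Q : ℕ → Set E3 := fun n => Metric.closedBall 0 (n + 2) ∩ {x | 1 / ((n : ℝ) + 2) ≤ x 2}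
  have hQc : ∀ n, IsCompact (Q n) := fun n =>
    (ProperSpace.isCompact_closedBall _ _).inter_right
      (isClosed_le continuous_const continuous_height)
  have hQH : ∀ n, Q n ⊆ upperHalfSpace := fun n x hx =>
    lt_of_lt_of_le (show 0 < 1 / ((n : ℝ) + 2) by positivity) hx.2
  have hQconv : ∀ n, Convex ℝ (Q n) := fun n => (convex_closedBall _ _).inter
    (convex_halfSpace_ge ⟨fun _ _ => rfl, fun _ _ => rfl⟩ _)
  have hmono : ∀ n, Q 0 ⊆ Q n := fun n x hx => by
    refine ⟨Metric.closedBall_subset_closedBall (by simp) hx.1,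
      le_trans (b := 1 / (((0 : ℕ) : ℝ) + 2)) ?_ hx.2⟩
    apply one_div_le_one_div_of_le <;> simp
  have hpos : 0 < volume (Q 0) := by
    have ho : IsOpen (Metric.ball (0 : E3) 2 ∩ {x | 1 / 2 < x 2}) :=
      Metric.isOpen_ball.inter (isOpen_lt continuous_const continuous_height)
    refine (ho.measure_pos volume ⟨!₂[0, 0, 1], ?_, ?_⟩).trans_le (measure_mono ?_)
    · simp [EuclideanSpace.norm_eq, Fin.sum_univ_three]
    · simp; norm_num
    · rintro x ⟨h1, h2⟩
      refine ⟨Metric.ball_subset_closedBall (by simpa using h1), ?_⟩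
      have : (1 : ℝ) / 2 < x 2 := h2
      simpa using this.le
  have hconst : ∀ n, ∃ c, ∀ᵐ x ∂(volume.restrict (Q n)), u x = c := by
    intro n
    have hfin : IsFiniteMeasure (volume.restrict (Q n) : Measure E3) :=
      ⟨by simpa using (hQc n).measure_lt_top⟩
    have hV : 0 < volume.real (Q n) := by
      rw [measureReal_def, ENNReal.toReal_pos_iff]
      exact ⟨hpos.trans_le (measure_mono (hmono n)), (hQc n).measure_lt_top⟩
    have h0 := h.poincare (hQc n) (hQH n) subset_rfl (hQc n).measurableSet (hQconv n)
      (d := 2 * (n + 2)) (by positivity) (fun x hx y hy => by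
        have h1 := hx.1
        have h2 := hy.1
        rw [mem_closedBall_zero_iff] at h1 h2
        rw [dist_eq_norm]
        linarith [norm_sub_le x y])
    have hz : ∫ x in Q n, ‖G x‖ ^ 2 = 0 := by
      rw [← integral_zero E3 ℝ (μ := volume.restrict (Q n))]
      refine integral_congr_ae ?_
      filter_upwards [ae_restrict_mem (hQc n).measurableSet, ae_restrict_of_ae hG] with x hx hx'
      simp [hx' (hQH n hx)]
    rw [hz, mul_zero] at h0
    have hu : MemLp u 2 (volume.restrict (Q n)) := h.1 _ (hQc n) (hQH n)
    have i1 := hu.integrable (q := 2) (by norm_num)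
    have i2 := hu.integrable_sq
    set m := (∫ x in Q n, u x) / volume.real (Q n) with hm
    refine ⟨m, ?_⟩
    have h2 : ∫ x in Q n, (u x - m) ^ 2 = 0 := by
      refine le_antisymm ?_ (integral_nonneg fun x => sq_nonneg _)
      rw [integral_sub_const_sq hu]
      simp only [measureReal_restrict_apply_univ]
      have : ∫ x in Q n, u x = m * volume.real (Q n) := by rw [hm]; field_simp
      rw [this] at h0 ⊢
      have h3 : volume.real (Q n) * ((∫ x in Q n, u x ^ 2) - m ^ 2 * volume.real (Q n)) ≤ 0 := by
        nlinarith
      nlinarith [nonpos_of_mul_nonpos_right h3 hV]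
    have i3 : Integrable (fun x => (u x - m) ^ 2) (volume.restrict (Q n)) :=
      (hu.sub (memLp_const m)).integrable_sq
    rw [integral_eq_zero_iff_of_nonneg (fun x => by positivity) i3] at h2
    filter_upwards [h2] with x hx
    have : (u x - m) ^ 2 = 0 := hx
    exact sub_eq_zero.1 (pow_eq_zero_iff two_ne_zero |>.1 this)
  choose c hc using hconst
  have hc0 : ∀ n, c n = c 0 := by
    intro n
    have h1 : ∀ᵐ x ∂(volume.restrict (Q 0)), u x = c n :=
      ae_restrict_of_ae_restrict_of_subset (hmono n) (hc n)
    have : NeBot (ae (volume.restrict (Q 0))) := by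
      rw [ae_neBot, Ne, Measure.restrict_eq_zero]
      exact hpos.ne'
    obtain ⟨x, hx, hx'⟩ := (h1.and (hc 0)).exists
    rw [← hx, hx']
  refine ⟨c 0, ?_⟩
  have hall : ∀ᵐ x, ∀ n, x ∈ Q n → u x = c 0 := by
    rw [ae_all_iff]
    intro n
    have := hc n
    rw [hc0 n] at this
    exact (ae_restrict_iff' (hQc n).measurableSet).1 this
  filter_upwards [hall] with x hx hxH
  have hxp : 0 < x 2 := hxH
  obtain ⟨n, hn⟩ := exists_nat_ge (max ‖x‖ (1 / x 2))
  refine hx n ⟨?_, ?_⟩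
  · rw [mem_closedBall_zero_iff]
    linarith [le_max_left ‖x‖ (1 / x 2)]
  · change 1 / ((n : ℝ) + 2) ≤ x 2
    rw [one_div_le (by positivity) hxp]
    linarith [le_max_right ‖x‖ (1 / x 2)]

end

/-! ### Lipschitz functions on hyperbolic space are weakly differentiable. -/

noncomputable section

open Filter Topology
open scoped Convolution ENNReal

namespace Hyp3

theorem inCoords_of_mem (u : Hyp3 → ℝ) {x : E3} (hx : x ∈ upperHalfSpace) :
    inCoords u x = u ⟨x, hx⟩ := by
  have : 0 < x 2 := hx
  simp [inCoords, this]

theorem inCoords_val (u : Hyp3 → ℝ) (p : Hyp3) : inCoords u p.val = u p :=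
  inCoords_of_mem u p.pos

theorem continuousOn_inCoords {u : Hyp3 → ℝ} (hu : Continuous u) :
    ContinuousOn (inCoords u) upperHalfSpace := by
  intro x hx
  refine ContinuousAt.continuousWithinAt ?_
  rw [show x = (⟨x, hx⟩ : Hyp3).val from rfl, ← isOpenEmbedding_val.continuousAt_iff]
  have : inCoords u ∘ Hyp3.val = u := funext fun p => inCoords_val u p
  rw [this]
  exact hu.continuousAt

variable {u : Hyp3 → ℝ} {L : ℝ}

theorem abs_inCoords_sub_le (hL : 0 ≤ L) (hu : ∀ p q, |u p - u q| ≤ L * dist p q) {x y : E3}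
    (hx : x ∈ upperHalfSpace) (hy : y ∈ upperHalfSpace) :
    |inCoords u x - inCoords u y| ≤ L / √(x 2 * y 2) * dist x y := by
  rw [inCoords_of_mem u hx, inCoords_of_mem u hy]
  refine (hu _ _).trans ?_
  rw [div_mul_eq_mul_div, mul_div_assoc]
  gcongr
  exact dist_le_of_chord ⟨x, hx⟩ ⟨y, hy⟩

/-- Near x the hyperbolic distance is at most about 1 / x₂ times the Euclidean one. Where u is not
differentiable, `gradient` takes the default value zero and the bound is trivial. -/
theorem height_mul_norm_gradient_le (hL : 0 ≤ L) (hu : ∀ p q, |u p - u q| ≤ L * dist p q) {x : E3}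
    (hx : x ∈ upperHalfSpace) : x 2 * ‖gradient (inCoords u) x‖ ≤ L := by
  have hx2 : 0 < x 2 := hx
  by_cases hd : DifferentiableAt ℝ (inCoords u) x
  swap
  · rw [gradient_eq_zero_of_not_differentiableAt hd, norm_zero, mul_zero]; exact hL
  have h1 : ‖gradient (inCoords u) x‖ = ‖fderiv ℝ (inCoords u) x‖ :=
    LinearIsometryEquiv.norm_map _ _
  rw [h1, mul_comm, ← le_div_iff₀ hx2]
  refine le_of_forall_gt_imp_ge_of_dense fun C hC => ?_
  have hC0 : 0 ≤ C := le_trans (by positivity) hC.le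
  refine hd.hasFDerivAt.le_of_lip' hC0 ?_
  have ht : Tendsto (fun y : E3 => L / √(y 2 * x 2)) (𝓝 x) (𝓝 (L / x 2)) := by
    have : ContinuousAt (fun y : E3 => L / √(y 2 * x 2)) x :=
      continuousAt_const.div (by fun_prop) (Real.sqrt_pos.2 (mul_pos hx2 hx2)).ne'
    simpa [ContinuousAt, Real.sqrt_mul_self hx2.le] using this
  filter_upwards [ht.eventually_lt_const hC, isOpen_upperHalfSpace.mem_nhds hx] with y hy hyH
  rw [Real.norm_eq_abs, ← dist_eq_norm]
  exact (abs_inCoords_sub_le hL hu hyH hx).trans (by gcongr)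

theorem gradient_eq_zero_of_isLocalExtr {f : E3 → ℝ} {x : E3} (h : IsLocalExtr f x) :
    gradient f x = 0 := by
  rw [gradient, h.fderiv_eq_zero, map_zero]

/-- Above height c the function is Lipschitz for the Euclidean distance. The extension to all of ℝ³
makes Rademacher's theorem and the integration by parts for Lipschitz functions applicable. -/
theorem exists_lipschitzWith_eqOn (hL : 0 ≤ L) (hu : ∀ p q, |u p - u q| ≤ L * dist p q) {c : ℝ}
    (hc : 0 < c) : ∃ (C : NNReal) (g : E3 → ℝ), LipschitzWith C g ∧
      ∀ x : E3, c < x 2 → inCoords u x = g x := by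
  have hlip : LipschitzOnWith (L / c).toNNReal (inCoords u) {x : E3 | c ≤ x 2} := by
    refine LipschitzOnWith.of_dist_le_mul fun x hx y hy => ?_
    have hx' : c ≤ x 2 := hx
    have hy' : c ≤ y 2 := hy
    refine (abs_inCoords_sub_le hL hu (hc.trans_le hx) (hc.trans_le hy)).trans ?_
    rw [Real.coe_toNNReal _ (by positivity)]
    gcongr
    exact Real.le_sqrt_of_sq_le (by rw [sq]; exact mul_le_mul hx' hy' hc.le (hc.le.trans hx'))
  obtain ⟨g, hg, hgu⟩ := hlip.extend_real
  exact ⟨_, g, hg, fun x hx => hgu hx.le⟩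

/-- A Lipschitz function on `ℍ³` is weakly differentiable. -/
theorem hasWeakGradient_of_lipschitz (hL : 0 ≤ L) (hu : ∀ p q, |u p - u q| ≤ L * dist p q) :
    HasWeakGradient (inCoords u) (gradient (inCoords u)) := by
  have hcont : Continuous u :=
    (LipschitzWith.of_dist_le_mul (K := L.toNNReal) fun p q => by
      rw [Real.coe_toNNReal _ hL]; exact hu p q).continuous
  have hgm : Measurable (gradient (inCoords u)) :=
    (LinearIsometryEquiv.continuous _).measurable.comp (measurable_fderiv ℝ _)
  refine ⟨(continuousOn_inCoords hcont).memL2Loc, fun K hK hKH => ?_, fun φ hφ v => ?_⟩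
  · obtain ⟨c, hc, hcK⟩ := exists_height_bounds hK hKH
    have : IsFiniteMeasure (volume.restrict K : Measure E3) := ⟨by simpa using hK.measure_lt_top⟩
    refine MemLp.of_bound hgm.aestronglyMeasurable (L / c) ?_
    filter_upwards [ae_restrict_mem hK.measurableSet] with x hx
    rw [le_div_iff₀ hc, mul_comm]
    exact (by gcongr; exact hcK x hx : _ ≤ x 2 * ‖gradient (inCoords u) x‖).trans
      (height_mul_norm_gradient_le hL hu (hKH hx))
  · obtain ⟨c, hc, hcK⟩ := exists_height_bounds hφ.2.1.isCompact hφ.2.2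
    -- Half the minimal height, so that g agrees with u on a neighbourhood of the support of φ and
    -- the gradients agree there too.
    obtain ⟨C, g, hg, hgu⟩ := exists_lipschitzWith_eqOn hL hu (half_pos hc)
    obtain ⟨D, hD⟩ : ∃ D, LipschitzWith D φ :=
      ContDiff.lipschitzWith_of_hasCompactSupport hφ.2.1 hφ.1 (by simp)
    rw [setIntegral_eq_integral_of_forall_compl_eq_zero (fun x hx => by
      rw [hφ.fderiv_eq_zero hx]; simp),
      setIntegral_eq_integral_of_forall_compl_eq_zero (fun x hx => by
      rw [hφ.eq_zero_of_notMem hx, mul_zero])]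
    have key := hg.integral_lineDeriv_mul_eq (μ := volume) hD hφ.2.1 v
    have e1 : ∫ x, inner ℝ (gradient (inCoords u) x) v * φ x = ∫ x, lineDeriv ℝ g x v * φ x := by
      refine integral_congr_ae ?_
      filter_upwards [hg.ae_differentiableAt (μ := volume)] with x hx
      by_cases hxK : x ∈ tsupport φ
      · have hev : inCoords u =ᶠ[𝓝 x] g := by
          have : c / 2 < x 2 := by linarith [hcK x hxK]
          filter_upwards [(isOpen_lt continuous_const continuous_height).mem_nhds this] with y hy
            using hgu y hy
        rw [hev.gradient_eq, inner_gradient_left, hx.lineDeriv_eq_fderiv]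
      · simp [image_eq_zero_of_notMem_tsupport hxK]
    have e2 : ∫ x, inCoords u x * fderiv ℝ φ x v = - ∫ x, lineDeriv ℝ φ x (-v) * g x := by
      rw [← integral_neg]
      refine integral_congr_ae (Eventually.of_forall fun x => ?_)
      simp only
      rw [(hφ.differentiable x).lineDeriv_eq_fderiv, map_neg, neg_mul, neg_neg]
      by_cases hxK : x ∈ tsupport φ
      · rw [hgu x (by linarith [hcK x hxK]), mul_comm]
      · rw [← inner_gradient_left, gradient_eq_zero_of_notMem hxK]
        simp
    rw [e1, e2, key]

end Hyp3

end

/-! ### Discrete groups, the quotient map and orbit sums. -/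

noncomputable section

open Filter Topology
open scoped ENNReal

open Hyp3

variable {Γ : Subgroup (Hyp3 ≃ᵢ Hyp3)}

/-- The elements of `Γ` moving the base point by at most `r`. -/
def nearIdentity (Γ : Subgroup (Hyp3 ≃ᵢ Hyp3)) (r : ℝ) : Set Γ :=
  {γ | dist ((γ : Hyp3 ≃ᵢ Hyp3) origin) origin ≤ r}

namespace IsDiscreteGroup

/-- An element of a discrete group which almost fixes a suitable finite set is the identity. -/
theorem exists_finset (hΓ : IsDiscreteGroup Γ) : ∃ (I : Finset Hyp3) (ε : ℝ), 0 < ε ∧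
    ∀ γ ∈ Γ, (∀ p ∈ I, dist (γ p) p < ε) → γ = 1 := by
  obtain ⟨O, hO, hOΓ⟩ := isDiscrete_iff_forall_mem_exists_isOpen.1 hΓ _
    (mem_image_of_mem _ Γ.one_mem)
  have h1 : ((1 : Hyp3 ≃ᵢ Hyp3) : Hyp3 → Hyp3) ∈ O := (hOΓ.symm.subset rfl).1
  obtain ⟨I, u, hu, hI⟩ := isOpen_pi_iff.1 hO _ h1
  have h2 : ∀ p : Hyp3, ∃ ε > 0, p ∈ I → Metric.ball p ε ⊆ u p := by
    intro p
    by_cases hp : p ∈ I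
    · obtain ⟨ε, hε, h⟩ := Metric.isOpen_iff.1 (hu p hp).1 p (hu p hp).2
      exact ⟨ε, hε, fun _ => h⟩
    · exact ⟨1, one_pos, fun h => absurd h hp⟩
  choose ε hε hball using h2
  obtain ⟨δ, hδ, hδI⟩ : ∃ δ > 0, ∀ p ∈ I, δ ≤ ε p := by
    rcases I.eq_empty_or_nonempty with rfl | hne
    · exact ⟨1, one_pos, by simp⟩
    · obtain ⟨p, -, hp⟩ := I.exists_min_image ε hne
      exact ⟨ε p, hε p, hp⟩
  refine ⟨I, δ, hδ, fun γ hγ h => ?_⟩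
  have h3 : (γ : Hyp3 → Hyp3) ∈ O := hI fun p hp =>
    hball p hp (Metric.mem_ball.2 ((h p hp).trans_le (hδI p hp)))
  have h4 : (γ : Hyp3 → Hyp3) ∈ ({((1 : Hyp3 ≃ᵢ Hyp3) : Hyp3 → Hyp3)} : Set _) := by
    rw [← hOΓ]
    exact ⟨h3, γ, hγ, rfl⟩
  exact IsometryEquiv.ext fun p => congrFun h4 p

/-- These elements move the finite set of `exists_finset` inside a compact product of balls.
Infinitely many of them would include two whose values on that set differ by less than ε, and the
quotient of those two would be the identity. -/
theorem finite_nearIdentity (hΓ : IsDiscreteGroup Γ) (r : ℝ) : (nearIdentity Γ r).Finite := by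
  obtain ⟨I, ε, hε, h⟩ := hΓ.exists_finset
  by_contra hinf
  let ev : Γ → (I → Hyp3) := fun γ p => (γ : Hyp3 ≃ᵢ Hyp3) p
  let T : Set (I → Hyp3) := univ.pi fun p => Metric.closedBall origin (dist (p : Hyp3) origin + r)
  have hT : IsCompact T := isCompact_univ_pi fun p => Hyp3.isCompact_closedBall _ _
  have hmaps : MapsTo ev (nearIdentity Γ r) T := by
    intro γ hγ p _
    rw [Metric.mem_closedBall]
    have hγ' : dist ((γ : Hyp3 ≃ᵢ Hyp3) origin) origin ≤ r := hγ
    calc dist ((γ : Hyp3 ≃ᵢ Hyp3) p) origin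
        ≤ dist ((γ : Hyp3 ≃ᵢ Hyp3) p) ((γ : Hyp3 ≃ᵢ Hyp3) origin) +
          dist ((γ : Hyp3 ≃ᵢ Hyp3) origin) origin := dist_triangle _ _ _
      _ ≤ _ := by rw [(γ : Hyp3 ≃ᵢ Hyp3).isometry.dist_eq]; gcongr
  obtain ⟨t, ht, hcov⟩ := Metric.totallyBounded_iff.1 hT.totallyBounded (ε / 2) (half_pos hε)
  have hch : ∀ γ : Γ, ∃ y, γ ∈ nearIdentity Γ r → y ∈ t ∧ dist (ev γ) y < ε / 2 := by
    intro γ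
    by_cases hγ : γ ∈ nearIdentity Γ r
    · have := hcov (hmaps hγ)
      simp only [mem_iUnion, Metric.mem_ball, exists_prop] at this
      obtain ⟨y, hy⟩ := this
      exact ⟨y, fun _ => hy⟩
    · exact ⟨fun _ => origin, fun h => absurd h hγ⟩
  choose c hc using hch
  obtain ⟨γ, hγ, δ, hδ, hne, heq⟩ := Set.Infinite.exists_ne_map_eq_of_mapsTo hinf
    (fun γ hγ => (hc γ hγ).1) ht
  apply hne
  have hlt : dist (ev γ) (ev δ) < ε := by
    have h1 := (hc γ hγ).2
    have h2 := (hc δ hδ).2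
    rw [heq] at h1
    linarith [dist_triangle_right (ev γ) (ev δ) (c δ)]
  have h1 := h ((δ⁻¹ * γ : Γ) : Hyp3 ≃ᵢ Hyp3) (δ⁻¹ * γ).2 fun p hp => by
    have : dist ((γ : Hyp3 ≃ᵢ Hyp3) p) ((δ : Hyp3 ≃ᵢ Hyp3) p) < ε :=
      (dist_le_pi_dist (ev γ) (ev δ) ⟨p, hp⟩).trans_lt hlt
    rw [← (δ : Hyp3 ≃ᵢ Hyp3).isometry.dist_eq]
    convert! this using 2
    exact (δ : Hyp3 ≃ᵢ Hyp3).apply_symm_apply _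
  have h2 : δ⁻¹ * γ = 1 := Subtype.ext h1
  exact (inv_mul_eq_one.1 h2).symm

theorem countable (hΓ : IsDiscreteGroup Γ) : Countable Γ := by
  have h : (univ : Set Γ) = ⋃ n : ℕ, nearIdentity Γ n := by
    refine (eq_univ_of_forall fun γ => ?_).symm
    obtain ⟨n, hn⟩ := exists_nat_ge (dist ((γ : Hyp3 ≃ᵢ Hyp3) origin) origin)
    exact mem_iUnion.2 ⟨n, hn⟩
  rw [← countable_univ_iff, h]
  exact countable_iUnion fun n => (hΓ.finite_nearIdentity n).countable

end IsDiscreteGroup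

namespace Orbifold

theorem proj_eq_iff {p q : Hyp3} : proj Γ p = proj Γ q ↔ ∃ γ ∈ Γ, γ p = q :=
  Quotient.eq (r := orbitSetoid Γ)

theorem proj_apply (γ : Γ) (p : Hyp3) : proj Γ ((γ : Hyp3 ≃ᵢ Hyp3) p) = proj Γ p :=
  (proj_eq_iff.2 ⟨γ, γ.2, rfl⟩).symm

theorem surjective_proj : Function.Surjective (proj Γ) := Quotient.mk_surjective

theorem isQuotientMap_proj : IsQuotientMap (proj Γ) := isQuotientMap_quotient_mk'

theorem continuous_proj : Continuous (proj Γ) := isQuotientMap_proj.continuous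

theorem isOpenMap_proj : IsOpenMap (proj Γ) := by
  intro U hU
  rw [← isQuotientMap_proj.isOpen_preimage]
  have : proj Γ ⁻¹' (proj Γ '' U) = ⋃ γ : Γ, (γ : Hyp3 ≃ᵢ Hyp3) ⁻¹' U := by
    ext p
    simp only [mem_preimage, mem_image, mem_iUnion]
    constructor
    · rintro ⟨q, hq, h⟩
      obtain ⟨γ, hγ, rfl⟩ := proj_eq_iff.1 h.symm
      exact ⟨⟨γ, hγ⟩, hq⟩
    · rintro ⟨γ, hγ⟩
      exact ⟨_, hγ, proj_apply γ p⟩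
  rw [this]
  exact isOpen_iUnion fun γ => hU.preimage (γ : Hyp3 ≃ᵢ Hyp3).continuous

/-- The projections of the balls around the base point form an open cover of the compact quotient,
so one of the balls meets every orbit. -/
theorem exists_radius [CompactSpace (Orbifold Γ)] :
    ∃ R : ℝ, ∀ p : Hyp3, ∃ γ : Γ, dist ((γ : Hyp3 ≃ᵢ Hyp3) p) origin < R := by
  obtain ⟨t, ht⟩ := isCompact_univ.elim_finite_subcover
    (fun n : ℕ => proj Γ '' Metric.ball origin n) (fun n => isOpenMap_proj _ Metric.isOpen_ball)
    fun x _ => by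
      obtain ⟨p, rfl⟩ := surjective_proj x
      obtain ⟨n, hn⟩ := exists_nat_gt (dist p origin)
      exact mem_iUnion.2 ⟨n, p, hn, rfl⟩
  refine ⟨((t.sup id : ℕ) : ℝ), fun p => ?_⟩
  obtain ⟨n, hn, q, hq, h⟩ : ∃ n ∈ t, proj Γ p ∈ proj Γ '' Metric.ball origin n := by
    simpa using ht (mem_univ (proj Γ p))
  obtain ⟨γ, hγ, rfl⟩ := proj_eq_iff.1 h.symm
  refine ⟨⟨γ, hγ⟩, (Metric.mem_ball.1 hq).trans_le ?_⟩
  exact_mod_cast Finset.le_sup (f := id) hn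

end Orbifold

theorem exists_radius_of_isCompact {K : Set E3} (hK : IsCompact K) (hKH : K ⊆ upperHalfSpace) :
    ∃ r : ℝ, ∀ p : Hyp3, p.val ∈ K → dist p origin ≤ r := by
  have hK' : IsCompact (Hyp3.val ⁻¹' K) :=
    (isInducing_val.isCompact_preimage_iff (by rw [range_val]; exact hKH)).2 hK
  obtain ⟨r, hr⟩ := (hK'.image (f := fun p : Hyp3 => dist p origin)
    (by fun_prop)).bddAbove
  exact ⟨r, fun p hp => hr (mem_image_of_mem _ hp)⟩

theorem IsTestFunction.exists_radius {φ : E3 → ℝ} (hφ : IsTestFunction φ) :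
    ∃ r : ℝ, ∀ p : Hyp3, p.val ∈ tsupport φ → dist p origin ≤ r :=
  exists_radius_of_isCompact hφ.2.1.isCompact hφ.2.2

theorem mem_nearIdentity_of_dist_le {γ : Γ} {p : Hyp3} {r s : ℝ}
    (h1 : dist ((γ : Hyp3 ≃ᵢ Hyp3) p) origin ≤ r) (h2 : dist p origin ≤ s) :
    γ ∈ nearIdentity Γ (r + s) := by
  change dist ((γ : Hyp3 ≃ᵢ Hyp3) origin) origin ≤ r + s
  have h3 := dist_triangle_left ((γ : Hyp3 ≃ᵢ Hyp3) origin) origin ((γ : Hyp3 ≃ᵢ Hyp3) p)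
  rw [(γ : Hyp3 ≃ᵢ Hyp3).isometry.dist_eq] at h3
  linarith

theorem inv_mem_nearIdentity {γ : Γ} {r : ℝ} (h : γ ∈ nearIdentity Γ r) :
    γ⁻¹ ∈ nearIdentity Γ r := by
  change dist (((γ⁻¹ : Γ) : Hyp3 ≃ᵢ Hyp3) origin) origin ≤ r
  have h1 : (γ : Hyp3 ≃ᵢ Hyp3) (((γ⁻¹ : Γ) : Hyp3 ≃ᵢ Hyp3) origin) = origin :=
    (γ : Hyp3 ≃ᵢ Hyp3).apply_symm_apply _
  rw [← (γ : Hyp3 ≃ᵢ Hyp3).isometry.dist_eq, h1, dist_comm]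
  exact h

/-- The sum of the translates of a function by the elements of `Γ`. -/
def orbitSum (Γ : Subgroup (Hyp3 ≃ᵢ Hyp3)) (φ : E3 → ℝ) (x : E3) : ℝ :=
  ∑ᶠ γ : Γ, φ (act (γ : Hyp3 ≃ᵢ Hyp3) x)

theorem orbitSum_act (φ : E3 → ℝ) (δ : Γ) {x : E3} (hx : x ∈ upperHalfSpace) :
    orbitSum Γ φ (act δ x) = orbitSum Γ φ x := by
  calc orbitSum Γ φ (act δ x) = ∑ᶠ γ : Γ, φ (act ((Equiv.mulRight δ γ : Γ) : Hyp3 ≃ᵢ Hyp3) x) :=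
        finsum_congr fun γ => by rw [Equiv.coe_mulRight, Subgroup.coe_mul, act_mul _ _ hx]
    _ = orbitSum Γ φ x :=
        finsum_comp_equiv (Equiv.mulRight δ) (f := fun γ : Γ => φ (act (γ : Hyp3 ≃ᵢ Hyp3) x))

/-- On a ball of `ℍ³` only finitely many translates of a test function do not vanish. -/
theorem eq_zero_of_notMem_nearIdentity {φ : E3 → ℝ} {r s : ℝ}
    (hr : ∀ p : Hyp3, p.val ∈ tsupport φ → dist p origin ≤ r) {γ : Γ}
    (hγ : γ ∉ nearIdentity Γ (r + s)) {x : E3} (hx : x ∈ upperHalfSpace)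
    (hxs : dist (⟨x, hx⟩ : Hyp3) origin ≤ s) : act (γ : Hyp3 ≃ᵢ Hyp3) x ∉ tsupport φ := by
  intro h
  rw [act_of_mem _ hx] at h
  exact hγ (mem_nearIdentity_of_dist_le (hr _ h) hxs)

theorem orbitSum_eq_sum {φ : E3 → ℝ} {r s : ℝ}
    (hr : ∀ p : Hyp3, p.val ∈ tsupport φ → dist p origin ≤ r) {F : Finset Γ}
    (hF : nearIdentity Γ (r + s) ⊆ F) {x : E3}
    (hx : x ∈ upperHalfSpace) (hxs : dist (⟨x, hx⟩ : Hyp3) origin ≤ s) :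
    orbitSum Γ φ x = ∑ γ ∈ F, φ (act (γ : Hyp3 ≃ᵢ Hyp3) x) := by
  refine finsum_eq_sum_of_support_subset _ fun γ hγ => ?_
  by_contra h
  exact hγ (image_eq_zero_of_notMem_tsupport
    (eq_zero_of_notMem_nearIdentity hr (fun h' => h (hF h')) hx hxs))

end

/-! ### The partition of unity over the group, unfolding, volumes in the quotient. -/

noncomputable section

open Filter Topology
open scoped ENNReal

open Hyp3

variable {Γ : Subgroup (Hyp3 ≃ᵢ Hyp3)}

/-- The strict inequality leaves a neighbourhood of x inside the ball of radius s, on which one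
finite set of group elements serves. -/
theorem orbitSum_eventuallyEq {φ : E3 → ℝ} {r s : ℝ}
    (hr : ∀ p : Hyp3, p.val ∈ tsupport φ → dist p origin ≤ r) {F : Finset Γ}
    (hF : nearIdentity Γ (r + s) ⊆ F) {x : E3}
    (hx : x ∈ upperHalfSpace) (hxs : dist (⟨x, hx⟩ : Hyp3) origin < s) :
    orbitSum Γ φ =ᶠ[𝓝 x] fun y => ∑ γ ∈ F, φ (act (γ : Hyp3 ≃ᵢ Hyp3) y) := by
  have h : Hyp3.val '' Metric.ball origin s ∈ 𝓝 x :=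
    (isOpenEmbedding_val.isOpenMap _ Metric.isOpen_ball).mem_nhds ⟨⟨x, hx⟩, hxs, rfl⟩
  filter_upwards [h] with y hy
  obtain ⟨p, hp, rfl⟩ := hy
  exact orbitSum_eq_sum hr hF p.pos (le_of_lt hp)

theorem contDiffAt_comp_act {φ : E3 → ℝ} (hφ : ContDiff ℝ ∞ φ) (γ : Hyp3 ≃ᵢ Hyp3) {x : E3}
    (hx : x ∈ upperHalfSpace) : ContDiffAt ℝ ∞ (fun y => φ (act γ y)) x :=
  hφ.contDiffAt.comp x (contDiffAt_act γ hx)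

theorem gradient_orbitSum {φ : E3 → ℝ} {r s : ℝ} (hφ : ContDiff ℝ ∞ φ)
    (hr : ∀ p : Hyp3, p.val ∈ tsupport φ → dist p origin ≤ r) {F : Finset Γ}
    (hF : nearIdentity Γ (r + s) ⊆ F) {x : E3}
    (hx : x ∈ upperHalfSpace) (hxs : dist (⟨x, hx⟩ : Hyp3) origin < s) :
    gradient (orbitSum Γ φ) x = ∑ γ ∈ F, pull (γ : Hyp3 ≃ᵢ Hyp3) (gradient φ) x := by
  have h1 : gradient (orbitSum Γ φ) x =
      gradient (fun y => ∑ γ ∈ F, φ (act (γ : Hyp3 ≃ᵢ Hyp3) y)) x := by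
    rw [gradient, gradient, (orbitSum_eventuallyEq hr hF hx hxs).fderiv_eq]
  rw [h1, gradient, fderiv_fun_sum (A := fun (γ : Γ) y => φ (act (γ : Hyp3 ≃ᵢ Hyp3) y)) fun γ _ =>
    (contDiffAt_comp_act hφ (γ : Hyp3 ≃ᵢ Hyp3) hx).differentiableAt (by simp), map_sum]
  refine Finset.sum_congr rfl fun γ _ => ?_
  exact gradient_comp_act _ hx (hφ.differentiable (by simp) _)

namespace IsDiscreteGroup

/-- The elements of `Γ` moving the base point by at most `r`, as a finite set. -/
def near (hΓ : IsDiscreteGroup Γ) (r : ℝ) : Finset Γ := (hΓ.finite_nearIdentity r).toFinset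

theorem subset_near (hΓ : IsDiscreteGroup Γ) (r : ℝ) : nearIdentity Γ r ⊆ hΓ.near r := by
  rw [near, Set.Finite.coe_toFinset]

/-- An isometry and its inverse move the base point equally far. Unfolding needs this, since the
change of variables replaces γ by its inverse. -/
theorem sum_near_inv (hΓ : IsDiscreteGroup Γ) (r : ℝ) {M : Type*} [AddCommMonoid M] (f : Γ → M) :
    ∑ γ ∈ hΓ.near r, f γ⁻¹ = ∑ γ ∈ hΓ.near r, f γ := by
  have h : ∀ γ ∈ hΓ.near r, γ⁻¹ ∈ hΓ.near r := fun γ hγ => by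
    simp only [near, Set.Finite.mem_toFinset] at hγ ⊢
    exact inv_mem_nearIdentity hγ
  exact Finset.sum_nbij' (fun γ => γ⁻¹) (fun γ => γ⁻¹) h h (by simp) (by simp) (by simp)

theorem contDiffOn_orbitSum (hΓ : IsDiscreteGroup Γ) {φ : E3 → ℝ} (hφ : IsTestFunction φ) :
    ContDiffOn ℝ ∞ (orbitSum Γ φ) upperHalfSpace := by
  intro x hx
  obtain ⟨r, hr⟩ := hφ.exists_radius
  refine ContDiffAt.contDiffWithinAt (ContDiffAt.congr_of_eventuallyEq ?_
    (orbitSum_eventuallyEq hr (hΓ.subset_near _) hx (lt_add_one _)))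
  exact ContDiffAt.sum fun γ _ => contDiffAt_comp_act hφ.1 (γ : Hyp3 ≃ᵢ Hyp3) hx

end IsDiscreteGroup

theorem IsTestFunction.mul_contDiffOn {φ ψ : E3 → ℝ} (hφ : IsTestFunction φ)
    (hψ : ContDiffOn ℝ ∞ ψ upperHalfSpace) : IsTestFunction fun x => φ x * ψ x := by
  refine ⟨contDiff_iff_contDiffAt.2 fun x => ?_, hφ.2.1.mul_right,
    (tsupport_mul_subset_left (f := φ) (g := ψ)).trans hφ.2.2⟩
  by_cases hx : x ∈ upperHalfSpace
  · exact hφ.1.contDiffAt.mul (hψ.contDiffAt (isOpen_upperHalfSpace.mem_nhds hx))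
  · have h : φ =ᶠ[𝓝 x] 0 := notMem_tsupport_iff_eventuallyEq.1 fun h => hx (hφ.2.2 h)
    refine (contDiffAt_const (c := (0 : ℝ))).congr_of_eventuallyEq ?_
    filter_upwards [h] with y hy
    simp [hy]

/-- A nonnegative test function whose translates by the elements of `Γ` sum up to one. -/
structure IsPartition (Γ : Subgroup (Hyp3 ≃ᵢ Hyp3)) (χ : E3 → ℝ) : Prop where
  test : IsTestFunction χ
  nonneg : ∀ x, 0 ≤ χ x
  orbitSum_eq_one : ∀ x ∈ upperHalfSpace, orbitSum Γ χ x = 1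

/-- A cut-off equal to one on a ball that meets every orbit has a positive, smooth, invariant orbit
sum; dividing by it normalizes the sum of the translates. -/
theorem IsDiscreteGroup.exists_isPartition (hΓ : IsDiscreteGroup Γ) [CompactSpace (Orbifold Γ)] :
    ∃ χ, IsPartition Γ χ := by
  obtain ⟨R, hR⟩ := Orbifold.exists_radius (Γ := Γ)
  obtain ⟨ψ, hψ, hψ0, -, V, -, hKV, hψV⟩ := exists_cutoff
    ((Hyp3.isCompact_closedBall origin R).image continuous_val)
    (by rintro _ ⟨p, -, rfl⟩; exact p.pos)
  obtain ⟨r, hr⟩ := hψ.exists_radius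
  have hpos : ∀ x ∈ upperHalfSpace, 0 < orbitSum Γ ψ x := by
    intro x hx
    rw [orbitSum_eq_sum hr (hΓ.subset_near _) hx le_rfl]
    obtain ⟨γ, hγ⟩ := hR ⟨x, hx⟩
    have h1 : ψ (act (γ : Hyp3 ≃ᵢ Hyp3) x) = 1 := by
      rw [act_of_mem _ hx]
      exact hψV _ (hKV ⟨_, Metric.mem_closedBall.2 hγ.le, rfl⟩)
    refine Finset.sum_pos' (fun γ _ => hψ0 _) ⟨γ, ?_, by rw [h1]; exact one_pos⟩
    by_contra h
    refine eq_zero_of_notMem_nearIdentity hr (fun h' => h (hΓ.subset_near _ h')) hx le_rfl ?_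
    exact subset_tsupport _ (by rw [Function.mem_support, h1]; exact one_ne_zero)
  have htest : IsTestFunction fun x => ψ x * (orbitSum Γ ψ x)⁻¹ :=
    hψ.mul_contDiffOn ((hΓ.contDiffOn_orbitSum hψ).inv fun x hx => (hpos x hx).ne')
  refine ⟨_, htest, fun x => ?_, fun x hx => ?_⟩
  · by_cases hx : x ∈ upperHalfSpace
    · exact mul_nonneg (hψ0 x) (inv_nonneg.2 (hpos x hx).le)
    · simp [hψ.eq_zero_of_notMem hx]
  · have hr' : ∀ p : Hyp3, p.val ∈ tsupport (fun x => ψ x * (orbitSum Γ ψ x)⁻¹) →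
        dist p origin ≤ r := fun p hp => hr p (tsupport_mul_subset_left (f := ψ) hp)
    rw [orbitSum_eq_sum hr' (hΓ.subset_near _) hx le_rfl]
    simp_rw [orbitSum_act _ _ hx]
    rw [← Finset.sum_mul, ← orbitSum_eq_sum hr (hΓ.subset_near _) hx le_rfl,
      mul_inv_cancel₀ (hpos x hx).ne']

theorem ae_mem_hvol : ∀ᵐ x ∂hvol, x ∈ upperHalfSpace :=
  (withDensity_absolutelyContinuous _ _).ae_le (ae_restrict_mem measurableSet_upperHalfSpace)

namespace IsPartition

variable {χ : E3 → ℝ}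

theorem sum_eq_one (hχ : IsPartition Γ χ) {r s : ℝ}
    (hr : ∀ p : Hyp3, p.val ∈ tsupport χ → dist p origin ≤ r) {F : Finset Γ}
    (hF : nearIdentity Γ (r + s) ⊆ F) {x : E3}
    (hx : x ∈ upperHalfSpace) (hxs : dist (⟨x, hx⟩ : Hyp3) origin ≤ s) :
    ∑ γ ∈ F, χ (act (γ : Hyp3 ≃ᵢ Hyp3) x) = 1 := by
  rw [← orbitSum_eq_sum hr hF hx hxs, hχ.orbitSum_eq_one x hx]

/-- Unfolding: an integral over `ℍ³` as an integral over the quotient. -/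
theorem integral_eq (hχ : IsPartition Γ χ) (hΓ : IsDiscreteGroup Γ) {r s : ℝ}
    (hr : ∀ p : Hyp3, p.val ∈ tsupport χ → dist p origin ≤ r)
    {T : E3 → ℝ} (hT : Integrable T hvol)
    (hs : ∀ p : Hyp3, s < dist p origin → T p.val = 0) :
    ∫ x, T x ∂hvol =
      ∫ x, χ x * ∑ γ ∈ hΓ.near (r + s), T (act (γ : Hyp3 ≃ᵢ Hyp3) x) ∂hvol := by
  obtain ⟨C, hC⟩ : ∃ C, ∀ x, ‖χ x‖ ≤ C := hχ.test.continuous.bounded_above_of_compact_support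
    hχ.test.2.1
  have hint : ∀ γ : Γ, Integrable (fun x => χ x * T (act (γ : Hyp3 ≃ᵢ Hyp3) x)) hvol := fun γ =>
    ((measurePreserving_act (γ : Hyp3 ≃ᵢ Hyp3)).integrable_comp_of_integrable hT).bdd_mul
      hχ.test.continuous.aestronglyMeasurable (Eventually.of_forall hC)
  -- The factor 1 = ∑ χ ∘ γ is inserted on the ball that carries T; each term is then moved by its
  -- group element.
  have h1 : ∀ᵐ x ∂hvol, T x = ∑ γ ∈ hΓ.near (r + s), χ (act (γ : Hyp3 ≃ᵢ Hyp3) x) * T x := by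
    filter_upwards [ae_mem_hvol] with x hx
    rw [← Finset.sum_mul]
    by_cases hxs : dist (⟨x, hx⟩ : Hyp3) origin ≤ s
    · rw [hχ.sum_eq_one hr (hΓ.subset_near _) hx hxs, one_mul]
    · rw [hs ⟨x, hx⟩ (not_le.1 hxs), mul_zero]
  have h2 : ∀ γ : Γ, Integrable (fun x => χ (act (γ : Hyp3 ≃ᵢ Hyp3) x) * T x) hvol := fun γ =>
    hT.bdd_mul (hχ.test.continuous.measurable.comp (measurable_act _)).aestronglyMeasurable
      (Eventually.of_forall fun x => hC _)
  rw [integral_congr_ae h1, integral_finsetSum _ fun γ _ => h2 γ]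
  simp_rw [Finset.mul_sum]
  rw [integral_finsetSum _ fun γ _ => hint γ, ← hΓ.sum_near_inv]
  refine Finset.sum_congr rfl fun γ _ => ?_
  rw [← (measurePreserving_act (γ : Hyp3 ≃ᵢ Hyp3)).integral_comp (measurableEmbedding_act _)]
  refine integral_congr_ae ?_
  filter_upwards [ae_mem_hvol] with x hx
  rw [Subgroup.coe_inv, act_inv_act _ hx]

theorem tsum_eq_one (hχ : IsPartition Γ χ) (hΓ : IsDiscreteGroup Γ) {x : E3}
    (hx : x ∈ upperHalfSpace) :
    ∑' γ : Γ, ENNReal.ofReal (χ (act (γ : Hyp3 ≃ᵢ Hyp3) x)) = 1 := by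
  obtain ⟨r, hr⟩ := hχ.test.exists_radius
  have h1 := hχ.sum_eq_one hr (hΓ.subset_near _) hx le_rfl
  rw [tsum_eq_sum (s := hΓ.near (r + dist (⟨x, hx⟩ : Hyp3) origin)) fun γ hγ => ?_,
    ← ENNReal.ofReal_sum_of_nonneg fun γ _ => hχ.nonneg _, h1, ENNReal.ofReal_one]
  rw [image_eq_zero_of_notMem_tsupport (eq_zero_of_notMem_nearIdentity hr
    (fun h' => hγ (hΓ.subset_near _ h')) hx le_rfl), ENNReal.ofReal_zero]

theorem measurable_ofReal (hχ : IsPartition Γ χ) (γ : Γ) :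
    Measurable fun p : Hyp3 => ENNReal.ofReal (χ ((γ : Hyp3 ≃ᵢ Hyp3) p).val) :=
  (hχ.test.continuous.comp (continuous_val.comp
    (γ : Hyp3 ≃ᵢ Hyp3).continuous)).measurable.ennreal_ofReal

theorem tsum_apply_eq_one (hχ : IsPartition Γ χ) (hΓ : IsDiscreteGroup Γ) (p : Hyp3) :
    ∑' γ : Γ, ENNReal.ofReal (χ ((γ : Hyp3 ≃ᵢ Hyp3) p).val) = 1 := by
  rw [← hχ.tsum_eq_one hΓ p.pos]
  simp_rw [act_val]

/-- Insert 1 = ∑ χ ∘ γ and move each term by γ. -/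
theorem vol_eq_tsum (hχ : IsPartition Γ χ) (hΓ : IsDiscreteGroup Γ) (B : Set Hyp3) :
    vol B = ∑' γ : Γ, ∫⁻ p in (γ : Hyp3 ≃ᵢ Hyp3) '' B, ENNReal.ofReal (χ p.val) ∂vol := by
  have := hΓ.countable
  calc vol B = ∫⁻ p in B, ∑' γ : Γ, ENNReal.ofReal (χ ((γ : Hyp3 ≃ᵢ Hyp3) p).val) ∂vol := by
        simp_rw [hχ.tsum_apply_eq_one hΓ, setLIntegral_one]
    _ = _ := by
        rw [lintegral_tsum fun γ => (hχ.measurable_ofReal γ).aemeasurable]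
        refine tsum_congr fun γ => ?_
        rw [← (measurePreserving_vol (γ : Hyp3 ≃ᵢ Hyp3)).setLIntegral_comp_preimage_emb
          (γ : Hyp3 ≃ᵢ Hyp3).toHomeomorph.measurableEmbedding
          (fun p => ENNReal.ofReal (χ p.val))]
        rw [preimage_image_eq _ (γ : Hyp3 ≃ᵢ Hyp3).injective]

/-- The volume of a subset of the orbifold in terms of the density `χ`. -/
theorem orbifoldVol_le (hχ : IsPartition Γ χ) (hΓ : IsDiscreteGroup Γ) (A : Set (Orbifold Γ)) :
    Orbifold.vol A ≤ ∫⁻ p in Orbifold.proj Γ ⁻¹' A, ENNReal.ofReal (χ p.val) ∂vol := by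
  have := hΓ.countable
  refine iSup_le fun B => iSup_le fun hB => iSup_le fun hinj => iSup_le fun hmaps => ?_
  rw [hχ.vol_eq_tsum hΓ, ← lintegral_iUnion₀]
  · refine lintegral_mono_set (iUnion_subset fun γ => ?_)
    rintro _ ⟨p, hp, rfl⟩
    rw [mem_preimage, Orbifold.proj_apply]
    exact hmaps hp
  · exact fun γ => ((γ : Hyp3 ≃ᵢ Hyp3).toHomeomorph.measurableEmbedding.measurableSet_image.2
      hB).nullMeasurableSet
  -- Since B injects into the quotient, a common point of two translates comes from a single point
  -- of B, and is therefore fixed by the nontrivial element γ δ⁻¹.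
  · intro γ δ hγδ
    have hne : ((γ : Hyp3 ≃ᵢ Hyp3) * (δ : Hyp3 ≃ᵢ Hyp3)⁻¹) ≠ 1 := fun h =>
      hγδ (Subtype.ext (mul_inv_eq_one.1 h))
    refine measure_mono_null ?_ (vol_fixedPoints hne)
    rintro _ ⟨⟨p, hp, rfl⟩, q, hq, hpq⟩
    have h1 : q = p := hinj hq hp (by
      rw [← Orbifold.proj_apply γ p, ← Orbifold.proj_apply δ q, hpq])
    subst h1
    change (γ : Hyp3 ≃ᵢ Hyp3) ((δ : Hyp3 ≃ᵢ Hyp3).symm ((γ : Hyp3 ≃ᵢ Hyp3) q)) = _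
    rw [← hpq, IsometryEquiv.symm_apply_apply, hpq]

/-- Without injectivity of the projection on B, subadditivity still gives one inequality, enough to
bound the volume of the image of a ball from above. -/
theorem lintegral_orbit_le (hχ : IsPartition Γ χ) (hΓ : IsDiscreteGroup Γ) (B : Set Hyp3) :
    ∫⁻ p in ⋃ γ : Γ, (γ : Hyp3 ≃ᵢ Hyp3) '' B, ENNReal.ofReal (χ p.val) ∂vol ≤ vol B := by
  have := hΓ.countable
  rw [hχ.vol_eq_tsum hΓ B]
  exact lintegral_iUnion_le _ _

end IsPartition

end

/-! ### Minimizing a Rayleigh quotient for two abstract quadratic forms. -/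

noncomputable section

open Filter Topology

/-- A nonnegative quadratic form `a` attains its minimum on the unit sphere of a nonnegative
quadratic form `b` if the space is complete for `a + b` and `b` is compact relative to `a + b`. -/
theorem LinearMap.BilinForm.exists_minimizer {X : Type*} [AddCommGroup X] [Module ℝ X]
    {a b : LinearMap.BilinForm ℝ X} (ha : a.IsSymm) (hb : b.IsSymm)
    (ha0 : ∀ u, 0 ≤ a u u) (hb0 : ∀ u, 0 ≤ b u u)
    (hcomplete : ∀ u : ℕ → X,
      (∀ ε > 0, ∃ N, ∀ m ≥ N, ∀ n ≥ N,
        a (u m - u n) (u m - u n) + b (u m - u n) (u m - u n) ≤ ε) →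
      ∃ w, Tendsto (fun n => a (u n - w) (u n - w) + b (u n - w) (u n - w)) atTop (𝓝 0))
    (hcompact : ∀ ε > 0, ∃ (m : ℕ) (ℓ : Fin m → X →ₗ[ℝ] ℝ) (C : ℝ),
      (∀ i u, ℓ i u ^ 2 ≤ C * (a u u + b u u)) ∧
      ∀ u, b u u ≤ ε * (a u u + b u u) + ∑ i, ℓ i u ^ 2)
    (hne : ∃ u, b u u ≠ 0) :
    ∃ (u : X) (c : ℝ), b u u = 1 ∧ (∀ v, a u v = c * b u v) ∧ ∀ v, c * b v v ≤ a v v := by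
  have hscale : ∀ (d : LinearMap.BilinForm ℝ X) (t : ℝ) (u : X),
      d (t • u) (t • u) = t ^ 2 * d u u := by
    intro d t u
    simp only [map_smul, LinearMap.smul_apply, smul_eq_mul]
    ring
  have hnormalize : ∀ u, b u u ≠ 0 → b ((√(b u u))⁻¹ • u) ((√(b u u))⁻¹ • u) = 1 := by
    intro u hu
    rw [hscale, inv_pow, Real.sq_sqrt (hb0 u), inv_mul_cancel₀ hu]
  set S : Set ℝ := {r | ∃ u, b u u = 1 ∧ a u u = r} with hS
  have hSne : S.Nonempty := by
    obtain ⟨u, hu⟩ := hne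
    exact ⟨_, _, hnormalize u hu, rfl⟩
  have hSbdd : BddBelow S := ⟨0, by rintro _ ⟨u, -, rfl⟩; exact ha0 u⟩
  set c := sInf S with hc
  have hc0 : 0 ≤ c := Real.sInf_nonneg (by rintro _ ⟨u, -, rfl⟩; exact ha0 u)
  have hmin : ∀ v, c * b v v ≤ a v v := by
    intro v
    by_cases hv : b v v = 0
    · rw [hv, mul_zero]
      exact ha0 v
    · have h1 : c ≤ _ := csInf_le hSbdd ⟨_, hnormalize v hv, rfl⟩
      have hv' : 0 < b v v := lt_of_le_of_ne (hb0 v) (Ne.symm hv)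
      rw [hscale, inv_pow, Real.sq_sqrt (hb0 v), inv_mul_eq_div, le_div_iff₀ hv'] at h1
      exact h1
  obtain ⟨r, -, hrlim, hrS⟩ := exists_seq_tendsto_sInf hSne hSbdd
  choose u hu1 hur using hrS
  have hua : Tendsto (fun n => a (u n) (u n)) atTop (𝓝 c) := by simpa only [hur] using hrlim
  obtain ⟨M, hM⟩ : ∃ M, ∀ n, a (u n) (u n) + b (u n) (u n) ≤ M := by
    obtain ⟨M, hM⟩ := hua.bddAbove_range
    refine ⟨M + 1, fun n => ?_⟩
    rw [hu1]
    linarith [hM ⟨n, rfl⟩]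
  have hpar : ∀ (d : LinearMap.BilinForm ℝ X) (x y : X),
      d (x - y) (x - y) = 2 * d x x + 2 * d y y - d (x + y) (x + y) := by
    intro d x y
    simp only [map_sub, map_add, LinearMap.sub_apply, LinearMap.add_apply]
    ring
  have hdiff : ∀ m n, a (u m - u n) (u m - u n) + b (u m - u n) (u m - u n) ≤ 4 * M := by
    intro m n
    rw [hpar a, hpar b]
    linarith [ha0 (u m + u n), hb0 (u m + u n), hM m, hM n]
  choose m ℓ C hℓC hℓ using fun k : ℕ => hcompact (1 / ((k : ℝ) + 1)) (by positivity)
  -- All values of all the functionals along the minimizing sequence lie in a product of compact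
  -- intervals, so Tychonoff's theorem does the work of a diagonal argument.
  let z : ℕ → ∀ k, Fin (m k) → ℝ := fun n k i => ℓ k i (u n)
  have hz : ∀ n, z n ∈ univ.pi fun k => univ.pi fun _ : Fin (m k) =>
      Icc (-√(C k * M)) (√(C k * M)) := by
    intro n k _ i _
    rw [mem_Icc, ← abs_le, ← Real.sqrt_sq_eq_abs]
    refine Real.sqrt_le_sqrt ((hℓC k i (u n)).trans ?_)
    have h1 := hℓC k i (u n)
    have h2 : 0 ≤ a (u n) (u n) + b (u n) (u n) := add_nonneg (ha0 _) (hb0 _)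
    have h3 : 0 < a (u n) (u n) + b (u n) (u n) := by rw [hu1]; linarith [ha0 (u n)]
    have h4 : 0 ≤ C k := by
      by_contra h
      nlinarith [sq_nonneg (ℓ k i (u n))]
    exact mul_le_mul_of_nonneg_left (hM n) h4
  obtain ⟨y, -, φ, hφ, hy⟩ := (isCompact_univ_pi fun k =>
    isCompact_univ_pi fun _ : Fin (m k) => isCompact_Icc).tendsto_subseq hz
  have hyc : ∀ k i, CauchySeq fun n => ℓ k i (u (φ n)) := fun k i =>
    ((tendsto_pi_nhds.1 (tendsto_pi_nhds.1 hy k)) i).cauchySeq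
  -- With k large the multiple of the norm in `hℓ` is small, and the finitely many functionals of
  -- index k are Cauchy along the subsequence.
  have hbC : ∀ ε > 0, ∃ N, ∀ p ≥ N, ∀ q ≥ N,
      b (u (φ p) - u (φ q)) (u (φ p) - u (φ q)) ≤ ε := by
    intro ε hε
    obtain ⟨k, hk⟩ := exists_nat_gt (4 * M / (ε / 2))
    have hM0 : 0 ≤ M := (add_nonneg (ha0 _) (hb0 _)).trans (hM 0)
    have hk1 : 1 / ((k : ℝ) + 1) * (4 * M) ≤ ε / 2 := by
      rw [div_lt_iff₀ (half_pos hε)] at hk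
      rw [one_div, inv_mul_le_iff₀ (by positivity)]
      nlinarith
    have hδ : 0 < ε / 2 / (m k + 1) := by positivity
    have hch : ∀ i, ∃ N, ∀ p ≥ N, ∀ q ≥ N,
        dist (ℓ k i (u (φ p))) (ℓ k i (u (φ q))) < √(ε / 2 / (m k + 1)) := fun i =>
      Metric.cauchySeq_iff.1 (hyc k i) _ (Real.sqrt_pos.2 hδ)
    choose N hN using hch
    refine ⟨Finset.univ.sup N, fun p hp q hq => ?_⟩
    have h1 := hℓ k (u (φ p) - u (φ q))
    have h2 : ∑ i, ℓ k i (u (φ p) - u (φ q)) ^ 2 ≤ ε / 2 := by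
      calc ∑ i, ℓ k i (u (φ p) - u (φ q)) ^ 2 ≤ ∑ _i : Fin (m k), ε / 2 / (m k + 1) := by
            refine Finset.sum_le_sum fun i _ => ?_
            have h3 := hN i p ((Finset.le_sup (Finset.mem_univ i)).trans hp) q
              ((Finset.le_sup (Finset.mem_univ i)).trans hq)
            rw [Real.dist_eq, ← map_sub] at h3
            rw [← sq_abs, ← Real.sq_sqrt hδ.le]
            exact pow_le_pow_left₀ (abs_nonneg _) h3.le 2
        _ = m k * (ε / 2 / (m k + 1)) := by simp
        _ ≤ ε / 2 := by
            rw [mul_div_assoc', div_le_iff₀ (by positivity)]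
            nlinarith
    have h3 := mul_le_mul_of_nonneg_left (hdiff (φ p) (φ q))
      (show (0 : ℝ) ≤ 1 / ((k : ℝ) + 1) by positivity)
    linarith
  -- The sequence is Cauchy for a as well: by the parallelogram law and the minimality of c at the
  -- sum of two terms, the a-norm of their difference is at most c times its b-norm, up to ε / 2.
  obtain ⟨w, hw⟩ := hcomplete (fun n => u (φ n)) fun ε hε => by
    obtain ⟨N, hN⟩ := hbC (ε / 2 / (c + 1)) (by positivity)
    obtain ⟨N', hN'⟩ := eventually_atTop.1
      ((hua.comp hφ.tendsto_atTop).eventually_le_const (show c < c + ε / 8 by linarith))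
    refine ⟨max N N', fun p hp q hq => ?_⟩
    have h1 := hN p (le_of_max_le_left hp) q (le_of_max_le_left hq)
    have h2 := hN' p (le_of_max_le_right hp)
    have h3 := hN' q (le_of_max_le_right hq)
    simp only [Function.comp_apply] at h2 h3
    have h4 := hmin (u (φ p) + u (φ q))
    have h5 := hpar a (u (φ p)) (u (φ q))
    have h6 := hpar b (u (φ p)) (u (φ q))
    rw [hu1, hu1] at h6
    set B := b (u (φ p) - u (φ q)) (u (φ p) - u (φ q))
    rw [show b (u (φ p) + u (φ q)) (u (φ p) + u (φ q)) = 4 - B by linarith] at h4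
    have h7 : (c + 1) * B ≤ ε / 2 := by
      rw [le_div_iff₀ (by positivity)] at h1
      linarith
    nlinarith
  have hcont : ∀ d : LinearMap.BilinForm ℝ X, d.IsSymm → (∀ u, 0 ≤ d u u) →
      Tendsto (fun n => d (u (φ n) - w) (u (φ n) - w)) atTop (𝓝 0) →
      Tendsto (fun n => d (u (φ n)) (u (φ n))) atTop (𝓝 (d w w)) := by
    intro d hd hd0 hlim
    have h1 : Tendsto (fun n => d (u (φ n) - w) w) atTop (𝓝 0) := by
      have h2 : Tendsto (fun n => √(d (u (φ n) - w) (u (φ n) - w) * d w w)) atTop (𝓝 0) := by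
        have := (hlim.mul_const (d w w)).sqrt
        rwa [zero_mul, Real.sqrt_zero] at this
      refine squeeze_zero_norm (fun n => ?_) h2
      exact Real.abs_le_sqrt (LinearMap.BilinForm.apply_sq_le_of_symm d hd0 ⟨hd.eq⟩ _ _)
    have h3 := ((hlim.add (h1.const_mul 2)).add_const (d w w))
    rw [mul_zero, zero_add, zero_add] at h3
    refine h3.congr fun n => ?_
    have h4 : d w (u (φ n)) = d (u (φ n)) w := hd.eq _ _
    simp only [map_sub, LinearMap.sub_apply]
    linarith
  have hwa := hcont a ha ha0 (squeeze_zero (fun n => ha0 _)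
    (fun n => le_add_of_nonneg_right (hb0 _)) hw)
  have hwb := hcont b hb hb0 (squeeze_zero (fun n => hb0 _)
    (fun n => le_add_of_nonneg_left (ha0 _)) hw)
  have hwa' : a w w = c := tendsto_nhds_unique hwa (hua.comp hφ.tendsto_atTop)
  have hwb' : b w w = 1 := tendsto_nhds_unique hwb (by simp only [hu1]; exact tendsto_const_nhds)
  refine ⟨w, c, hwb', fun v => ?_, hmin⟩
  -- The form a - c b is nonnegative and vanishes at (w, w), so by Cauchy–Schwarz it vanishes at (w,
  -- v) for every v.
  have hq := LinearMap.BilinForm.apply_sq_le_of_symm (a - c • b)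
    (fun x => by simpa using hmin x) ⟨fun x y => by
      simp only [LinearMap.sub_apply, LinearMap.smul_apply, RingHom.id_apply]
      rw [← ha.eq, ← hb.eq]⟩ w v
  simp only [LinearMap.sub_apply, LinearMap.smul_apply, smul_eq_mul, hwa', hwb', mul_one, sub_self,
    zero_mul] at hq
  have := pow_eq_zero_iff (two_ne_zero) |>.1 (le_antisymm hq (sq_nonneg _))
  linarith

end

/-! ### The cell measure as a substitute for a fundamental domain. -/

noncomputable section

open Filter Topology
open scoped ENNReal

open Hyp3

variable {Γ : Subgroup (Hyp3 ≃ᵢ Hyp3)}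

theorem MeasureTheory.MemLp.sq_eLpNorm_two_eq {α F : Type*} [MeasurableSpace α]
    [NormedAddCommGroup F] {μ : Measure α} {f : α → F} (hf : MemLp f 2 μ) :
    eLpNorm f 2 μ ^ 2 = ENNReal.ofReal (∫ x, ‖f x‖ ^ 2 ∂μ) := by
  rw [sq_eLpNorm_two, ofReal_integral_eq_lintegral_ofReal
    (hf.integrable_norm_pow two_ne_zero) (Eventually.of_forall fun x => by positivity)]
  refine lintegral_congr fun x => ?_
  rw [ENNReal.ofReal_pow (norm_nonneg _), ofReal_norm]

theorem MeasureTheory.MemLp.sq_norm_toLp {α F : Type*} [MeasurableSpace α]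
    [NormedAddCommGroup F] {μ : Measure α} {f : α → F} (hf : MemLp f 2 μ) :
    ‖hf.toLp‖ ^ 2 = ∫ x, ‖f x‖ ^ 2 ∂μ := by
  rw [Lp.norm_toLp, ← ENNReal.toReal_pow, hf.sq_eLpNorm_two_eq,
    ENNReal.toReal_ofReal (integral_nonneg fun x => by positivity)]

/-- Completeness of `L²`, for sequences of functions. -/
theorem exists_tendsto_of_cauchy_integral {α F : Type*} [MeasurableSpace α] [NormedAddCommGroup F]
    [CompleteSpace F] {μ : Measure α} {f : ℕ → α → F} (hf : ∀ n, MemLp (f n) 2 μ)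
    (hc : ∀ ε > 0, ∃ N, ∀ m ≥ N, ∀ n ≥ N, ∫ x, ‖f m x - f n x‖ ^ 2 ∂μ ≤ ε) :
    ∃ g, MemLp g 2 μ ∧ Tendsto (fun n => ∫⁻ x, ‖f n x - g x‖ₑ ^ 2 ∂μ) atTop (𝓝 0) ∧
      ∃ φ : ℕ → ℕ, StrictMono φ ∧ ∀ᵐ x ∂μ, Tendsto (fun k => f (φ k) x) atTop (𝓝 (g x)) := by
  have hcs : CauchySeq fun n => (hf n).toLp := by
    refine Metric.cauchySeq_iff.2 fun ε hε => ?_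
    obtain ⟨N, hN⟩ := hc ((ε / 2) ^ 2) (by positivity)
    refine ⟨N, fun m hm n hn => ?_⟩
    rw [dist_eq_norm, ← MemLp.toLp_sub]
    have h1 := hN m hm n hn
    have h2 := ((hf m).sub (hf n)).sq_norm_toLp
    simp only [Pi.sub_apply] at h2
    rw [← h2, sq_le_sq₀ (norm_nonneg _) (by positivity)] at h1
    linarith
  obtain ⟨g, hg⟩ := cauchySeq_tendsto_of_complete hcs
  have hg' : Tendsto (fun n => eLpNorm (f n - (g : α → F)) 2 μ) atTop (𝓝 0) :=
    (Lp.tendsto_Lp_iff_tendsto_eLpNorm'' f hf g (Lp.memLp g)).1 (by simpa using hg)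
  refine ⟨g, Lp.memLp g, ?_, (tendstoInMeasure_of_tendsto_eLpNorm two_ne_zero
    (fun n => (hf n).1) (Lp.memLp g).1 hg').exists_seq_tendsto_ae⟩
  have h2 := ENNReal.Tendsto.pow (n := 2) hg'
  simp only [sq_eLpNorm_two, Pi.sub_apply] at h2
  simpa using h2

theorem ae_hvol_iff {P : E3 → Prop} : (∀ᵐ x ∂hvol, P x) ↔ ∀ᵐ x, x ∈ upperHalfSpace → P x := by
  rw [hvol, ae_withDensity_iff measurable_density,
    ae_restrict_iff' measurableSet_upperHalfSpace]
  refine eventually_congr (Eventually.of_forall fun x => forall_congr' fun hx => ?_)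
  have hx2 : 0 < x 2 := hx
  have : ENNReal.ofReal (1 / x 2 ^ 3) ≠ 0 := (ENNReal.ofReal_pos.2 (by positivity)).ne'
  simp only [ne_eq, this, not_false_eq_true, true_implies]

/-- The volume of `ℍ³` weighted by `χ`. -/
def cell (χ : E3 → ℝ) : Measure E3 := hvol.withDensity fun x => ENNReal.ofReal (χ x)

namespace IsPartition

variable {χ : E3 → ℝ}

theorem measurable (hχ : IsPartition Γ χ) : Measurable fun x => ENNReal.ofReal (χ x) :=
  hχ.test.continuous.measurable.ennreal_ofReal

theorem integral_cell (hχ : IsPartition Γ χ) (F : E3 → ℝ) :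
    ∫ x, F x ∂cell χ = ∫ x, χ x * F x ∂hvol := by
  rw [cell, integral_withDensity_eq_integral_toReal_smul hχ.measurable
    (Eventually.of_forall fun x => ENNReal.ofReal_lt_top)]
  simp only [ENNReal.toReal_ofReal (hχ.nonneg _), smul_eq_mul]

theorem lintegral_cell (hχ : IsPartition Γ χ) (F : E3 → ℝ≥0∞) :
    ∫⁻ x, F x ∂cell χ = ∫⁻ x, ENNReal.ofReal (χ x) * F x ∂hvol := by
  rw [cell, lintegral_withDensity_eq_lintegral_mul_non_measurable _ hχ.measurable
    (Eventually.of_forall fun x => ENNReal.ofReal_lt_top)]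
  rfl

/-- The density χ is bounded with compact support in the half-space. Consequently local square
integrability implies square integrability over the cell. -/
theorem cell_le (hχ : IsPartition Γ χ) :
    ∃ C : NNReal, cell χ ≤ C • (volume.restrict (tsupport χ) : Measure E3) := by
  obtain ⟨C, hC⟩ := hvol_restrict_le hχ.test.2.1.isCompact hχ.test.2.2
  obtain ⟨M, hM⟩ := hχ.test.continuous.bounded_above_of_compact_support hχ.test.2.1
  refine ⟨M.toNNReal * C, ?_⟩
  have hle : cell χ ≤ (M.toNNReal : ℝ≥0∞) • hvol.restrict (tsupport χ) := by
    rw [cell, ← withDensity_const, ← withDensity_indicator (isClosed_tsupport χ).measurableSet]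
    refine withDensity_mono (Eventually.of_forall fun x => ?_)
    by_cases hx : x ∈ tsupport χ
    · simp only [indicator_of_mem hx]
      exact ENNReal.ofReal_le_ofReal ((le_abs_self _).trans (hM x))
    · simp [image_eq_zero_of_notMem_tsupport hx]
  rw [mul_smul]
  refine hle.trans ?_
  exact Measure.le_iff.2 fun s hs => by
    simp only [Measure.smul_apply]
    exact mul_le_mul_right (hC s) _

theorem isFiniteMeasure_cell (hχ : IsPartition Γ χ) : IsFiniteMeasure (cell χ) := by
  obtain ⟨C, hC⟩ := hχ.cell_le
  have : IsFiniteMeasure (volume.restrict (tsupport χ) : Measure E3) :=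
    ⟨by simpa using hχ.test.2.1.isCompact.measure_lt_top⟩
  exact isFiniteMeasure_of_le _ hC

theorem memLp_cell {F : Type*} [NormedAddCommGroup F] (hχ : IsPartition Γ χ) {u : E3 → F}
    (hu : MemL2Loc u) : MemLp u 2 (cell χ) := by
  obtain ⟨C, hC⟩ := hχ.cell_le
  exact ((hu _ hχ.test.2.1.isCompact hχ.test.2.2).smul_measure
    (c := (C : ℝ≥0∞)) ENNReal.coe_ne_top).mono_measure hC

theorem cell_absolutelyContinuous (χ : E3 → ℝ) : cell χ ≪ hvol :=
  withDensity_absolutelyContinuous _ _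

/-- A property of almost every point of the cell that is invariant under `Γ` holds almost
everywhere. -/
theorem ae_hvol (hχ : IsPartition Γ χ) (hΓ : IsDiscreteGroup Γ) {P : E3 → Prop}
    (hP : ∀ γ : Γ, ∀ᵐ x ∂hvol, P (act (γ : Hyp3 ≃ᵢ Hyp3) x) → P x)
    (h : ∀ᵐ x ∂cell χ, P x) : ∀ᵐ x ∂hvol, P x := by
  have := hΓ.countable
  rw [cell, ae_withDensity_iff hχ.measurable] at h
  have h1 : ∀ᵐ x ∂hvol, ∀ γ : Γ, ENNReal.ofReal (χ (act (γ : Hyp3 ≃ᵢ Hyp3) x)) ≠ 0 →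
      P (act (γ : Hyp3 ≃ᵢ Hyp3) x) :=
    ae_all_iff.2 fun γ => (measurePreserving_act (γ : Hyp3 ≃ᵢ Hyp3)).quasiMeasurePreserving.ae h
  filter_upwards [ae_mem_hvol, ae_all_iff.2 hP, h1] with x hx h2 h3
  have h4 := hχ.tsum_eq_one hΓ hx
  by_contra hn
  -- If the property failed at x, every translate of χ would vanish there, although they sum to one.
  have h5 : ∀ γ : Γ, ENNReal.ofReal (χ (act (γ : Hyp3 ≃ᵢ Hyp3) x)) = 0 := fun γ => by
    by_contra h
    exact hn (h2 γ (h3 γ h))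
  simp [h5] at h4

/-- Over a compact set the integral of an invariant function is controlled by the integral over
the cell. -/
theorem exists_setLIntegral_le (hχ : IsPartition Γ χ) (hΓ : IsDiscreteGroup Γ) {K : Set E3}
    (hK : IsCompact K) (hKH : K ⊆ upperHalfSpace) :
    ∃ C : NNReal, ∀ F : E3 → ℝ≥0∞, AEMeasurable F hvol →
      (∀ γ : Γ, ∀ᵐ x ∂hvol, F (act (γ : Hyp3 ≃ᵢ Hyp3) x) = F x) →
      ∫⁻ x in K, F x ≤ C * ∫⁻ x, F x ∂cell χ := by
  obtain ⟨C, hC⟩ := volume_restrict_le hK hKH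
  obtain ⟨r, hr⟩ := hχ.test.exists_radius
  obtain ⟨s, hs⟩ := exists_radius_of_isCompact hK hKH
  set I := hΓ.near (r + s)
  refine ⟨C * I.card, fun F hF hinv => ?_⟩
  have hm : ∀ γ : Γ, AEMeasurable
      (fun x => ENNReal.ofReal (χ (act (γ : Hyp3 ≃ᵢ Hyp3) x)) * F x) hvol := fun γ =>
    (hχ.measurable.comp (measurable_act _)).aemeasurable.mul hF
  calc ∫⁻ x in K, F x ≤ C * ∫⁻ x in K, F x ∂hvol := by
        refine (lintegral_mono' hC le_rfl).trans ?_
        rw [lintegral_smul_measure]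
        rfl
    _ = C * ∫⁻ x in K, ∑ γ ∈ I, ENNReal.ofReal (χ (act (γ : Hyp3 ≃ᵢ Hyp3) x)) * F x ∂hvol := by
        congr 1
        refine setLIntegral_congr_fun hK.measurableSet fun x hx => ?_
        rw [← Finset.sum_mul, ← ENNReal.ofReal_sum_of_nonneg fun γ _ => hχ.nonneg _,
          hχ.sum_eq_one hr (hΓ.subset_near _) (hKH hx) (hs ⟨x, hKH hx⟩ hx), ENNReal.ofReal_one,
          one_mul]
    _ ≤ C * ∫⁻ x, ∑ γ ∈ I, ENNReal.ofReal (χ (act (γ : Hyp3 ≃ᵢ Hyp3) x)) * F x ∂hvol := by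
        exact mul_le_mul_right (setLIntegral_le_lintegral _ _) _
    _ = C * ∑ γ ∈ I, ∫⁻ x, F x ∂cell χ := by
        rw [lintegral_finsetSum' _ fun γ _ => hm γ]
        congr 1
        refine Finset.sum_congr rfl fun γ _ => ?_
        rw [hχ.lintegral_cell, ← (measurePreserving_act (γ : Hyp3 ≃ᵢ Hyp3)).lintegral_comp_emb
          (measurableEmbedding_act _) fun x => ENNReal.ofReal (χ x) * F x]
        refine lintegral_congr_ae ?_
        filter_upwards [hinv γ] with x hx
        rw [hx]
    _ = _ := by
        rw [Finset.sum_const, nsmul_eq_mul]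
        push_cast
        ring

end IsPartition

namespace HasWeakGradient

variable {u v : E3 → ℝ} {G G' : E3 → E3}

theorem add (h : HasWeakGradient u G) (h' : HasWeakGradient v G') :
    HasWeakGradient (fun x => u x + v x) (fun x => G x + G' x) := by
  refine ⟨h.1.add h'.1, h.2.1.add h'.2.1, fun φ hφ w => ?_⟩
  simp only [add_mul, inner_add_left]
  have i1 : ∀ {u : E3 → ℝ} {G : E3 → E3}, HasWeakGradient u G →
      IntegrableOn (fun x => u x * fderiv ℝ φ x w) upperHalfSpace := fun h => by
    simpa [mul_comm] using (h.1.integrable_fderiv_smul_test hφ w).integrableOn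
  have i2 : ∀ {u : E3 → ℝ} {G : E3 → E3}, HasWeakGradient u G →
      IntegrableOn (fun x => inner ℝ (G x) w * φ x) upperHalfSpace := fun h => by
    simpa [mul_comm] using ((h.2.1.inner_const w).integrable_smul_test hφ).integrableOn
  rw [integral_add (i1 h) (i1 h'), integral_add (i2 h) (i2 h'), h.2.2 φ hφ w, h'.2.2 φ hφ w]
  ring

theorem const_smul (h : HasWeakGradient u G) (c : ℝ) :
    HasWeakGradient (fun x => c * u x) (fun x => c • G x) := by
  refine ⟨h.1.const_smul c, h.2.1.const_smul c, fun φ hφ w => ?_⟩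
  simp only [real_inner_smul_left, mul_assoc]
  rw [integral_const_mul, integral_const_mul, h.2.2 φ hφ w]
  ring

theorem const (c : ℝ) : HasWeakGradient (fun _ => c) fun _ => 0 := by
  have := (contDiffOn_const (c := c) (s := upperHalfSpace) (𝕜 := ℝ) (n := 1)).hasWeakGradient
  simpa [gradient] using this

end HasWeakGradient

end

/-! ### Rellich's theorem by a grid of small cubes. -/

noncomputable section

open Filter Topology
open scoped ENNReal

open Hyp3

/-- A cube of the grid of mesh `1 / N`. -/
def gridCube (N : ℕ) (ν : Fin 3 → ℤ) : Set E3 := {x | ∀ i, ⌊N * x i⌋ = ν i}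

section gridCube

variable {N : ℕ} {ν : Fin 3 → ℤ}

theorem mem_gridCube (hN : 0 < N) {x : E3} :
    x ∈ gridCube N ν ↔ ∀ i, x i ∈ Ico ((ν i : ℝ) / N) ((ν i + 1) / N) := by
  have hN' : (0 : ℝ) < N := by exact_mod_cast hN
  refine forall_congr' fun i => ?_
  rw [Int.floor_eq_iff, mem_Ico, div_le_iff₀' hN', lt_div_iff₀' hN']

theorem gridCube_eq (hN : 0 < N) : gridCube N ν =
    WithLp.ofLp ⁻¹' (univ.pi fun i => Ico ((ν i : ℝ) / N) ((ν i + 1) / N)) := by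
  ext x
  rw [mem_gridCube hN]
  simp

theorem convex_gridCube (hN : 0 < N) : Convex ℝ (gridCube N ν) := by
  have : gridCube N ν = ⋂ i, (EuclideanSpace.proj i : E3 →L[ℝ] ℝ) ⁻¹'
      Ico ((ν i : ℝ) / N) ((ν i + 1) / N) := by
    ext x
    rw [mem_gridCube hN]
    simp
  rw [this]
  exact convex_iInter fun i => (convex_Ico _ _).linear_preimage
    (EuclideanSpace.proj i : E3 →L[ℝ] ℝ).toLinearMap

theorem measurableSet_gridCube : MeasurableSet (gridCube N ν) := by
  have : gridCube N ν = ⋂ i, (fun x : E3 => ⌊N * x i⌋) ⁻¹' {ν i} := by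
    ext x
    simp [gridCube]
  rw [this]
  refine MeasurableSet.iInter fun i => ?_
  exact (Int.measurable_floor.comp (by fun_prop : Measurable fun x : E3 => N * x i))
    (measurableSet_singleton _)

theorem volume_gridCube (hN : 0 < N) : volume.real (gridCube N ν) = (1 / N : ℝ) ^ 3 := by
  rw [gridCube_eq hN, Measure.real, (PiLp.volume_preserving_ofLp (Fin 3)).measure_preimage
    (MeasurableSet.univ_pi fun i => measurableSet_Ico).nullMeasurableSet, Real.volume_pi_Ico]
  have h : ∀ i, ((ν i : ℝ) + 1) / N - ν i / N = 1 / N := fun i => by ring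
  simp only [h, Finset.prod_const, Finset.card_univ, Fintype.card_fin, ENNReal.toReal_pow]
  rw [ENNReal.toReal_ofReal (by positivity)]

theorem dist_le_of_mem_gridCube (hN : 0 < N) {x y : E3} (hx : x ∈ gridCube N ν)
    (hy : y ∈ gridCube N ν) : dist x y ≤ 2 / N := by
  have hN' : (0 : ℝ) < N := by exact_mod_cast hN
  rw [mem_gridCube hN] at hx hy
  have h : ∀ i, (x i - y i) ^ 2 ≤ (1 / N) ^ 2 := fun i => by
    have h1 := hx i
    have h2 := hy i
    rw [mem_Ico, add_div] at h1 h2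
    rw [← sq_abs]
    refine pow_le_pow_left₀ (abs_nonneg _) (abs_le.2 ⟨?_, ?_⟩) 2 <;> linarith
  rw [← sq_le_sq₀ dist_nonneg (by positivity), EuclideanSpace.real_dist_sq_eq', Fin.sum_univ_three]
  have := h 0
  have := h 1
  have := h 2
  have h4 : (2 / (N : ℝ)) ^ 2 = 4 * (1 / N) ^ 2 := by ring
  have : 0 ≤ (1 / (N : ℝ)) ^ 2 := by positivity
  linarith

end gridCube

/-- A compact set is covered by finitely many disjoint small cubes. -/
theorem exists_gridCube_cover {K : Set E3} (hK : IsCompact K) (hKH : K ⊆ upperHalfSpace) :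
    ∃ K' : Set E3, IsCompact K' ∧ K' ⊆ upperHalfSpace ∧ ∀ ε > 0,
      ∃ (N : ℕ) (I : Finset (Fin 3 → ℤ)), 0 < N ∧ K ⊆ ⋃ ν ∈ I, gridCube N ν ∧
        (∀ ν ∈ I, gridCube N ν ⊆ K') ∧
      volume.real (Metric.closedBall (0 : E3) (2 / N)) * (2 / N) ^ 2 ≤ ε * (1 / N : ℝ) ^ 3 := by
  obtain ⟨δ, hδ, hδK⟩ := hK.exists_cthickening_subset_open isOpen_upperHalfSpace hKH
  refine ⟨Metric.cthickening δ K, hK.cthickening, hδK, fun ε hε => ?_⟩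
  set W := volume.real (Metric.ball (0 : E3) 1)
  -- The first bound keeps cubes that meet K inside its δ-thickening. The constant 32 is 2³ · 2²,
  -- from the volume of the ball of radius 2 / N and the squared diameter bound. The last bound
  -- serves to replace N by N².
  obtain ⟨N, hN⟩ := exists_nat_gt (max (2 / δ) (max (32 * W / ε) 1))
  simp only [max_lt_iff] at hN
  obtain ⟨hN1, hN2, hN3⟩ := hN
  have hN' : (0 : ℝ) < N := by linarith
  have hN0 : 0 < N := by exact_mod_cast hN'
  have hfin : ((fun (x : E3) (i : Fin 3) => ⌊N * x i⌋) '' K).Finite := by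
    obtain ⟨R, hR⟩ := hK.isBounded.exists_norm_le
    refine (Set.finite_Icc (fun _ => ⌊-(N * R)⌋) (fun _ => ⌊N * R⌋)).subset ?_
    rintro _ ⟨x, hx, rfl⟩
    have h1 : ∀ i, |N * x i| ≤ N * R := fun i => by
      rw [abs_mul, abs_of_pos hN']
      gcongr
      exact (PiLp.norm_apply_le x i).trans (hR x hx)
    exact ⟨fun i => Int.floor_mono (abs_le.1 (h1 i)).1, fun i => Int.floor_mono (abs_le.1 (h1 i)).2⟩
  refine ⟨N, hfin.toFinset, hN0, fun x hx => ?_,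
    fun ν hν x hx => ?_, ?_⟩
  · simp only [mem_iUnion, Set.Finite.mem_toFinset, exists_prop]
    exact ⟨_, mem_image_of_mem _ hx, fun i => rfl⟩
  · obtain ⟨y, hy, rfl⟩ := hfin.mem_toFinset.1 hν
    refine Metric.mem_cthickening_of_dist_le x y δ K hy ?_
    refine (dist_le_of_mem_gridCube hN0 hx fun i => rfl).trans ?_
    rw [div_lt_iff₀ hδ] at hN1
    rw [div_le_iff₀ hN']
    linarith
  · have h1 : volume.real (Metric.closedBall (0 : E3) (2 / N)) = (2 / N) ^ 3 * W := by
      rw [Measure.real, Measure.addHaar_closedBall _ _ (by positivity), ENNReal.toReal_mul,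
        ENNReal.toReal_ofReal (by positivity)]
      simp [W, Measure.real]
    rw [h1]
    rw [div_lt_iff₀ hε] at hN2
    have h2 : 32 * W ≤ ε * (N : ℝ) ^ 2 := by
      have h5 := mul_le_mul_of_nonneg_left hN3.le (mul_pos hN' hε).le
      linarith
    have h3 : (2 / (N : ℝ)) ^ 3 * W * (2 / N) ^ 2 = 32 * W * (1 / N) ^ 5 := by ring
    have h4 : ε * (1 / (N : ℝ)) ^ 3 = ε * N ^ 2 * (1 / N) ^ 5 := by field_simp
    rw [h3, h4]
    gcongr

/-- Rellich's theorem: the `L²` norm on a compact set is controlled by finitely many mean values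
and a small multiple of the energy. -/
theorem exists_forall_integral_sq_le {K : Set E3} (hK : IsCompact K) (hKH : K ⊆ upperHalfSpace) :
    ∃ K' : Set E3, IsCompact K' ∧ K' ⊆ upperHalfSpace ∧ ∀ ε > 0,
      ∃ (m : ℕ) (Q : Fin m → Set E3) (c : ℝ), (∀ i, Q i ⊆ K') ∧ 0 ≤ c ∧
      ∀ (u : E3 → ℝ) (G : E3 → E3), HasWeakGradient u G →
        ∫ x in K, u x ^ 2 ≤ ε * (∫ x in K', ‖G x‖ ^ 2) + ∑ i, c * (∫ x in Q i, u x) ^ 2 := by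
  obtain ⟨K', hK', hKH', hcover⟩ := exists_gridCube_cover hK hKH
  refine ⟨K', hK', hKH', fun ε hε => ?_⟩
  obtain ⟨N, I, hN, hKI, hIK, hvol⟩ := hcover ε hε
  have hN' : (0 : ℝ) < N := by exact_mod_cast hN
  refine ⟨I.card, fun i => gridCube N (I.equivFin.symm i : Fin 3 → ℤ), N ^ 3,
    fun i => hIK _ (I.equivFin.symm i).2, by positivity, fun u G h => ?_⟩
  have hsum : ∑ i, (N : ℝ) ^ 3 * (∫ x in gridCube N (I.equivFin.symm i : Fin 3 → ℤ), u x) ^ 2 =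
      ∑ ν ∈ I, (N : ℝ) ^ 3 * (∫ x in gridCube N ν, u x) ^ 2 := by
    rw [← Finset.sum_coe_sort I]
    exact Equiv.sum_comp I.equivFin.symm
      fun ν : I => (N : ℝ) ^ 3 * (∫ x in gridCube N (ν : Fin 3 → ℤ), u x) ^ 2
  rw [hsum]
  have hu2 : IntegrableOn (fun x => u x ^ 2) K' := (h.1 K' hK' hKH').integrable_sq
  have hG2 : IntegrableOn (fun x => ‖G x‖ ^ 2) K' :=
    (h.2.1 K' hK' hKH').integrable_norm_pow two_ne_zero
  have hdisj : (I : Set (Fin 3 → ℤ)).PairwiseDisjoint (gridCube N) := by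
    intro ν _ ν' _ hne
    refine Set.disjoint_left.2 fun x hx hx' => hne (funext fun i => ?_)
    rw [← hx i, hx' i]
  have hsub : ⋃ ν ∈ I, gridCube N ν ⊆ K' := iUnion₂_subset hIK
  -- The Poincaré inequality on one cube, divided by the volume of the cube.
  have key : ∀ ν ∈ I, ∫ x in gridCube N ν, u x ^ 2 ≤
      ε * (∫ x in gridCube N ν, ‖G x‖ ^ 2) + (N : ℝ) ^ 3 * (∫ x in gridCube N ν, u x) ^ 2 := by
    intro ν hν
    have h1 := h.poincare hK' hKH' (hIK ν hν) measurableSet_gridCube (convex_gridCube hN)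
      (show (0 : ℝ) ≤ 2 / N by positivity) fun x hx y hy => dist_le_of_mem_gridCube hN hx hy
    rw [volume_gridCube hN] at h1
    have h2 : 0 ≤ ∫ x in gridCube N ν, ‖G x‖ ^ 2 := integral_nonneg fun x => by positivity
    have h3 := mul_le_mul_of_nonneg_right hvol h2
    have h4 : (N : ℝ) ^ 3 * (1 / N) ^ 3 = 1 := by field_simp
    have h5 : 0 < (N : ℝ) ^ 3 := by positivity
    have h6 := mul_le_mul_of_nonneg_left (h1.trans h3) h5.le
    have h7 : (N : ℝ) ^ 3 * (ε * (1 / N) ^ 3 * ∫ x in gridCube N ν, ‖G x‖ ^ 2) =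
        ε * ∫ x in gridCube N ν, ‖G x‖ ^ 2 := by
      linear_combination (ε * ∫ x in gridCube N ν, ‖G x‖ ^ 2) * h4
    have h8 : (N : ℝ) ^ 3 * (2 * ((1 / N) ^ 3 * (∫ x in gridCube N ν, u x ^ 2) -
        (∫ x in gridCube N ν, u x) ^ 2)) = 2 * (∫ x in gridCube N ν, u x ^ 2) -
        2 * (N ^ 3 * (∫ x in gridCube N ν, u x) ^ 2) := by
      linear_combination (2 * ∫ x in gridCube N ν, u x ^ 2) * h4
    rw [h7, h8] at h6
    have h9 := mul_nonneg hε.le h2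
    linarith
  calc ∫ x in K, u x ^ 2 ≤ ∫ x in ⋃ ν ∈ I, gridCube N ν, u x ^ 2 :=
        setIntegral_mono_set (hu2.mono_set hsub) (Eventually.of_forall fun x => sq_nonneg _)
          hKI.eventuallyLE
    _ = ∑ ν ∈ I, ∫ x in gridCube N ν, u x ^ 2 :=
        integral_biUnion_finset I (fun ν _ => measurableSet_gridCube) hdisj
          fun ν hν => hu2.mono_set (hIK ν hν)
    _ ≤ ∑ ν ∈ I, (ε * (∫ x in gridCube N ν, ‖G x‖ ^ 2) +
        (N : ℝ) ^ 3 * (∫ x in gridCube N ν, u x) ^ 2) := Finset.sum_le_sum key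
    _ = ε * (∫ x in ⋃ ν ∈ I, gridCube N ν, ‖G x‖ ^ 2) +
        ∑ ν ∈ I, (N : ℝ) ^ 3 * (∫ x in gridCube N ν, u x) ^ 2 := by
        rw [Finset.sum_add_distrib, ← Finset.mul_sum,
          integral_biUnion_finset I (fun ν _ => measurableSet_gridCube) hdisj
          fun ν hν => hG2.mono_set (hIK ν hν)]
    _ ≤ _ := by
        exact add_le_add_left (mul_le_mul_of_nonneg_left (setIntegral_mono_set hG2
          (Eventually.of_forall fun x => by positivity) hsub.eventuallyLE) hε.le) _

end

/-! ### Completeness: limits of equivariant fields and of weak gradients. -/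

noncomputable section

open Filter Topology
open scoped ENNReal

open Hyp3

variable {Γ : Subgroup (Hyp3 ≃ᵢ Hyp3)}

theorem hvol_absolutelyContinuous : hvol ≪ (volume.restrict upperHalfSpace : Measure E3) :=
  withDensity_absolutelyContinuous _ _

theorem volume_restrict_absolutelyContinuous {K : Set E3} (hKH : K ⊆ upperHalfSpace)
    (hK : MeasurableSet K) : (volume.restrict K : Measure E3) ≪ hvol :=
  Measure.ae_le_iff_absolutelyContinuous.1 fun s hs => by
    change ∀ᵐ x ∂(volume.restrict K), x ∈ s
    rw [ae_restrict_iff' hK]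
    filter_upwards [ae_hvol_iff.1 hs] with x hx hxK
    exact hx (hKH hxK)

theorem MemL2Loc.aestronglyMeasurable {F : Type*} [NormedAddCommGroup F] {u : E3 → F}
    (hu : MemL2Loc u) : AEStronglyMeasurable u hvol :=
  hu.locallyIntegrableOn.aestronglyMeasurable.mono_ac hvol_absolutelyContinuous

/-- Completeness of the invariant sections, locally square integrable, for the `L²` norm of the
cell. -/
theorem IsPartition.exists_subseq_tendsto {F : Type*} [NormedAddCommGroup F] [CompleteSpace F]
    {χ : E3 → ℝ} (hχ : IsPartition Γ χ) (hΓ : IsDiscreteGroup Γ) {g : ℕ → E3 → F}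
    (hg : ∀ n, MemL2Loc (g n)) {L : Γ → E3 → F → F}
    (hL : ∀ γ, ∀ x ∈ upperHalfSpace, Isometry (L γ x))
    (hinv : ∀ γ n, ∀ᵐ x ∂hvol, g n x = L γ x (g n (act (γ : Hyp3 ≃ᵢ Hyp3) x)))
    (hc : ∀ ε > 0, ∃ N, ∀ m ≥ N, ∀ n ≥ N, ∫ x, ‖g m x - g n x‖ ^ 2 ∂cell χ ≤ ε) :
    ∃ φ : ℕ → ℕ, StrictMono φ ∧
      (∀ᵐ x ∂hvol, ∃ l, Tendsto (fun k => g (φ k) x) atTop (𝓝 l)) ∧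
      ∀ g₀ : E3 → F, (∀ᵐ x ∂hvol, Tendsto (fun k => g (φ k) x) atTop (𝓝 (g₀ x))) →
        MemL2Loc g₀ ∧ Tendsto (fun n => ∫ x, ‖g n x - g₀ x‖ ^ 2 ∂cell χ) atTop (𝓝 0) ∧
        ∀ K : Set E3, IsCompact K → K ⊆ upperHalfSpace →
          Tendsto (fun n => eLpNorm (fun x => g n x - g₀ x) 2 (volume.restrict K)) atTop (𝓝 0) := by
  obtain ⟨h, -, hlim, φ, hφ, hae⟩ := exists_tendsto_of_cauchy_integral
    (fun n => hχ.memLp_cell (hg n)) hc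
  have hinv' : ∀ γ : Γ, ∀ᵐ x ∂hvol, ∀ n, g n x = L γ x (g n (act (γ : Hyp3 ≃ᵢ Hyp3) x)) :=
    fun γ => ae_all_iff.2 fun n => hinv γ n
  refine ⟨φ, hφ, ?_, fun g₀ hg₀ => ?_⟩
  -- Existence of the limit at a point passes to the other points of its orbit through the
  -- isometries `L γ x`, hence spreads from the cell to the whole space.
  · refine hχ.ae_hvol hΓ (fun γ => ?_) (hae.mono fun x hx => ⟨_, hx⟩)
    filter_upwards [hinv' γ, ae_mem_hvol] with x hx hxH
    rintro ⟨l, hl⟩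
    refine ⟨L γ x l, ?_⟩
    simp_rw [hx]
    exact ((hL γ x hxH).continuous.tendsto l).comp hl
  have hm₀ : AEStronglyMeasurable g₀ hvol :=
    aestronglyMeasurable_of_tendsto_ae atTop (fun k => (hg (φ k)).aestronglyMeasurable) hg₀
  have hgh : ∀ᵐ x ∂cell χ, g₀ x = h x := by
    filter_upwards [hae, (IsPartition.cell_absolutelyContinuous χ).ae_le hg₀] with x h1 h2
    exact tendsto_nhds_unique h2 h1
  have hinv₀ : ∀ γ : Γ, ∀ᵐ x ∂hvol, g₀ x = L γ x (g₀ (act (γ : Hyp3 ≃ᵢ Hyp3) x)) := by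
    intro γ
    filter_upwards [hinv' γ, ae_mem_hvol, hg₀, (measurePreserving_act
      (γ : Hyp3 ≃ᵢ Hyp3)).quasiMeasurePreserving.ae hg₀] with x hx hxH h1 h2
    refine tendsto_nhds_unique h1 ?_
    simp_rw [hx]
    exact ((hL γ x hxH).continuous.tendsto _).comp h2
  have hlim₀ : Tendsto (fun n => ∫⁻ x, ‖g n x - g₀ x‖ₑ ^ 2 ∂cell χ) atTop (𝓝 0) := by
    refine hlim.congr fun n => lintegral_congr_ae ?_
    filter_upwards [hgh] with x hx
    rw [hx]
  have hmd : ∀ n, AEStronglyMeasurable (fun x => g n x - g₀ x) hvol := fun n =>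
    (hg n).aestronglyMeasurable.sub hm₀
  have hK : ∀ K : Set E3, IsCompact K → K ⊆ upperHalfSpace →
      Tendsto (fun n => eLpNorm (fun x => g n x - g₀ x) 2 (volume.restrict K)) atTop (𝓝 0) := by
    intro K hK hKH
    obtain ⟨C, hC⟩ := hχ.exists_setLIntegral_le hΓ hK hKH
    have h1 : Tendsto (fun n => (C : ℝ≥0∞) * ∫⁻ x, ‖g n x - g₀ x‖ₑ ^ 2 ∂cell χ) atTop (𝓝 0) := by
      have := ENNReal.Tendsto.const_mul (a := (C : ℝ≥0∞)) hlim₀ (Or.inr ENNReal.coe_ne_top)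
      rwa [mul_zero] at this
    have h2 : Tendsto (fun n => eLpNorm (fun x => g n x - g₀ x) 2 (volume.restrict K) ^ 2)
        atTop (𝓝 0) := by
      refine tendsto_of_tendsto_of_tendsto_of_le_of_le tendsto_const_nhds h1
        (fun _ => zero_le) fun n => ?_
      simp only [sq_eLpNorm_two]
      refine hC _ ((hmd n).enorm.pow_const 2) fun γ => ?_
      filter_upwards [hinv γ n, hinv₀ γ, ae_mem_hvol] with x h1 h2 hxH
      have h3 := (hL γ x hxH) (g n (act (γ : Hyp3 ≃ᵢ Hyp3) x)) (g₀ (act (γ : Hyp3 ≃ᵢ Hyp3) x))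
      rw [← h1, ← h2, edist_eq_enorm_sub, edist_eq_enorm_sub] at h3
      rw [h3]
    have h3 := h2.ennrpow_const (1 / 2)
    simp only [ENNReal.zero_rpow_of_pos (show (0 : ℝ) < 1 / 2 by norm_num)] at h3
    refine h3.congr fun n => ?_
    rw [← ENNReal.rpow_natCast, ← ENNReal.rpow_mul]
    norm_num
  have hmem : MemL2Loc g₀ := by
    intro K hKc hKH
    obtain ⟨n, hn⟩ := ((hK K hKc hKH).eventually_lt_const (ENNReal.zero_lt_top)).exists
    have h1 : MemLp (fun x => g n x - g₀ x) 2 (volume.restrict K) :=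
      ⟨(hmd n).mono_ac (volume_restrict_absolutelyContinuous hKH hKc.measurableSet), hn⟩
    have h2 := (hg n K hKc hKH).sub h1
    refine h2.ae_eq (Eventually.of_forall fun x => ?_)
    simp
  refine ⟨hmem, ?_, hK⟩
  have h1 := (ENNReal.tendsto_toReal ENNReal.zero_ne_top).comp hlim₀
  rw [ENNReal.toReal_zero] at h1
  refine h1.congr fun n => ?_
  have h2 := ((hχ.memLp_cell (hg n)).sub (hχ.memLp_cell hmem)).sq_eLpNorm_two_eq
  rw [sq_eLpNorm_two] at h2
  simp only [Pi.sub_apply] at h2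
  rw [Function.comp_apply, h2, ENNReal.toReal_ofReal (integral_nonneg fun x => by positivity)]

theorem MemL2Loc.continuous_smul {F : Type*} [NormedAddCommGroup F] [NormedSpace ℝ F] {u : E3 → F}
    (hu : MemL2Loc u) {g : E3 → ℝ} (hg : ContinuousOn g upperHalfSpace) :
    MemL2Loc fun x => g x • u x := by
  intro K hK hKH
  obtain ⟨C, hC⟩ := hK.exists_bound_of_continuousOn (hg.mono hKH)
  refine (hu K hK hKH).of_le_mul (c := C)
    (((hg.mono hKH).aestronglyMeasurable hK.measurableSet).smul (hu K hK hKH).1) ?_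
  filter_upwards [ae_restrict_mem hK.measurableSet] with x hx
  rw [norm_smul]
  gcongr
  exact hC x hx

theorem tendsto_eLpNorm_smul {F : Type*} [NormedAddCommGroup F] [NormedSpace ℝ F] {u : ℕ → E3 → F}
    {K : Set E3} (hK : IsCompact K) {g : E3 → ℝ} (hg : ContinuousOn g K)
    (hu : Tendsto (fun n => eLpNorm (u n) 2 (volume.restrict K)) atTop (𝓝 0)) :
    Tendsto (fun n => eLpNorm (fun x => g x • u n x) 2 (volume.restrict K)) atTop (𝓝 0) := by
  obtain ⟨C, hC⟩ := hK.exists_bound_of_continuousOn hg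
  have h1 := ENNReal.Tendsto.const_mul (a := ENNReal.ofReal C) hu (Or.inr ENNReal.ofReal_ne_top)
  rw [mul_zero] at h1
  refine tendsto_of_tendsto_of_tendsto_of_le_of_le tendsto_const_nhds h1 (fun _ => zero_le)
    fun n => ?_
  refine eLpNorm_le_mul_eLpNorm_of_ae_le_mul ?_ 2
  filter_upwards [ae_restrict_mem hK.measurableSet] with x hx
  rw [norm_smul]
  gcongr
  exact hC x hx

/-- Both sides of the weak identity are L² pairings over the compact support of φ, so they pass to
the limit. -/
theorem HasWeakGradient.of_tendsto {u : ℕ → E3 → ℝ} {G : ℕ → E3 → E3} {u₀ : E3 → ℝ} {G₀ : E3 → E3}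
    (h : ∀ n, HasWeakGradient (u n) (G n)) (hu₀ : MemL2Loc u₀) (hG₀ : MemL2Loc G₀)
    (hu : ∀ K : Set E3, IsCompact K → K ⊆ upperHalfSpace →
      Tendsto (fun n => eLpNorm (fun x => u n x - u₀ x) 2 (volume.restrict K)) atTop (𝓝 0))
    (hG : ∀ K : Set E3, IsCompact K → K ⊆ upperHalfSpace →
      Tendsto (fun n => eLpNorm (fun x => G n x - G₀ x) 2 (volume.restrict K)) atTop (𝓝 0)) :
    HasWeakGradient u₀ G₀ := by
  refine ⟨hu₀, hG₀, fun φ hφ v => ?_⟩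
  have hK := hφ.2.1.isCompact
  have hKH := hφ.2.2
  have e : ∀ F : E3 → ℝ, (∀ x ∉ tsupport φ, F x = 0) →
      ∫ x in upperHalfSpace, F x = ∫ x in tsupport φ, F x := fun F hF => by
    rw [setIntegral_eq_integral_of_forall_compl_eq_zero fun x hx => hF x fun h => hx (hKH h),
      setIntegral_eq_integral_of_forall_compl_eq_zero hF]
  have e1 : ∀ (u : E3 → ℝ), ∀ x ∉ tsupport φ, u x * fderiv ℝ φ x v = 0 := fun u x hx => by
    rw [image_eq_zero_of_notMem_tsupport fun h => hx (tsupport_fderiv_subset ℝ h)]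
    simp
  have e2 : ∀ (G : E3 → E3), ∀ x ∉ tsupport φ, inner ℝ (G x) v * φ x = 0 := fun G x hx => by
    rw [image_eq_zero_of_notMem_tsupport hx, mul_zero]
  have h1 := tendsto_integral_mul (μ := volume.restrict (tsupport φ)) (fun n => (h n).1 _ hK hKH)
    (fun _ => ((hφ.continuous_fderiv_apply v).continuousOn.memL2Loc _ hK hKH)) (hu₀ _ hK hKH)
    ((hφ.continuous_fderiv_apply v).continuousOn.memL2Loc _ hK hKH) (hu _ hK hKH)
    (by simp)
  have hφv : MemL2Loc fun x => φ x • v :=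
    (hφ.continuous.smul continuous_const).continuousOn.memL2Loc
  have h2 := tendsto_integral_inner (μ := volume.restrict (tsupport φ))
    (fun n => (h n).2.1 _ hK hKH)
    (fun _ => hφv _ hK hKH) (hG₀ _ hK hKH) (hφv _ hK hKH) (hG _ hK hKH)
    (by simp)
  rw [e _ (e1 u₀), e _ (e2 G₀)]
  refine tendsto_nhds_unique h1 ?_
  have h3 := h2.neg
  simp only [real_inner_smul_right, mul_comm (φ _)] at h3
  refine h3.congr fun n => ?_
  have := (h n).2.2 φ hφ v
  rw [e _ (e1 (u n)), e _ (e2 (G n))] at this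
  exact this.symm

end

/-! ### The energy space of the orbifold, its mass form and its Dirichlet form. -/

noncomputable section

open Filter Topology
open scoped ENNReal

open Hyp3

variable {Γ : Subgroup (Hyp3 ≃ᵢ Hyp3)}

theorem integrable_inner_of_memLp {α F : Type*} [MeasurableSpace α] [NormedAddCommGroup F]
    [InnerProductSpace ℝ F] {μ : Measure α} {f g : α → F} (hf : MemLp f 2 μ) (hg : MemLp g 2 μ) :
    Integrable (fun x => inner ℝ (f x) (g x)) μ := by
  refine (L2.integrable_inner (𝕜 := ℝ) hf.toLp hg.toLp).congr ?_
  filter_upwards [hf.coeFn_toLp, hg.coeFn_toLp] with x h1 h2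
  rw [h1, h2]

/-- Cauchy–Schwarz against a constant. The summand 1 allows division even when the measure is zero.
-/
theorem sq_integral_le {α : Type*} [MeasurableSpace α] {μ : Measure α} [IsFiniteMeasure μ]
    {f : α → ℝ} (hf : MemLp f 2 μ) :
    (∫ x, f x ∂μ) ^ 2 ≤ (μ.real univ + 1) * ∫ x, f x ^ 2 ∂μ := by
  have hm : 0 < μ.real univ + 1 := by positivity
  set S := ∫ x, f x ∂μ
  have h1 := integral_sub_const_sq hf (S / (μ.real univ + 1))
  have h2 : 0 ≤ ∫ x, (f x - S / (μ.real univ + 1)) ^ 2 ∂μ := integral_nonneg fun x => sq_nonneg _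
  rw [h1] at h2
  have h3 : 2 * (S / (μ.real univ + 1)) * S - μ.real univ * (S / (μ.real univ + 1)) ^ 2 =
      S ^ 2 / (μ.real univ + 1) + (S / (μ.real univ + 1)) ^ 2 := by
    field_simp
    ring
  have h4 : S ^ 2 / (μ.real univ + 1) ≤ ∫ x, f x ^ 2 ∂μ := by
    linarith [sq_nonneg (S / (μ.real univ + 1))]
  rw [div_le_iff₀ hm] at h4
  linarith

namespace Orbifold

theorem lift_of_mem (f : Orbifold Γ → ℝ) {x : E3} (hx : x ∈ upperHalfSpace) :
    lift f x = f (proj Γ ⟨x, hx⟩) := inCoords_of_mem _ hx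

theorem lift_of_notMem (f : Orbifold Γ → ℝ) {x : E3} (hx : x ∉ upperHalfSpace) :
    lift f x = 0 := by
  have : ¬ 0 < x 2 := hx
  simp [lift, inCoords, this]

theorem lift_act (f : Orbifold Γ → ℝ) (γ : Γ) {x : E3} (hx : x ∈ upperHalfSpace) :
    lift f (act (γ : Hyp3 ≃ᵢ Hyp3) x) = lift f x := by
  have h : (⟨_, act_mem (γ : Hyp3 ≃ᵢ Hyp3) hx⟩ : Hyp3) = (γ : Hyp3 ≃ᵢ Hyp3) ⟨x, hx⟩ :=
    Hyp3.ext (act_of_mem _ hx)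
  rw [lift_of_mem f hx, lift_of_mem f (act_mem _ hx), h, proj_apply]

theorem lift_add (f g : Orbifold Γ → ℝ) : lift (f + g) = fun x => lift f x + lift g x := by
  funext x
  by_cases hx : x ∈ upperHalfSpace
  · simp [lift_of_mem _ hx]
  · simp [lift_of_notMem _ hx]

theorem lift_smul (c : ℝ) (f : Orbifold Γ → ℝ) : lift (c • f) = fun x => c * lift f x := by
  funext x
  by_cases hx : x ∈ upperHalfSpace
  · simp [lift_of_mem _ hx]
  · simp [lift_of_notMem _ hx]

end Orbifold

open Orbifold

/-- The functions in `H¹` of the orbifold, together with the weak gradient of their lift. -/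
def energySpace (Γ : Subgroup (Hyp3 ≃ᵢ Hyp3)) :
    Submodule ℝ ((Orbifold Γ → ℝ) × (E3 → E3)) where
  carrier := {u | HasWeakGradient (lift u.1) u.2}
  add_mem' {u v} hu hv := by
    have := HasWeakGradient.add hu hv
    rw [← lift_add] at this
    exact this
  zero_mem' := by
    refine (HasWeakGradient.const 0).congr fun x hx => ?_
    rw [lift_of_mem _ hx]
    rfl
  smul_mem' c u hu := by
    have := HasWeakGradient.const_smul hu c
    rw [← lift_smul] at this
    exact this

namespace energySpace

/-- The function in coordinates. -/
def fn (u : energySpace Γ) : E3 → ℝ := lift u.1.1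

/-- The weak gradient, multiplied by the height: its norm is that of the hyperbolic gradient. -/
def grad (u : energySpace Γ) (x : E3) : E3 := x 2 • u.1.2 x

theorem hasWeakGradient (u : energySpace Γ) : HasWeakGradient (fn u) u.1.2 := u.2

theorem memL2Loc_fn (u : energySpace Γ) : MemL2Loc (fn u) := u.2.1

theorem memL2Loc_grad (u : energySpace Γ) : MemL2Loc (grad u) :=
  u.2.2.1.continuous_smul continuous_height.continuousOn

theorem fn_add (u v : energySpace Γ) (x : E3) : fn (u + v) x = fn u x + fn v x :=
  congrFun (lift_add u.1.1 v.1.1) x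

theorem fn_smul (c : ℝ) (u : energySpace Γ) (x : E3) : fn (c • u) x = c * fn u x :=
  congrFun (lift_smul c u.1.1) x

theorem grad_add (u v : energySpace Γ) (x : E3) : grad (u + v) x = grad u x + grad v x :=
  smul_add _ _ _

theorem grad_smul (c : ℝ) (u : energySpace Γ) (x : E3) : grad (c • u) x = c • grad u x :=
  smul_comm (x 2) c (u.1.2 x)

theorem fn_sub (u v : energySpace Γ) (x : E3) : fn (u - v) x = fn u x - fn v x := by
  rw [eq_sub_iff_add_eq, ← fn_add, sub_add_cancel]

theorem grad_sub (u v : energySpace Γ) (x : E3) : grad (u - v) x = grad u x - grad v x := by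
  rw [eq_sub_iff_add_eq, ← grad_add, sub_add_cancel]

theorem fn_act (u : energySpace Γ) (γ : Γ) {x : E3} (hx : x ∈ upperHalfSpace) :
    fn u (act (γ : Hyp3 ≃ᵢ Hyp3) x) = fn u x := lift_act _ γ hx

theorem gradient_act (u : energySpace Γ) (γ : Γ) :
    ∀ᵐ x ∂hvol, u.1.2 x = coact (γ : Hyp3 ≃ᵢ Hyp3) x (u.1.2 (act (γ : Hyp3 ≃ᵢ Hyp3) x)) :=
  ae_hvol_iff.2 ((hasWeakGradient u).ae_eq_pull fun _ hx => fn_act u γ hx)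

/-- The isometry of tangent spaces by which hyperbolic gradients transform. -/
def frame (γ : Γ) (x v : E3) : E3 :=
  x 2 • coact (γ : Hyp3 ≃ᵢ Hyp3) x ((act (γ : Hyp3 ≃ᵢ Hyp3) x 2)⁻¹ • v)

theorem isometry_frame (γ : Γ) {x : E3} (hx : x ∈ upperHalfSpace) : Isometry (frame γ x) := by
  have hx2 : 0 < x 2 := hx
  have hy2 : 0 < act (γ : Hyp3 ≃ᵢ Hyp3) x 2 := act_mem _ hx
  refine Isometry.of_dist_eq fun v w => ?_
  rw [dist_eq_norm, dist_eq_norm, frame, frame, ← smul_sub, ← map_sub, ← smul_sub, norm_smul,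
    norm_coact _ hx, norm_smul, scale, norm_inv, Real.norm_of_nonneg hx2.le,
    Real.norm_of_nonneg hy2.le]
  field_simp

theorem grad_act (u : energySpace Γ) (γ : Γ) :
    ∀ᵐ x ∂hvol, grad u x = frame γ x (grad u (act (γ : Hyp3 ≃ᵢ Hyp3) x)) := by
  filter_upwards [gradient_act u γ, ae_mem_hvol] with x hx hxH
  have hy2 : 0 < act (γ : Hyp3 ≃ᵢ Hyp3) x 2 := act_mem _ hxH
  rw [frame, grad, grad, smul_smul, inv_mul_cancel₀ hy2.ne', one_smul, ← hx]

end energySpace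

open energySpace

namespace IsPartition

variable {χ : E3 → ℝ}

theorem integrable_fn_mul (hχ : IsPartition Γ χ) (u v : energySpace Γ) :
    Integrable (fun x => fn u x * fn v x) (cell χ) :=
  (hχ.memLp_cell (memL2Loc_fn u)).integrable_mul (hχ.memLp_cell (memL2Loc_fn v))

theorem integrable_inner_grad (hχ : IsPartition Γ χ) (u v : energySpace Γ) :
    Integrable (fun x => inner ℝ (grad u x) (grad v x)) (cell χ) :=
  integrable_inner_of_memLp (hχ.memLp_cell (memL2Loc_grad u))
    (hχ.memLp_cell (memL2Loc_grad v))

theorem integrable_fn (hχ : IsPartition Γ χ) (u : energySpace Γ) : Integrable (fn u) (cell χ) := by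
  have := hχ.isFiniteMeasure_cell
  exact (hχ.memLp_cell (memL2Loc_fn u)).integrable one_le_two

/-- The `L²` scalar product over the orbifold. -/
def massForm (hχ : IsPartition Γ χ) : LinearMap.BilinForm ℝ (energySpace Γ) :=
  LinearMap.mk₂ ℝ (fun u v => ∫ x, fn u x * fn v x ∂cell χ)
    (fun u v w => by
      simp only [fn_add, add_mul]
      exact integral_add (hχ.integrable_fn_mul u w) (hχ.integrable_fn_mul v w))
    (fun c u v => by
      simp only [fn_smul, mul_assoc, smul_eq_mul]
      exact integral_const_mul _ _)
    (fun u v w => by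
      simp only [fn_add, mul_add]
      exact integral_add (hχ.integrable_fn_mul u v) (hχ.integrable_fn_mul u w))
    (fun c u v => by
      simp only [fn_smul, mul_left_comm, smul_eq_mul]
      exact integral_const_mul _ _)

/-- The Dirichlet form of the orbifold. -/
def energyForm (hχ : IsPartition Γ χ) : LinearMap.BilinForm ℝ (energySpace Γ) :=
  LinearMap.mk₂ ℝ (fun u v => ∫ x, inner ℝ (grad u x) (grad v x) ∂cell χ)
    (fun u v w => by
      simp only [grad_add, inner_add_left]
      exact integral_add (hχ.integrable_inner_grad u w) (hχ.integrable_inner_grad v w))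
    (fun c u v => by
      simp only [grad_smul, real_inner_smul_left, smul_eq_mul]
      exact integral_const_mul _ _)
    (fun u v w => by
      simp only [grad_add, inner_add_right]
      exact integral_add (hχ.integrable_inner_grad u v) (hχ.integrable_inner_grad u w))
    (fun c u v => by
      simp only [grad_smul, real_inner_smul_right, smul_eq_mul]
      exact integral_const_mul _ _)

/-- The integral over the orbifold. -/
def total (hχ : IsPartition Γ χ) : energySpace Γ →ₗ[ℝ] ℝ where
  toFun u := ∫ x, fn u x ∂cell χ
  map_add' u v := by
    simp only [fn_add]
    exact integral_add (hχ.integrable_fn u) (hχ.integrable_fn v)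
  map_smul' c u := by
    simp only [fn_smul]
    exact integral_const_mul _ _

theorem massForm_apply (hχ : IsPartition Γ χ) (u v : energySpace Γ) :
    hχ.massForm u v = ∫ x, fn u x * fn v x ∂cell χ := rfl

theorem energyForm_apply (hχ : IsPartition Γ χ) (u v : energySpace Γ) :
    hχ.energyForm u v = ∫ x, inner ℝ (grad u x) (grad v x) ∂cell χ := rfl

theorem total_apply (hχ : IsPartition Γ χ) (u : energySpace Γ) :
    hχ.total u = ∫ x, fn u x ∂cell χ := rfl

theorem massForm_self (hχ : IsPartition Γ χ) (u : energySpace Γ) :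
    hχ.massForm u u = ∫ x, ‖fn u x‖ ^ 2 ∂cell χ := by
  simp only [massForm_apply, ← pow_two, Real.norm_eq_abs, sq_abs]

theorem energyForm_self (hχ : IsPartition Γ χ) (u : energySpace Γ) :
    hχ.energyForm u u = ∫ x, ‖grad u x‖ ^ 2 ∂cell χ := by
  simp only [energyForm_apply, real_inner_self_eq_norm_sq]

theorem massForm_nonneg (hχ : IsPartition Γ χ) (u : energySpace Γ) : 0 ≤ hχ.massForm u u := by
  rw [massForm_self]
  exact integral_nonneg fun x => by positivity

theorem energyForm_nonneg (hχ : IsPartition Γ χ) (u : energySpace Γ) : 0 ≤ hχ.energyForm u u := by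
  rw [energyForm_self]
  exact integral_nonneg fun x => by positivity

/-- Functions and gradients converge separately by `exists_subseq_tendsto`: the functions transform
trivially under Γ, and the gradients, scaled by the height, by the isometries `frame`. -/
theorem exists_limit (hχ : IsPartition Γ χ) (hΓ : IsDiscreteGroup Γ) (u : ℕ → energySpace Γ)
    (hu : ∀ ε > 0, ∃ N, ∀ m ≥ N, ∀ n ≥ N, hχ.energyForm (u m - u n) (u m - u n) +
      hχ.massForm (u m - u n) (u m - u n) ≤ ε) :
    ∃ w, Tendsto (fun n => hχ.energyForm (u n - w) (u n - w) + hχ.massForm (u n - w) (u n - w))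
      atTop (𝓝 0) := by
  obtain ⟨φ, -, hφ, hφ'⟩ := hχ.exists_subseq_tendsto hΓ (fun n => memL2Loc_fn (u n))
    (L := fun _ _ => id) (fun _ _ _ => isometry_id)
    (fun γ n => by filter_upwards [ae_mem_hvol] with x hx using (fn_act (u n) γ hx).symm)
    fun ε hε => by
      obtain ⟨N, hN⟩ := hu ε hε
      refine ⟨N, fun m hm n hn => ?_⟩
      have h1 := hN m hm n hn
      rw [massForm_self] at h1
      simp only [fn_sub] at h1
      linarith [hχ.energyForm_nonneg (u m - u n)]
  obtain ⟨ψ, -, hψ, hψ'⟩ := hχ.exists_subseq_tendsto hΓ (fun n => memL2Loc_grad (u n))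
    (L := frame) (fun γ _ hx => isometry_frame γ hx) (fun γ n => grad_act (u n) γ)
    fun ε hε => by
      obtain ⟨N, hN⟩ := hu ε hε
      refine ⟨N, fun m hm n hn => ?_⟩
      have h1 := hN m hm n hn
      rw [energyForm_self] at h1
      simp only [grad_sub] at h1
      linarith [hχ.massForm_nonneg (u m - u n)]
  -- The limit is taken on the quotient, so its lift is invariant everywhere and not only almost
  -- everywhere.
  let f : Orbifold Γ → ℝ := fun y => limUnder atTop fun k => (u (φ k)).1.1 y
  let G : E3 → E3 := fun x => limUnder atTop fun k => (u (ψ k)).1.2 x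
  have hf : ∀ᵐ x ∂hvol, Tendsto (fun k => fn (u (φ k)) x) atTop (𝓝 (lift f x)) := by
    filter_upwards [hφ, ae_mem_hvol] with x hx hxH
    have : lift f x = limUnder atTop fun k => fn (u (φ k)) x := by
      rw [lift_of_mem _ hxH]
      simp only [f, fn, lift_of_mem _ hxH]
    rw [this]
    exact tendsto_nhds_limUnder hx
  have hG : ∀ᵐ x ∂hvol, Tendsto (fun k => grad (u (ψ k)) x) atTop (𝓝 (x 2 • G x)) := by
    filter_upwards [hψ, ae_mem_hvol] with x hx hxH
    have hx2 : 0 < x 2 := hxH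
    refine Tendsto.const_smul (tendsto_nhds_limUnder ?_) (x 2)
    obtain ⟨l, hl⟩ := hx
    refine ⟨(x 2)⁻¹ • l, (hl.const_smul (x 2)⁻¹).congr fun k => ?_⟩
    rw [grad, smul_smul, inv_mul_cancel₀ hx2.ne', one_smul]
  obtain ⟨f1, f2, f3⟩ := hφ' _ hf
  obtain ⟨G1, G2, G3⟩ := hψ' _ hG
  have hinv : ContinuousOn (fun x : E3 => (x 2)⁻¹) upperHalfSpace :=
    continuous_height.continuousOn.inv₀ fun x hx => (show 0 < x 2 from hx).ne'
  have hcancel : ∀ (v : E3), ∀ x ∈ upperHalfSpace, (x 2)⁻¹ • x 2 • v = v := fun v x hx => by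
    rw [smul_smul, inv_mul_cancel₀ (show 0 < x 2 from hx).ne', one_smul]
  have hGL : MemL2Loc G := by
    intro K hK hKH
    refine (G1.continuous_smul hinv K hK hKH).ae_eq ?_
    filter_upwards [ae_restrict_mem hK.measurableSet] with x hx
    exact hcancel _ x (hKH hx)
  have hw : HasWeakGradient (lift f) G := by
    refine HasWeakGradient.of_tendsto (fun n => hasWeakGradient (u n)) f1 hGL f3
      fun K hK hKH => ?_
    refine (tendsto_eLpNorm_smul hK (hinv.mono hKH) (G3 K hK hKH)).congr fun n =>
      eLpNorm_congr_ae ?_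
    filter_upwards [ae_restrict_mem hK.measurableSet] with x hx
    rw [smul_sub, grad, hcancel _ x (hKH hx), hcancel _ x (hKH hx)]
  refine ⟨⟨(f, G), hw⟩, ?_⟩
  have := G2.add f2
  rw [add_zero] at this
  refine this.congr fun n => ?_
  rw [energyForm_self, massForm_self]
  simp only [grad_sub, fn_sub]
  rfl

theorem exists_setIntegral_le (hχ : IsPartition Γ χ) (hΓ : IsDiscreteGroup Γ) {F : Type*}
    [NormedAddCommGroup F] {K : Set E3} (hK : IsCompact K) (hKH : K ⊆ upperHalfSpace) :
    ∃ C : ℝ, 0 ≤ C ∧ ∀ g : E3 → F, MemL2Loc g →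
      (∀ γ : Γ, ∀ᵐ x ∂hvol, ‖g (act (γ : Hyp3 ≃ᵢ Hyp3) x)‖ = ‖g x‖) →
      ∫ x in K, ‖g x‖ ^ 2 ≤ C * ∫ x, ‖g x‖ ^ 2 ∂cell χ := by
  obtain ⟨C, hC⟩ := hχ.exists_setLIntegral_le hΓ hK hKH
  refine ⟨C, C.2, fun g hg hinv => ?_⟩
  have h1 := hC (fun x => ‖g x‖ₑ ^ 2) (hg.aestronglyMeasurable.enorm.pow_const 2) fun γ => by
    filter_upwards [hinv γ] with x hx
    rw [← ofReal_norm, hx, ofReal_norm]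
  rw [← sq_eLpNorm_two, ← sq_eLpNorm_two, (hg K hK hKH).sq_eLpNorm_two_eq,
    (hχ.memLp_cell hg).sq_eLpNorm_two_eq, ← ENNReal.ofReal_coe_nnreal,
    ← ENNReal.ofReal_mul C.coe_nonneg] at h1
  exact (ENNReal.ofReal_le_ofReal_iff (mul_nonneg C.coe_nonneg
    (integral_nonneg fun x => by positivity))).1 h1

theorem exists_setIntegral_fn_le (hχ : IsPartition Γ χ) (hΓ : IsDiscreteGroup Γ) {K : Set E3}
    (hK : IsCompact K) (hKH : K ⊆ upperHalfSpace) :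
    ∃ C : ℝ, 0 ≤ C ∧ ∀ u : energySpace Γ, ∫ x in K, fn u x ^ 2 ≤ C * hχ.massForm u u := by
  obtain ⟨C, hC0, hC⟩ := hχ.exists_setIntegral_le hΓ hK hKH (F := ℝ)
  refine ⟨C, hC0, fun u => ?_⟩
  have := hC (fn u) (memL2Loc_fn u) fun γ => by
    filter_upwards [ae_mem_hvol] with x hx
    rw [fn_act u γ hx]
  rw [massForm_self]
  simpa only [Real.norm_eq_abs, sq_abs] using this

theorem exists_setIntegral_grad_le (hχ : IsPartition Γ χ) (hΓ : IsDiscreteGroup Γ) {K : Set E3}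
    (hK : IsCompact K) (hKH : K ⊆ upperHalfSpace) :
    ∃ C : ℝ, 0 ≤ C ∧ ∀ u : energySpace Γ, ∫ x in K, ‖u.1.2 x‖ ^ 2 ≤ C * hχ.energyForm u u := by
  obtain ⟨C, hC0, hC⟩ := hχ.exists_setIntegral_le hΓ hK hKH (F := E3)
  obtain ⟨c, hc, hcK⟩ := exists_height_bounds hK hKH
  refine ⟨(c ^ 2)⁻¹ * C, by positivity, fun u => ?_⟩
  have h1 := hC (grad u) (memL2Loc_grad u) fun γ => by
    filter_upwards [grad_act u γ, ae_mem_hvol] with x hx hxH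
    have h2 := (isometry_frame γ hxH).dist_eq (grad u (act (γ : Hyp3 ≃ᵢ Hyp3) x)) 0
    have h3 : frame γ x 0 = 0 := by simp [frame]
    rw [← hx, h3, dist_zero_right, dist_zero_right] at h2
    exact h2.symm
  rw [energyForm_self, mul_assoc, ← div_eq_inv_mul, le_div_iff₀ (by positivity), mul_comm,
    ← integral_const_mul]
  refine le_trans (setIntegral_mono_on ?_ ?_ hK.measurableSet fun x hx => ?_) h1
  · exact ((u.2.2.1 K hK hKH).integrable_norm_pow two_ne_zero).const_mul _
  · exact (memL2Loc_grad u K hK hKH).integrable_norm_pow two_ne_zero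
  · rw [grad, norm_smul, mul_pow, Real.norm_eq_abs, sq_abs]
    have := hcK x hx
    gcongr

/-- Rellich's theorem is applied on the support of χ. It involves the energy on a larger compact
set, which the energy over the cell controls by invariance. -/
theorem exists_compactness (hχ : IsPartition Γ χ) (hΓ : IsDiscreteGroup Γ) {ε : ℝ} (hε : 0 < ε) :
    ∃ (m : ℕ) (ℓ : Fin m → energySpace Γ →ₗ[ℝ] ℝ) (C : ℝ),
      (∀ i u, ℓ i u ^ 2 ≤ C * (hχ.energyForm u u + hχ.massForm u u)) ∧
      ∀ u, hχ.massForm u u ≤ ε * (hχ.energyForm u u + hχ.massForm u u) + ∑ i, ℓ i u ^ 2 := by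
  obtain ⟨C₀, hC₀⟩ := hχ.cell_le
  obtain ⟨K', hK', hKH', hRellich⟩ := exists_forall_integral_sq_le hχ.test.2.1.isCompact hχ.test.2.2
  obtain ⟨C₁, hC₁0, hC₁⟩ := hχ.exists_setIntegral_grad_le hΓ hK' hKH'
  obtain ⟨C₂, hC₂0, hC₂⟩ := hχ.exists_setIntegral_fn_le hΓ hK' hKH'
  -- The comparison constants C₀ and C₁ multiply the energy term later; the summand 1 avoids
  -- division by zero.
  obtain ⟨m, Q, c, hQ, hc, hmain⟩ := hRellich (ε / (C₀ * C₁ + 1)) (by positivity)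
  have hint : ∀ i (u : energySpace Γ), IntegrableOn (fn u) (Q i) := fun i u => by
    have : IsFiniteMeasure (volume.restrict K' : Measure E3) :=
      ⟨by simpa using hK'.measure_lt_top⟩
    have h1 : IntegrableOn (fn u) K' := (memL2Loc_fn u K' hK' hKH').integrable one_le_two
    exact h1.mono_set (hQ i)
  let ℓ : Fin m → energySpace Γ →ₗ[ℝ] ℝ := fun i =>
    { toFun := fun u => √(C₀ * c) * ∫ x in Q i, fn u x
      map_add' := fun u v => by
        simp only [fn_add]
        rw [integral_add (hint i u) (hint i v), mul_add]
      map_smul' := fun t u => by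
        simp only [fn_smul, RingHom.id_apply, smul_eq_mul]
        rw [integral_const_mul]
        ring }
  have hℓ : ∀ i u, ℓ i u ^ 2 = C₀ * (c * (∫ x in Q i, fn u x) ^ 2) := fun i u => by
    change (√(C₀ * c) * _) ^ 2 = _
    rw [mul_pow, Real.sq_sqrt (by positivity)]
    ring
  refine ⟨m, ℓ, C₀ * (c * ((volume.real K' + 1) * C₂)), fun i u => ?_, fun u => ?_⟩
  · rw [hℓ, mul_assoc, mul_assoc]
    refine mul_le_mul_of_nonneg_left (mul_le_mul_of_nonneg_left ?_ hc) C₀.coe_nonneg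
    have h1 : (∫ x in Q i, fn u x) ^ 2 ≤ (volume.real K' + 1) * ∫ x in Q i, fn u x ^ 2 := by
      have hfin : IsFiniteMeasure (volume.restrict (Q i) : Measure E3) :=
        ⟨by simpa using (measure_mono (hQ i)).trans_lt hK'.measure_lt_top⟩
      refine (sq_integral_le ((memL2Loc_fn u K' hK' hKH').mono_measure
        (Measure.restrict_mono_set _ (hQ i)))).trans ?_
      refine mul_le_mul_of_nonneg_right ?_ (integral_nonneg fun x => sq_nonneg _)
      rw [measureReal_restrict_apply_univ]
      exact add_le_add_left (measureReal_mono (hQ i) hK'.measure_lt_top.ne) _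
    have h2 : ∫ x in Q i, fn u x ^ 2 ≤ ∫ x in K', fn u x ^ 2 :=
      setIntegral_mono_set (memL2Loc_fn u K' hK' hKH').integrable_sq
        (Eventually.of_forall fun x => sq_nonneg _) (hQ i).eventuallyLE
    have h3 := hC₂ u
    have h4 : 0 ≤ volume.real K' + 1 := by positivity
    calc _ ≤ _ := h1
      _ ≤ (volume.real K' + 1) * (C₂ * (hχ.energyForm u u + hχ.massForm u u)) := by
          gcongr
          refine (h2.trans h3).trans ?_
          gcongr
          linarith [hχ.energyForm_nonneg u]
      _ = _ := by ring
  · simp only [hℓ]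
    rw [← Finset.mul_sum]
    have h1 := hmain _ _ (hasWeakGradient u)
    have h2 : hχ.massForm u u ≤ C₀ * ∫ x in tsupport χ, fn u x ^ 2 := by
      rw [massForm_self]
      simp only [Real.norm_eq_abs, sq_abs]
      have h3 := integral_mono_measure hC₀ (Eventually.of_forall fun x => sq_nonneg (fn u x))
        (((memL2Loc_fn u _ hχ.test.2.1.isCompact hχ.test.2.2).integrable_sq).smul_measure
          (c := (C₀ : ℝ≥0∞)) ENNReal.coe_ne_top)
      refine h3.trans_eq ?_
      exact integral_smul_nnreal_measure _ _
    have h3 := mul_le_mul_of_nonneg_left (h1.trans (add_le_add_left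
      (mul_le_mul_of_nonneg_left (hC₁ u) (by positivity)) _)) C₀.coe_nonneg
    refine h2.trans (h3.trans ?_)
    have h4 := hχ.energyForm_nonneg u
    have h5 := hχ.massForm_nonneg u
    have h6 : (C₀ : ℝ) * (ε / (C₀ * C₁ + 1) * (C₁ * hχ.energyForm u u)) =
        ε * ((C₀ * C₁) / (C₀ * C₁ + 1) * hχ.energyForm u u) := by ring
    have h7 : (C₀ : ℝ) * C₁ / (C₀ * C₁ + 1) ≤ 1 := by
      rw [div_le_one (by positivity)]
      linarith
    rw [mul_add, h6]
    refine add_le_add_left (mul_le_mul_of_nonneg_left ?_ hε.le) _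
    have h8 := mul_le_mul_of_nonneg_right h7 h4
    linarith

end IsPartition

end

/-! ### Testing on the covering space against testing on the quotient. -/

noncomputable section

open Filter Topology
open scoped ENNReal

open Hyp3 Orbifold energySpace

variable {Γ : Subgroup (Hyp3 ≃ᵢ Hyp3)}

theorem Orbifold.exists_descend {α : Type*} {u : Hyp3 → α}
    (hu : ∀ (γ : Γ) p, u ((γ : Hyp3 ≃ᵢ Hyp3) p) = u p) :
    ∃ f : Orbifold Γ → α, ∀ p, f (proj Γ p) = u p := by
  refine ⟨Quotient.lift u ?_, fun p => rfl⟩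
  rintro p q ⟨γ, hγ, rfl⟩
  exact (hu ⟨γ, hγ⟩ p).symm

theorem integrable_hvol {T : E3 → ℝ} {K : Set E3} (hK : IsCompact K) (hKH : K ⊆ upperHalfSpace)
    (hT : IntegrableOn T K) (h0 : ∀ x ∉ K, T x = 0) : Integrable T hvol := by
  obtain ⟨C, hC⟩ := hvol_restrict_le hK hKH
  rw [← integrableOn_iff_integrable_of_support_subset (s := K)]
  · exact (hT.smul_measure (c := (C : ℝ≥0∞)) ENNReal.coe_ne_top).mono_measure hC
  · intro x hx
    by_contra h
    exact hx (h0 x h)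

theorem integral_hvol_eq_setIntegral {T : E3 → ℝ} {K : Set E3} (hKH : K ⊆ upperHalfSpace)
    (h0 : ∀ x ∉ K, T x = 0) : ∫ x, T x ∂hvol = ∫ x in K, T x / x 2 ^ 3 := by
  rw [integral_hvol, setIntegral_eq_integral_of_forall_compl_eq_zero,
    setIntegral_eq_integral_of_forall_compl_eq_zero]
  · intro x hx
    rw [h0 x hx, zero_div]
  · intro x hx
    rw [h0 x fun h => hx (hKH h), zero_div]

theorem hvol_ne_zero : hvol ≠ 0 := by
  intro h
  have h1 : ∀ᵐ x ∂hvol, False := by simp [h]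
  rw [ae_hvol_iff] at h1
  have h2 : volume upperHalfSpace = 0 := by
    rw [← nonpos_iff_eq_zero]
    exact (measure_mono (fun x hx => by simpa using hx)).trans_eq h1
  exact (isOpen_upperHalfSpace.measure_pos volume ⟨_, origin.pos⟩).ne' h2

theorem gradient_eventuallyEq_const {f : E3 → ℝ} {x : E3} {c : ℝ} (h : f =ᶠ[𝓝 x] fun _ => c) :
    gradient f x = 0 := by
  rw [gradient, h.fderiv_eq]
  simp

namespace IsPartition

variable {χ : E3 → ℝ}

/-- Unfolding: the invariant factor g comes out of the sum over Γ, and what remains is the orbit sum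
of φ. -/
theorem integral_mul_test (hχ : IsPartition Γ χ) (hΓ : IsDiscreteGroup Γ) {g φ : E3 → ℝ}
    (hg : ∀ γ : Γ, ∀ x ∈ upperHalfSpace, g (act (γ : Hyp3 ≃ᵢ Hyp3) x) = g x)
    (hφ : IsTestFunction φ) (hint : Integrable (fun x => g x * φ x) hvol) :
    ∫ x, g x * φ x ∂hvol = ∫ x, g x * orbitSum Γ φ x ∂cell χ := by
  obtain ⟨r, hr⟩ := hχ.test.exists_radius
  obtain ⟨s, hs⟩ := hφ.exists_radius
  rw [hχ.integral_eq hΓ hr hint (s := s) fun p hp => ?_, hχ.integral_cell]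
  · refine integral_congr_ae ?_
    filter_upwards [ae_mem_hvol] with x hx
    by_cases hxχ : x ∈ tsupport χ
    · rw [orbitSum_eq_sum hs (by rw [add_comm s]; exact hΓ.subset_near _) hx (hr ⟨x, hx⟩ hxχ)]
      congr 1
      rw [Finset.mul_sum]
      exact Finset.sum_congr rfl fun γ _ => by rw [hg γ x hx]
    · rw [image_eq_zero_of_notMem_tsupport hxχ, zero_mul, zero_mul]
  · rw [image_eq_zero_of_notMem_tsupport fun h => hp.not_ge (hs p h), mul_zero]

/-- The same unfolding for gradients: `coact` multiplies inner products by `scale ^ 2`, which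
compensates exactly for the change of the two height factors. -/
theorem integral_inner_test (hχ : IsPartition Γ χ) (hΓ : IsDiscreteGroup Γ) (u : energySpace Γ)
    {g φ : E3 → ℝ} (hg : ∀ γ : Γ, ∀ x ∈ upperHalfSpace, g (act (γ : Hyp3 ≃ᵢ Hyp3) x) = g x)
    (hφ : IsTestFunction φ)
    (hint : Integrable (fun x => g x * inner ℝ (grad u x) (x 2 • gradient φ x)) hvol) :
    ∫ x, g x * inner ℝ (grad u x) (x 2 • gradient φ x) ∂hvol =
      ∫ x, g x * inner ℝ (grad u x) (x 2 • gradient (orbitSum Γ φ) x) ∂cell χ := by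
  have := hΓ.countable
  obtain ⟨r, hr⟩ := hχ.test.exists_radius
  obtain ⟨s, hs⟩ := hφ.exists_radius
  -- The gradient of the orbit sum is computed on an open ball, hence the extra 1; it is added here
  -- so that the same finite set of group elements occurs in both sums.
  rw [hχ.integral_eq hΓ hr hint (s := s + 1) fun p hp => ?_, hχ.integral_cell]
  · refine integral_congr_ae ?_
    filter_upwards [ae_mem_hvol, ae_all_iff.2 fun γ => gradient_act u γ] with x hx hxG
    have hx2 : 0 < x 2 := hx
    by_cases hxχ : x ∈ tsupport χ
    · rw [gradient_orbitSum hφ.1 hs (s := r + 1) (F := hΓ.near (r + (s + 1)))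
        (by rw [show s + (r + 1) = r + (s + 1) by ring]; exact hΓ.subset_near _) hx
        ((hr ⟨x, hx⟩ hxχ).trans_lt (lt_add_one r)), Finset.smul_sum, inner_sum]
      congr 1
      rw [Finset.mul_sum]
      refine Finset.sum_congr rfl fun γ _ => ?_
      rw [hg γ x hx, grad, grad, hxG γ, pull, real_inner_smul_left, real_inner_smul_right,
        real_inner_smul_left, real_inner_smul_right, inner_coact _ hx, scale]
      field_simp
    · rw [image_eq_zero_of_notMem_tsupport hxχ, zero_mul, zero_mul]
  · rw [gradient_eq_zero_of_notMem fun h => hp.not_ge ((hs p h).trans (lt_add_one s).le),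
      smul_zero, inner_zero_right, mul_zero]

theorem integrable_inner_test (u : energySpace Γ) {φ : E3 → ℝ} (hφ : IsTestFunction φ)
    {g : E3 → ℝ} (hg : MemL2Loc g) :
    Integrable (fun x => g x * inner ℝ (grad u x) (x 2 • gradient φ x)) hvol := by
  refine integrable_hvol hφ.2.1.isCompact hφ.2.2 ?_ fun x hx => ?_
  · have h1 := (memL2Loc_grad u) _ hφ.2.1.isCompact hφ.2.2
    have h2 : MemL2Loc fun x => g x • x 2 • gradient φ x := by
      intro K hK hKH
      obtain ⟨C, hC⟩ := hK.exists_bound_of_continuousOn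
        (f := fun x : E3 => x 2 • gradient φ x)
        ((continuous_height.smul (continuous_gradient hφ.1)).continuousOn)
      refine (hg K hK hKH).of_le_mul (c := C) ((hg K hK hKH).1.smul
        (continuous_height.smul (continuous_gradient hφ.1)).aestronglyMeasurable) ?_
      filter_upwards [ae_restrict_mem hK.measurableSet] with x hx
      rw [norm_smul, mul_comm]
      exact mul_le_mul_of_nonneg_right (hC x hx) (norm_nonneg _)
    have h3 := integrable_inner_of_memLp h1 (h2 _ hφ.2.1.isCompact hφ.2.2)
    simpa only [real_inner_smul_right, IntegrableOn] using h3
  · rw [gradient_eq_zero_of_notMem hx, smul_zero, inner_zero_right, mul_zero]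

theorem integrable_mul_test {g φ : E3 → ℝ} (hg : MemL2Loc g) (hφ : IsTestFunction φ) :
    Integrable (fun x => g x * φ x) hvol := by
  refine integrable_hvol hφ.2.1.isCompact hφ.2.2 ?_ fun x hx => ?_
  · simpa [mul_comm] using (hg.integrable_smul_test hφ).integrableOn
  · rw [image_eq_zero_of_notMem_tsupport hx, mul_zero]

/-- The weak form of `Δ u = c u`, written with hyperbolic gradients. -/
theorem hasWeakLaplacian_iff (u : energySpace Γ) (c : ℝ) (φ : E3 → ℝ) :
    (∫ x in upperHalfSpace, (x 2 ^ 2 * inner ℝ (u.1.2 x) (gradient φ x)) / x 2 ^ 3 =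
      ∫ x in upperHalfSpace, (c * fn u x * φ x) / x 2 ^ 3) ↔
    ∫ x, inner ℝ (grad u x) (x 2 • gradient φ x) ∂hvol = c * ∫ x, fn u x * φ x ∂hvol := by
  rw [← integral_hvol, ← integral_hvol (fun x => c * fn u x * φ x), ← integral_const_mul]
  simp only [grad, real_inner_smul_left, real_inner_smul_right, mul_assoc, pow_two]

theorem gradient_orbitSum_eq_zero (hχ : IsPartition Γ χ) {x : E3} (hx : x ∈ upperHalfSpace) :
    gradient (orbitSum Γ χ) x = 0 := by
  refine gradient_eventuallyEq_const (c := 1) ?_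
  filter_upwards [isOpen_upperHalfSpace.mem_nhds hx] with y hy
  exact hχ.orbitSum_eq_one y hy

/-- After unfolding, χ becomes its orbit sum, which is constant. This removes the terms with a
gradient of χ when χ or χ u is used as a test function. -/
theorem integral_inner_partition (hχ : IsPartition Γ χ) (hΓ : IsDiscreteGroup Γ)
    (u : energySpace Γ) {g : E3 → ℝ}
    (hg : ∀ γ : Γ, ∀ x ∈ upperHalfSpace, g (act (γ : Hyp3 ≃ᵢ Hyp3) x) = g x) (hg2 : MemL2Loc g) :
    ∫ x, g x * inner ℝ (grad u x) (x 2 • gradient χ x) ∂hvol = 0 := by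
  rw [hχ.integral_inner_test hΓ u hg hχ.test (integrable_inner_test u hχ.test hg2)]
  refine integral_eq_zero_of_ae ?_
  filter_upwards [(cell_absolutelyContinuous χ).ae_le ae_mem_hvol] with x hx
  rw [hχ.gradient_orbitSum_eq_zero hx, smul_zero, inner_zero_right, mul_zero]
  rfl

/-- The sum of the translates of a test function, as an element of the energy space. -/
theorem exists_orbitSum (hΓ : IsDiscreteGroup Γ) {φ : E3 → ℝ} (hφ : IsTestFunction φ) :
    ∃ v : energySpace Γ, (∀ x ∈ upperHalfSpace, fn v x = orbitSum Γ φ x) ∧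
      ∀ x, grad v x = x 2 • gradient (orbitSum Γ φ) x := by
  obtain ⟨f, hf⟩ := exists_descend (Γ := Γ) (u := fun p : Hyp3 => orbitSum Γ φ p.val)
    fun γ p => by rw [← act_val, orbitSum_act φ γ p.pos]
  have hfl : ∀ x ∈ upperHalfSpace, lift f x = orbitSum Γ φ x := fun x hx => by
    rw [lift_of_mem f hx, hf]
  have h1 := ((hΓ.contDiffOn_orbitSum hφ).of_le (by simp)).hasWeakGradient
  exact ⟨⟨(f, gradient (orbitSum Γ φ)), h1.congr hfl⟩, hfl, fun x => rfl⟩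

/-- Both integrals against a test function unfold to the forms evaluated at its orbit sum, which
belongs to the energy space. -/
theorem hasWeakLaplacian_of_energyForm (hχ : IsPartition Γ χ) (hΓ : IsDiscreteGroup Γ)
    {u : energySpace Γ} {c : ℝ} (h : ∀ v, hχ.energyForm u v = c * hχ.massForm u v) :
    HasWeakLaplacian (lift u.1.1) fun x => c * lift u.1.1 x := by
  refine ⟨u.1.2, u.2, fun φ hφ => (hasWeakLaplacian_iff u c φ).2 ?_⟩
  obtain ⟨v, hv1, hv2⟩ := exists_orbitSum hΓ hφ
  have h1 := h v
  have h2 := hχ.integral_inner_test hΓ u (g := fun _ => 1) (fun _ _ _ => rfl) hφ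
    (integrable_inner_test u hφ continuousOn_const.memL2Loc)
  simp only [one_mul] at h2
  rw [h2, hχ.integral_mul_test hΓ (fun γ x hx => fn_act u γ hx) hφ
    (integrable_mul_test (memL2Loc_fn u) hφ)]
  rw [energyForm_apply, massForm_apply] at h1
  simp only [hv2] at h1
  rw [h1]
  congr 1
  refine integral_congr_ae ?_
  filter_upwards [(cell_absolutelyContinuous χ).ae_le ae_mem_hvol] with x hx
  rw [hv1 x hx]

end IsPartition

end

/-! ### The first nonzero eigenvalue as the minimum of the Rayleigh quotient. -/

noncomputable section

open Filter Topology
open scoped ENNReal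

open Hyp3 Orbifold energySpace

variable {Γ : Subgroup (Hyp3 ≃ᵢ Hyp3)}

namespace energySpace

/-- The constant function `1`. -/
def one (Γ : Subgroup (Hyp3 ≃ᵢ Hyp3)) : energySpace Γ :=
  ⟨(fun _ => 1, fun _ => 0), (HasWeakGradient.const 1).congr fun x hx => by rw [lift_of_mem _ hx]⟩

theorem fn_one {x : E3} (hx : x ∈ upperHalfSpace) : fn (one Γ) x = 1 := lift_of_mem _ hx

theorem grad_one (x : E3) : grad (one Γ) x = 0 := smul_zero _

end energySpace

theorem ae_mem_cell (χ : E3 → ℝ) : ∀ᵐ x ∂cell χ, x ∈ upperHalfSpace :=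
  (IsPartition.cell_absolutelyContinuous χ).ae_le ae_mem_hvol

namespace IsPartition

variable {χ : E3 → ℝ}

theorem massForm_one (hχ : IsPartition Γ χ) (u : energySpace Γ) :
    hχ.massForm u (one Γ) = hχ.total u := by
  rw [massForm_apply, total_apply]
  refine integral_congr_ae ?_
  filter_upwards [ae_mem_cell χ] with x hx
  rw [fn_one hx, mul_one]

theorem energyForm_one (hχ : IsPartition Γ χ) (u : energySpace Γ) :
    hχ.energyForm u (one Γ) = 0 := by
  simp [energyForm_apply, grad_one]

theorem total_one (hχ : IsPartition Γ χ) : hχ.total (one Γ) = (cell χ).real univ := by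
  rw [total_apply, integral_congr_ae (g := fun _ => (1 : ℝ))]
  · simp
  · filter_upwards [ae_mem_cell χ] with x hx using fn_one hx

/-- If the cell were null, the property `False`, invariant and true almost everywhere on the cell,
would hold almost everywhere. -/
theorem cell_univ_pos (hχ : IsPartition Γ χ) (hΓ : IsDiscreteGroup Γ) :
    0 < (cell χ).real univ := by
  have := hχ.isFiniteMeasure_cell
  refine ENNReal.toReal_pos (fun h => ?_) (measure_ne_top _ _)
  apply hvol_ne_zero
  rw [← ae_eq_bot, ← eventually_false_iff_eq_bot]
  refine hχ.ae_hvol hΓ (fun γ => Eventually.of_forall fun x h => h) ?_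
  simp [Measure.measure_univ_eq_zero.1 h]

theorem massForm_isSymm (hχ : IsPartition Γ χ) : hχ.massForm.IsSymm :=
  ⟨fun u v => by simp only [massForm_apply, mul_comm]⟩

theorem energyForm_isSymm (hχ : IsPartition Γ χ) : hχ.energyForm.IsSymm :=
  ⟨fun u v => by simp only [energyForm_apply, real_inner_comm]⟩

theorem ae_fn_eq_of_massForm (hχ : IsPartition Γ χ) (hΓ : IsDiscreteGroup Γ) {u : energySpace Γ}
    (h : hχ.massForm u u = 0) : ∀ᵐ x ∂hvol, fn u x = 0 := by
  refine hχ.ae_hvol hΓ (fun γ => ?_) ?_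
  · filter_upwards [ae_mem_hvol] with x hx h
    rwa [fn_act u γ hx] at h
  · rw [massForm_self, integral_eq_zero_iff_of_nonneg (fun x => by positivity)
      ((hχ.memLp_cell (memL2Loc_fn u)).integrable_norm_pow two_ne_zero)] at h
    filter_upwards [h] with x hx
    simpa using hx

theorem ae_gradient_eq_of_energyForm (hχ : IsPartition Γ χ) (hΓ : IsDiscreteGroup Γ)
    {u : energySpace Γ} (h : hχ.energyForm u u = 0) : ∀ᵐ x ∂hvol, u.1.2 x = 0 := by
  refine hχ.ae_hvol hΓ (fun γ => ?_) ?_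
  · filter_upwards [gradient_act u γ] with x hx h
    rw [hx, h, map_zero]
  · rw [energyForm_self, integral_eq_zero_iff_of_nonneg (fun x => by positivity)
      ((hχ.memLp_cell (memL2Loc_grad u)).integrable_norm_pow two_ne_zero)] at h
    filter_upwards [h, ae_mem_cell χ] with x hx hxH
    have hx2 : x 2 ≠ 0 := (show 0 < x 2 from hxH).ne'
    simpa [grad, hx2] using hx

theorem total_eq_of_ae (hχ : IsPartition Γ χ) {u : energySpace Γ} {k : ℝ}
    (h : ∀ᵐ x ∂hvol, fn u x = k) : hχ.total u = k * (cell χ).real univ := by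
  rw [total_apply, integral_congr_ae (g := fun _ => k)
    ((cell_absolutelyContinuous χ).ae_le h)]
  simp [mul_comm]

theorem massForm_eq_of_ae_zero (hχ : IsPartition Γ χ) {u : energySpace Γ}
    (h : ∀ᵐ x ∂hvol, fn u x = 0) : hχ.massForm u u = 0 := by
  rw [massForm_self]
  refine integral_eq_zero_of_ae ?_
  filter_upwards [(cell_absolutelyContinuous χ).ae_le h] with x hx
  simp [hx]

/-- A minimizer of the Rayleigh quotient among the functions of mean value zero. -/
theorem exists_minimizer (hχ : IsPartition Γ χ) (hΓ : IsDiscreteGroup Γ)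
    (hne : ∃ u, hχ.total u = 0 ∧ hχ.massForm u u ≠ 0) :
    ∃ (u : energySpace Γ) (c : ℝ), hχ.total u = 0 ∧ hχ.massForm u u = 1 ∧
      (∀ v, hχ.energyForm u v = c * hχ.massForm u v) ∧
      ∀ v, hχ.total v = 0 → c * hχ.massForm v v ≤ hχ.energyForm v v := by
  have := hχ.isFiniteMeasure_cell
  let a : LinearMap.BilinForm ℝ (LinearMap.ker hχ.total) :=
    LinearMap.BilinForm.restrict hχ.energyForm _
  let b : LinearMap.BilinForm ℝ (LinearMap.ker hχ.total) :=
    LinearMap.BilinForm.restrict hχ.massForm _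
  obtain ⟨u, c, h1, h2, h3⟩ := LinearMap.BilinForm.exists_minimizer
    (X := LinearMap.ker hχ.total) (a := a) (b := b)
    ⟨fun u v => hχ.energyForm_isSymm.eq u v⟩ ⟨fun u v => hχ.massForm_isSymm.eq u v⟩
    (fun u => hχ.energyForm_nonneg u) (fun u => hχ.massForm_nonneg u)
    (fun u hu => by
      obtain ⟨w, hw⟩ := hχ.exists_limit hΓ (fun n => (u n : energySpace Γ)) hu
      refine ⟨⟨w, ?_⟩, hw⟩
      rw [LinearMap.mem_ker]
      -- The functions of mean value zero form a closed subspace, because the integral is bounded by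
      -- the L² norm over the finite measure of the cell.
      have h1 : ∀ n, hχ.total w ^ 2 ≤ ((cell χ).real univ + 1) *
          (hχ.energyForm ((u n : energySpace Γ) - w) ((u n : energySpace Γ) - w) +
          hχ.massForm ((u n : energySpace Γ) - w) ((u n : energySpace Γ) - w)) := by
        intro n
        have h2 := sq_integral_le (hχ.memLp_cell (memL2Loc_fn ((u n : energySpace Γ) - w)))
        have h3 := hχ.massForm_self ((u n : energySpace Γ) - w)
        simp only [Real.norm_eq_abs, sq_abs] at h3
        have h4 : hχ.total ((u n : energySpace Γ) - w) = - hχ.total w := by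
          rw [map_sub, LinearMap.mem_ker.1 (u n).2, zero_sub]
        rw [← h3, ← total_apply hχ, h4, neg_sq] at h2
        refine h2.trans ?_
        gcongr
        linarith [hχ.energyForm_nonneg ((u n : energySpace Γ) - w)]
      have h5 := le_of_tendsto_of_tendsto' tendsto_const_nhds
        (hw.const_mul ((cell χ).real univ + 1)) h1
      rw [mul_zero] at h5
      exact pow_eq_zero_iff two_ne_zero |>.1 (le_antisymm h5 (sq_nonneg _)))
    (fun ε hε => by
      obtain ⟨m, ℓ, C, h1, h2⟩ := hχ.exists_compactness hΓ hε
      exact ⟨m, fun i => (ℓ i).comp (LinearMap.ker hχ.total).subtype, C,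
        fun i u => h1 i u, fun u => h2 u⟩)
    (by
      obtain ⟨u, hu, hu'⟩ := hne
      exact ⟨⟨u, hu⟩, hu'⟩)
  refine ⟨u, c, u.2, h1, fun v => ?_, fun v hv => h3 ⟨v, hv⟩⟩
  have hm := (hχ.cell_univ_pos hΓ).ne'
  -- Subtracting the mean extends the Euler–Lagrange equation from mean value zero to all v:
  -- constants have no energy, and u is orthogonal to them.
  set t := hχ.total v / (cell χ).real univ
  have hv : hχ.total (v - t • one Γ) = 0 := by
    rw [map_sub, map_smul, total_one, smul_eq_mul, div_mul_cancel₀ _ hm, sub_self]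
  have h4 : hχ.energyForm u (v - t • one Γ) = c * hχ.massForm u (v - t • one Γ) := h2 ⟨_, hv⟩
  have h5 : hχ.total u = 0 := u.2
  rw [map_sub, map_sub, map_smul, map_smul, energyForm_one, massForm_one, h5, smul_zero, sub_zero,
    sub_zero] at h4
  exact h4

/-- Testing with χ itself, the left side vanishes by `integral_inner_partition` and the right side
is μ times the integral over the cell. -/
theorem total_eq_zero_of_hasWeakLaplacian (hχ : IsPartition Γ χ) (hΓ : IsDiscreteGroup Γ)
    {u : energySpace Γ} {μ : ℝ} (hμ : μ ≠ 0)
    (h : ∀ φ, IsTestFunction φ → ∫ x, inner ℝ (grad u x) (x 2 • gradient φ x) ∂hvol =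
      μ * ∫ x, fn u x * φ x ∂hvol) : hχ.total u = 0 := by
  have h1 := h χ hχ.test
  have h2 := hχ.integral_inner_partition hΓ u (g := fun _ => 1) (fun _ _ _ => rfl)
    continuousOn_const.memL2Loc
  simp only [one_mul] at h2
  rw [h2, zero_eq_mul, or_iff_right hμ] at h1
  rw [total_apply, hχ.integral_cell, ← h1]
  simp only [mul_comm]

/-- The equation is tested with χ u, which need not be smooth and is reached as an H¹ limit of test
functions. The product rule gives χ |∇u|² and the cross term u ⟨∇u, ∇χ⟩, whose integral vanishes by
`integral_inner_partition`. -/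
theorem energyForm_eq_of_hasWeakLaplacian (hχ : IsPartition Γ χ) (hΓ : IsDiscreteGroup Γ)
    {u : energySpace Γ} {μ : ℝ}
    (h : ∀ φ, IsTestFunction φ → ∫ x, inner ℝ (grad u x) (x 2 • gradient φ x) ∂hvol =
      μ * ∫ x, fn u x * φ x ∂hvol) : hχ.energyForm u u = μ * hχ.massForm u u := by
  obtain ⟨K', φ, hK', hKH', hφ, hφK, l1, l2⟩ := (hasWeakGradient u).exists_seq_cutoff hχ.test
  set K := K' ∪ tsupport χ
  have hK : IsCompact K := hK'.union hχ.test.2.1.isCompact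
  have hKH : K ⊆ upperHalfSpace := union_subset hKH' hχ.test.2.2
  set W : E3 → E3 := fun x => χ x • u.1.2 x + fn u x • gradient χ x
  have hχx : ∀ x ∉ K, x ∉ tsupport χ := fun x hx h => hx (Or.inr h)
  have hφx : ∀ n, ∀ x ∉ K, x ∉ tsupport (φ n) := fun n x hx h => hx (Or.inl (hφK n h))
  have hW0 : ∀ x ∉ K, W x = 0 := fun x hx => by
    simp only [W, image_eq_zero_of_notMem_tsupport (hχx x hx),
      gradient_eq_zero_of_notMem (hχx x hx), zero_smul, smul_zero, add_zero]
  have hinv : ContinuousOn (fun x : E3 => (x 2)⁻¹ ^ 3) upperHalfSpace :=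
    (continuous_height.continuousOn.inv₀ fun x hx => (show 0 < x 2 from hx).ne').pow 3
  have hW : MemLp W 2 (volume.restrict K) :=
    ((hasWeakGradient u).memLp_gradient_cutoff hχ.test).restrict K
  have hA : MemLp (fun x => (x 2)⁻¹ ^ 3 • x 2 • grad u x) 2 (volume.restrict K) :=
    (((memL2Loc_grad u).continuous_smul continuous_height.continuousOn).continuous_smul hinv)
      K hK hKH
  have hB : MemLp (fun x => (x 2)⁻¹ ^ 3 • fn u x) 2 (volume.restrict K) :=
    ((memL2Loc_fn u).continuous_smul hinv) K hK hKH
  have hle : ∀ {F : Type} [NormedAddCommGroup F] {f : ℕ → E3 → F},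
      Tendsto (fun n => eLpNorm (f n) 2 volume) atTop (𝓝 0) →
      Tendsto (fun n => eLpNorm (f n) 2 (volume.restrict K)) atTop (𝓝 0) := fun hf =>
    tendsto_of_tendsto_of_tendsto_of_le_of_le tendsto_const_nhds hf (fun _ => zero_le)
      fun n => eLpNorm_mono_measure _ Measure.restrict_le_self
  have t1 := tendsto_integral_inner (fun _ => hA)
    (fun n => (continuous_gradient (hφ n).1).continuousOn.memL2Loc K hK hKH) hA hW
    (by simp) (hle l2)
  have t2 := tendsto_integral_mul (fun _ => hB)
    (fun n => (hφ n).continuous.continuousOn.memL2Loc K hK hKH) hB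
    (((hasWeakGradient u).memLp_cutoff hχ.test).restrict K) (by simp) (hle l1)
  have e1 : ∀ Z : E3 → E3, (∀ x ∉ K, Z x = 0) → ∫ x, inner ℝ (grad u x) (x 2 • Z x) ∂hvol =
      ∫ x in K, inner ℝ ((x 2)⁻¹ ^ 3 • x 2 • grad u x) (Z x) := fun Z hZ => by
    rw [integral_hvol_eq_setIntegral hKH fun x hx => by rw [hZ x hx, smul_zero, inner_zero_right]]
    refine integral_congr_ae (Eventually.of_forall fun x => ?_)
    simp only [real_inner_smul_left, real_inner_smul_right]
    ring
  have e2 : ∀ z : E3 → ℝ, (∀ x ∉ K, z x = 0) → ∫ x, fn u x * z x ∂hvol =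
      ∫ x in K, ((x 2)⁻¹ ^ 3 • fn u x) * z x := fun z hz => by
    rw [integral_hvol_eq_setIntegral hKH fun x hx => by rw [hz x hx, mul_zero]]
    refine integral_congr_ae (Eventually.of_forall fun x => ?_)
    simp only [smul_eq_mul]
    ring
  rw [← e1 W hW0] at t1
  rw [← e2 (fun x => χ x * fn u x) fun x hx => by
    rw [image_eq_zero_of_notMem_tsupport (hχx x hx), zero_mul]] at t2
  have hlim : ∫ x, inner ℝ (grad u x) (x 2 • W x) ∂hvol =
      μ * ∫ x, fn u x * (χ x * fn u x) ∂hvol := by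
    refine tendsto_nhds_unique t1 ((t2.const_mul μ).congr fun n => ?_)
    rw [← e1 _ fun x hx => gradient_eq_zero_of_notMem (hφx n x hx),
      ← e2 _ fun x hx => image_eq_zero_of_notMem_tsupport (hφx n x hx), h _ (hφ n)]
  have i1 : Integrable (fun x => χ x * ‖grad u x‖ ^ 2) hvol := by
    have h1 := (hχ.memLp_cell (memL2Loc_grad u)).integrable_norm_pow two_ne_zero
    rw [cell, integrable_withDensity_iff_integrable_smul' hχ.measurable
      (Eventually.of_forall fun x => ENNReal.ofReal_lt_top)] at h1
    simpa only [ENNReal.toReal_ofReal (hχ.nonneg _), smul_eq_mul] using h1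
  have i2 := integrable_inner_test u hχ.test (memL2Loc_fn u)
  have h3 : ∀ x, inner ℝ (grad u x) (x 2 • W x) =
      χ x * ‖grad u x‖ ^ 2 + fn u x * inner ℝ (grad u x) (x 2 • gradient χ x) := fun x => by
    have : x 2 • W x = χ x • grad u x + fn u x • x 2 • gradient χ x := by
      simp only [W, grad, smul_add]
      rw [smul_comm, smul_comm (x 2) (fn u x)]
    rw [this, inner_add_right, real_inner_smul_right, real_inner_smul_right,
      real_inner_self_eq_norm_sq]
  simp only [h3] at hlim
  rw [integral_add i1 i2, hχ.integral_inner_partition hΓ u (fun γ x hx => fn_act u γ hx)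
    (memL2Loc_fn u), add_zero] at hlim
  rw [energyForm_self, massForm_apply, hχ.integral_cell, hχ.integral_cell, hlim]
  congr 2
  funext x
  ring

/-- The first nonzero eigenvalue is the minimum of the Rayleigh quotient. -/
theorem exists_isLeast (hχ : IsPartition Γ χ) (hΓ : IsDiscreteGroup Γ)
    (hne : ∃ u, hχ.total u = 0 ∧ hχ.massForm u u ≠ 0) :
    ∃ c : ℝ, IsLeast {μ : ℝ | μ ≠ 0 ∧ IsEigenvalue Γ μ} c ∧
      ∀ v, hχ.total v = 0 → c * hχ.massForm v v ≤ hχ.energyForm v v := by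
  have hm := (hχ.cell_univ_pos hΓ).ne'
  obtain ⟨u, c, hu0, hu1, hEL, hmin⟩ := hχ.exists_minimizer hΓ hne
  have hae : ∀ f : Orbifold Γ → ℝ, (∀ᵐ p ∂Hyp3.vol, f (proj Γ p) = 0) ↔
      ∀ᵐ x ∂hvol, lift f x = 0 := by
    intro f
    rw [← map_val_vol, measurableEmbedding_val.ae_map_iff]
    simp only [lift, inCoords_val]
  refine ⟨c, ⟨⟨fun hc => ?_, u.1.1, fun h => ?_, hχ.hasWeakLaplacian_of_energyForm hΓ hEL⟩, ?_⟩,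
    hmin⟩
  · have h1 : hχ.energyForm u u = 0 := by rw [hEL, hc, zero_mul]
    -- For c = 0 the minimizer would be constant, hence zero because its mean is zero, against its
    -- mass being 1.
    obtain ⟨k, hk⟩ := (hasWeakGradient u).exists_ae_eq_const
      (ae_hvol_iff.1 (hχ.ae_gradient_eq_of_energyForm hΓ h1))
    rw [← ae_hvol_iff] at hk
    rw [hχ.total_eq_of_ae hk, mul_eq_zero, or_iff_left hm] at hu0
    rw [hu0] at hk
    rw [hχ.massForm_eq_of_ae_zero hk] at hu1
    exact zero_ne_one hu1
  · rw [hχ.massForm_eq_of_ae_zero ((hae _).1 h)] at hu1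
    exact zero_ne_one hu1
  · rintro μ ⟨hμ, f, hf, G, hG, hweak⟩
    set w : energySpace Γ := ⟨(f, G), hG⟩
    have hw : ∀ φ, IsTestFunction φ → ∫ x, inner ℝ (grad w x) (x 2 • gradient φ x) ∂hvol =
        μ * ∫ x, fn w x * φ x ∂hvol := fun φ hφ => (hasWeakLaplacian_iff w μ φ).1 (hweak φ hφ)
    have h1 := hmin w (hχ.total_eq_zero_of_hasWeakLaplacian hΓ hμ hw)
    rw [hχ.energyForm_eq_of_hasWeakLaplacian hΓ hw] at h1
    refine le_of_mul_le_mul_right h1 (lt_of_le_of_ne (hχ.massForm_nonneg w) fun h => hf ?_)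
    exact (hae f).2 (hχ.ae_fn_eq_of_massForm hΓ (u := w) h.symm)

end IsPartition

end

/-! ### Lipschitz functions on the orbifold; a nonconstant one exists. -/

noncomputable section

open Filter Topology
open scoped ENNReal

open Hyp3 Orbifold energySpace

variable {Γ : Subgroup (Hyp3 ≃ᵢ Hyp3)}

theorem exists_mem_of_ae_hvol {P : E3 → Prop} (h : ∀ᵐ x ∂hvol, P x) {V : Set E3} (hV : IsOpen V)
    (hVH : V ⊆ upperHalfSpace) (hne : V.Nonempty) : ∃ x ∈ V, P x := by
  by_contra! hn
  refine (hV.measure_pos volume hne).ne' (measure_mono_null ?_ (ae_hvol_iff.1 h))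
  exact fun x hx h' => hn x hx (h' (hVH hx))

/-- A `1`-Lipschitz invariant function as an element of the energy space. -/
theorem energySpace.exists_lipschitz {u : Hyp3 → ℝ}
    (hu : ∀ (γ : Γ) p, u ((γ : Hyp3 ≃ᵢ Hyp3) p) = u p) (hL : ∀ p q, |u p - u q| ≤ dist p q) :
    ∃ v : energySpace Γ, fn v = inCoords u ∧ v.1.2 = gradient (inCoords u) := by
  obtain ⟨f, hf⟩ := exists_descend hu
  have hfl : lift f = inCoords u := congrArg inCoords (funext hf)
  refine ⟨⟨(f, gradient (inCoords u)), ?_⟩, hfl, rfl⟩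
  change HasWeakGradient (lift f) _
  rw [hfl]
  exact hasWeakGradient_of_lipschitz zero_le_one fun p q => (hL p q).trans_eq (one_mul _).symm

theorem infDist_apply (A : Set (Orbifold Γ)) (γ : Γ) (p : Hyp3) :
    Metric.infDist ((γ : Hyp3 ≃ᵢ Hyp3) p) (proj Γ ⁻¹' A) = Metric.infDist p (proj Γ ⁻¹' A) := by
  have h : (γ : Hyp3 ≃ᵢ Hyp3) '' (proj Γ ⁻¹' A) = proj Γ ⁻¹' A := by
    ext q
    constructor
    · rintro ⟨p, hp, rfl⟩
      rwa [mem_preimage, proj_apply]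
    · intro hq
      refine ⟨((γ⁻¹ : Γ) : Hyp3 ≃ᵢ Hyp3) q, ?_, (γ : Hyp3 ≃ᵢ Hyp3).apply_symm_apply q⟩
      rwa [mem_preimage, proj_apply]
  conv_lhs => rw [← h]
  exact Metric.infDist_image (γ : Hyp3 ≃ᵢ Hyp3).isometry

theorem abs_infDist_sub_le {X : Type*} [PseudoMetricSpace X] (S : Set X) (p q : X) :
    |Metric.infDist p S - Metric.infDist q S| ≤ dist p q := by
  rw [abs_le]
  constructor
  · linarith [Metric.infDist_le_infDist_add_dist (s := S) (x := q) (y := p), dist_comm p q]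
  · linarith [Metric.infDist_le_infDist_add_dist (s := S) (x := p) (y := q)]

theorem measurableSet_val_image {B : Set Hyp3} (hB : MeasurableSet B) :
    MeasurableSet (Hyp3.val '' B) :=
  measurableEmbedding_val.measurableSet_image.2 hB

theorem cell_val_image (χ : E3 → ℝ) {B : Set Hyp3} (hB : MeasurableSet B) :
    cell χ (Hyp3.val '' B) = ∫⁻ p in B, ENNReal.ofReal (χ p.val) ∂Hyp3.vol := by
  rw [cell, withDensity_apply _ (measurableSet_val_image hB), ← map_val_vol,
    measurableEmbedding_val.restrict_map, measurableEmbedding_val.lintegral_map,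
    preimage_image_eq _ val_injective]

/-- The set lies in the union of the translates of one ball, and over such a union the integral of χ
is at most the volume of the ball. -/
theorem IsPartition.cell_val_image_le {χ : E3 → ℝ} (hχ : IsPartition Γ χ) (hΓ : IsDiscreteGroup Γ)
    {z : Hyp3} {r : ℝ} {B : Set Hyp3} (hB : MeasurableSet B)
    (h : ∀ p ∈ B, ∃ γ : Γ, dist p ((γ : Hyp3 ≃ᵢ Hyp3) z) < r) :
    cell χ (Hyp3.val '' B) ≤ Hyp3.vol (Metric.ball origin r) := by
  rw [cell_val_image χ hB, ← Hyp3.vol_ball z]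
  refine (lintegral_mono_set fun p hp => ?_).trans
    (hχ.lintegral_orbit_le hΓ (Metric.ball z r))
  obtain ⟨γ, hγ⟩ := h p hp
  refine mem_iUnion.2 ⟨γ, (γ : Hyp3 ≃ᵢ Hyp3).symm p, ?_, (γ : Hyp3 ≃ᵢ Hyp3).apply_symm_apply p⟩
  rwa [Metric.mem_ball, ← (γ : Hyp3 ≃ᵢ Hyp3).isometry.dist_eq, IsometryEquiv.apply_symm_apply]

theorem exists_vol_ball_lt {m : ℝ≥0∞} (hm : 0 < m) :
    ∃ ε > 0, Hyp3.vol (Metric.ball origin ε) < m := by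
  have h0 : Hyp3.vol {origin} = 0 := by
    rw [vol_eq_hvol_image, image_singleton]
    exact hvol_absolutelyContinuous (by simp)
  have h1 : ⋂ n : ℕ, Metric.ball origin (1 / ((n : ℝ) + 1)) = {origin} := by
    refine Subset.antisymm (fun p hp => ?_) (by
      rintro _ rfl
      exact mem_iInter.2 fun n => Metric.mem_ball_self (by positivity))
    refine dist_le_zero.1 (le_of_forall_pos_le_add fun ε hε => ?_)
    obtain ⟨n, hn⟩ := exists_nat_one_div_lt hε
    have := Metric.mem_ball.1 (mem_iInter.1 hp n)
    linarith
  have h2 := tendsto_measure_iInter_atTop (μ := Hyp3.vol)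
    (s := fun n : ℕ => Metric.ball origin (1 / ((n : ℝ) + 1)))
    (fun n => Metric.isOpen_ball.measurableSet.nullMeasurableSet)
    (fun i j hij => Metric.ball_subset_ball (by
      have : (i : ℝ) ≤ j := by exact_mod_cast hij
      gcongr)) ⟨0, (vol_ball_lt_top _ _).ne⟩
  rw [h1, h0] at h2
  obtain ⟨n, hn⟩ := (h2.eventually_lt_const hm).exists
  exact ⟨_, by positivity, hn⟩

/-- The function is the distance to the orbit of the base point, minus its mean. Were it almost
everywhere constant, then, being small near that orbit, it would be smaller than ε almost
everywhere, and the whole cell would have at most the volume of a ball of radius ε, which is too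
little. -/
theorem IsPartition.exists_total_eq_zero {χ : E3 → ℝ} (hχ : IsPartition Γ χ)
    (hΓ : IsDiscreteGroup Γ) : ∃ u, hχ.total u = 0 ∧ hχ.massForm u u ≠ 0 := by
  have := hχ.isFiniteMeasure_cell
  have hm := hχ.cell_univ_pos hΓ
  have hm' : 0 < cell χ univ := (ENNReal.toReal_pos_iff.1 hm).1
  obtain ⟨ε, hε, hball⟩ := exists_vol_ball_lt hm'
  set S := proj Γ ⁻¹' {proj Γ origin}
  obtain ⟨v, hv, -⟩ := energySpace.exists_lipschitz (Γ := Γ)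
    (u := fun p => Metric.infDist p S) (fun γ p => infDist_apply _ γ p)
    fun p q => abs_infDist_sub_le S p q
  set k := hχ.total v / (cell χ).real univ
  have hSo : origin ∈ S := rfl
  refine ⟨v - k • one Γ, ?_, fun h => ?_⟩
  · rw [map_sub, map_smul, total_one, smul_eq_mul, div_mul_cancel₀ _ hm.ne', sub_self]
  have h1 : ∀ᵐ x ∂hvol, inCoords (fun p => Metric.infDist p S) x = k := by
    filter_upwards [hχ.ae_fn_eq_of_massForm hΓ h, ae_mem_hvol] with x hx hxH
    rw [fn_sub, fn_smul, fn_one hxH, hv] at hx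
    linarith
  have hk : k < ε := by
    obtain ⟨x, ⟨p, hp, rfl⟩, hx⟩ := exists_mem_of_ae_hvol h1
      (isOpenEmbedding_val.isOpenMap _ (Metric.isOpen_ball (x := origin) (ε := ε)))
      (by rintro _ ⟨p, -, rfl⟩; exact p.pos) ⟨_, origin, Metric.mem_ball_self hε, rfl⟩
    rw [inCoords_val] at hx
    rw [← hx]
    exact (Metric.infDist_le_dist_of_mem hSo).trans_lt hp
  have hN : IsOpen {p | Metric.infDist p S < ε} :=
    isOpen_lt (Metric.continuous_infDist_pt S) continuous_const
  have h2 : cell χ univ ≤ cell χ (Hyp3.val '' {p | Metric.infDist p S < ε}) := by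
    refine measure_mono_ae ?_
    filter_upwards [(cell_absolutelyContinuous χ).ae_le h1, ae_mem_cell χ] with x hx hxH _
    rw [inCoords_of_mem _ hxH] at hx
    exact ⟨⟨x, hxH⟩, hx.trans_lt hk, rfl⟩
  refine (h2.trans (hχ.cell_val_image_le hΓ hN.measurableSet (z := origin) (r := ε)
    fun p hp => ?_)).not_gt hball
  obtain ⟨q, hq, hpq⟩ := (Metric.infDist_lt_iff ⟨origin, hSo⟩).1 hp
  obtain ⟨γ, hγ, rfl⟩ := proj_eq_iff.1 (show proj Γ origin = proj Γ q from hq.symm)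
  exact ⟨⟨γ, hγ⟩, hpq⟩

end

/-! ### Collar functions and the eigenvalue bound. -/

noncomputable section

open Filter Topology
open scoped ENNReal

open Hyp3 Orbifold energySpace

variable {Γ : Subgroup (Hyp3 ≃ᵢ Hyp3)}

/-- Otherwise the interiors of A and of its complement would separate the ball of radius r around p,
which is connected. -/
theorem Hyp3.exists_mem_frontier {A : Set Hyp3} {p q : Hyp3} (hp : p ∈ A) (hq : q ∉ A) {r : ℝ}
    (hr : dist p q < r) : ∃ s ∈ frontier A, dist p s < r := by
  by_contra! h
  have hcov : Metric.ball p r ⊆ interior A ∪ interior Aᶜ := fun s hs => by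
    rw [← compl_frontier_eq_union_interior]
    exact fun hsA => (h s hsA).not_gt (by rwa [Metric.mem_ball, dist_comm] at hs)
  have hpr : p ∈ Metric.ball p r := Metric.mem_ball_self (dist_nonneg.trans_lt hr)
  have hqr : q ∈ Metric.ball p r := by rwa [Metric.mem_ball, dist_comm]
  obtain ⟨s, -, hs, hs'⟩ := Hyp3.isPreconnected_ball p r _ _ isOpen_interior isOpen_interior hcov
    ⟨p, hpr, (hcov hpr).resolve_right fun h' => interior_subset h' hp⟩
    ⟨q, hqr, (hcov hqr).resolve_left fun h' => hq (interior_subset h')⟩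
  exact interior_subset hs' (interior_subset hs)

theorem Hyp3.infDist_frontier_le {A : Set Hyp3} {p q : Hyp3} (hp : p ∈ A) (hq : q ∉ A) :
    Metric.infDist p (frontier A) ≤ dist p q := by
  refine le_of_forall_gt fun r hr => ?_
  obtain ⟨s, hs, hps⟩ := Hyp3.exists_mem_frontier hp hq hr
  exact (Metric.infDist_le_dist_of_mem hs).trans_lt hps

/-- The distance to the frontier of `A`, cut off at `1`, and extended by zero outside `A`. -/
def collar (A : Set Hyp3) : Hyp3 → ℝ := A.indicator fun p => min 1 (Metric.infDist p (frontier A))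

section collar

variable {A : Set Hyp3} {p q : Hyp3}

theorem collar_of_mem (hp : p ∈ A) : collar A p = min 1 (Metric.infDist p (frontier A)) :=
  indicator_of_mem hp _

theorem collar_of_notMem (hp : p ∉ A) : collar A p = 0 := indicator_of_notMem hp _

theorem collar_nonneg : 0 ≤ collar A p :=
  indicator_nonneg (fun _ _ => le_min zero_le_one Metric.infDist_nonneg) p

theorem collar_le_one : collar A p ≤ 1 := by
  by_cases hp : p ∈ A
  · rw [collar_of_mem hp]
    exact min_le_left _ _
  · rw [collar_of_notMem hp]
    exact zero_le_one

theorem collar_eq_one (hp : p ∈ A) (h : 1 ≤ Metric.infDist p (frontier A)) : collar A p = 1 := by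
  rw [collar_of_mem hp, min_eq_left h]

/-- The case that matters is p in A and q outside: then the frontier is no farther from p than q is.
-/
theorem abs_collar_sub_le : |collar A p - collar A q| ≤ dist p q := by
  have h : ∀ {p q : Hyp3}, p ∈ A → q ∉ A → |collar A p - collar A q| ≤ dist p q := by
    intro p q hp hq
    rw [collar_of_notMem hq, sub_zero, abs_of_nonneg collar_nonneg, collar_of_mem hp]
    exact (min_le_right _ _).trans (Hyp3.infDist_frontier_le hp hq)
  by_cases hp : p ∈ A <;> by_cases hq : q ∈ A
  · rw [collar_of_mem hp, collar_of_mem hq]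
    refine le_trans ?_ (abs_infDist_sub_le (frontier A) p q)
    have := abs_min_sub_min_le_max 1 (Metric.infDist p (frontier A)) 1
      (Metric.infDist q (frontier A))
    simpa using this
  · exact h hp hq
  · rw [abs_sub_comm, dist_comm]
    exact h hq hp
  · rw [collar_of_notMem hp, collar_of_notMem hq, sub_self, abs_zero]
    exact dist_nonneg

theorem inCoords_collar_mem (A : Set Hyp3) (x : E3) : inCoords (collar A) x ∈ Icc (0 : ℝ) 1 := by
  by_cases hx : x ∈ upperHalfSpace
  · rw [inCoords_of_mem _ hx]
    exact ⟨collar_nonneg, collar_le_one⟩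
  · have : ¬ 0 < x 2 := hx
    simp [inCoords, this]

/-- A point where the collar is 0 is a global minimum, so the gradient vanishes whether or not the
function is differentiable there. -/
theorem gradient_collar_of_eq_zero {x : E3} (h : inCoords (collar A) x = 0) :
    gradient (inCoords (collar A)) x = 0 :=
  gradient_eq_zero_of_isLocalExtr (Or.inl (Eventually.of_forall fun y => by
    rw [h]; exact (inCoords_collar_mem A y).1))

theorem gradient_collar_of_eq_one {x : E3} (h : inCoords (collar A) x = 1) :
    gradient (inCoords (collar A)) x = 0 :=
  gradient_eq_zero_of_isLocalExtr (Or.inr (Eventually.of_forall fun y => by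
    rw [h]; exact (inCoords_collar_mem A y).2))

end collar

theorem collar_apply (B : Set (Orbifold Γ)) (γ : Γ) (p : Hyp3) :
    collar (proj Γ ⁻¹' B) ((γ : Hyp3 ≃ᵢ Hyp3) p) = collar (proj Γ ⁻¹' B) p := by
  have hmem : (γ : Hyp3 ≃ᵢ Hyp3) p ∈ proj Γ ⁻¹' B ↔ p ∈ proj Γ ⁻¹' B := by
    rw [mem_preimage, mem_preimage, proj_apply]
  by_cases hp : p ∈ proj Γ ⁻¹' B
  · rw [collar_of_mem hp, collar_of_mem (hmem.2 hp),
      ← isOpenMap_proj.preimage_frontier_eq_frontier_preimage continuous_proj, infDist_apply]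
  · rw [collar_of_notMem hp, collar_of_notMem fun h => hp (hmem.1 h)]

/-- The quotient distance is an infimum, not assumed to be attained, which is why room above D is
required. -/
theorem Orbifold.exists_dist_lt {D r : ℝ} {z q : Hyp3} (h : qdist (proj Γ z) (proj Γ q) ≤ D)
    (hr : D < r) : ∃ γ : Γ, dist q ((γ : Hyp3 ≃ᵢ Hyp3) z) < r := by
  obtain ⟨d, ⟨p', q', hp', hq', rfl⟩, hd⟩ := exists_lt_of_csInf_lt
    (⟨_, z, q, rfl, rfl, rfl⟩ : {d : ℝ | ∃ p q' : Hyp3, proj Γ p = proj Γ z ∧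
      proj Γ q' = proj Γ q ∧ d = dist p q'}.Nonempty) (h.trans_lt hr)
  obtain ⟨γ, hγ, rfl⟩ := proj_eq_iff.1 hp'.symm
  obtain ⟨δ, hδ, rfl⟩ := proj_eq_iff.1 hq'
  refine ⟨⟨δ, hδ⟩ * ⟨γ, hγ⟩, ?_⟩
  change dist (δ q') (δ (γ z)) < r
  rwa [δ.isometry.dist_eq, dist_comm]

namespace IsPartition

variable {χ : E3 → ℝ}

theorem ofReal_le_cell (hχ : IsPartition Γ χ) (hΓ : IsDiscreteGroup Γ) {B : Set (Orbifold Γ)}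
    (hB : MeasurableSet (proj Γ ⁻¹' B)) {V : ℝ} (hV : ENNReal.ofReal V ≤ Orbifold.vol B) :
    V ≤ (cell χ).real (Hyp3.val '' (proj Γ ⁻¹' B)) := by
  have := hχ.isFiniteMeasure_cell
  refine (ENNReal.ofReal_le_iff_le_toReal (measure_ne_top _ _)).1 (hV.trans ?_)
  rw [cell_val_image χ hB]
  exact hχ.orbifoldVol_le hΓ B

/-- The neighbourhood of radius `1` of a union of `n` sets of diameter at most `D`. -/
theorem cell_neighbourhood_le (hχ : IsPartition Γ χ) (hΓ : IsDiscreteGroup Γ) {n : ℕ} {D : ℝ}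
    {P : Fin n → Set (Orbifold Γ)} (hP : ∀ i, DiamLE (P i) D)
    (hne : (⋃ i, P i).Nonempty) :
    (cell χ).real (Hyp3.val '' {p | Metric.infDist p (proj Γ ⁻¹' ⋃ i, P i) < 1}) ≤
      n * ballVolume (D + 1) := by
  have := hχ.isFiniteMeasure_cell
  set S := proj Γ ⁻¹' ⋃ i, P i
  -- Nonemptiness matters: `Metric.infDist` to the empty set is 0, so the neighbourhood would be the
  -- whole space.
  have hSne : S.Nonempty := by
    obtain ⟨y, hy⟩ := hne
    obtain ⟨p, rfl⟩ := surjective_proj y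
    exact ⟨p, hy⟩
  have hz : ∀ i, ∃ z : Hyp3, (P i).Nonempty → proj Γ z ∈ P i := fun i => by
    by_cases h : (P i).Nonempty
    · obtain ⟨y, hy⟩ := h
      obtain ⟨p, rfl⟩ := surjective_proj y
      exact ⟨p, fun _ => hy⟩
    · exact ⟨origin, fun h' => absurd h' h⟩
  choose z hz using hz
  let B : Fin n → Set Hyp3 := fun i => ⋃ γ : Γ, Metric.ball ((γ : Hyp3 ≃ᵢ Hyp3) (z i)) (D + 1)
  have hB : ∀ i, cell χ (Hyp3.val '' B i) ≤ Hyp3.vol (Metric.ball origin (D + 1)) := fun i =>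
    hχ.cell_val_image_le hΓ (z := z i) (isOpen_iUnion fun γ => Metric.isOpen_ball).measurableSet
      fun p hp => by simpa [B] using hp
  have hsub : {p | Metric.infDist p S < 1} ⊆ ⋃ i, B i := by
    intro p hp
    obtain ⟨q, hq, hpq⟩ := (Metric.infDist_lt_iff hSne).1 hp
    obtain ⟨i, hi⟩ := mem_iUnion.1 (show proj Γ q ∈ ⋃ i, P i from hq)
    -- The open neighbourhood leaves the slack 1 - dist p q, so radius D + 1 suffices although the
    -- infimum need not be attained.
    obtain ⟨γ, hγ⟩ := exists_dist_lt (hP i _ (hz i ⟨_, hi⟩) _ hi)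
      (show D < D + (1 - dist p q) by linarith)
    refine mem_iUnion.2 ⟨i, mem_iUnion.2 ⟨γ, Metric.mem_ball.2 ?_⟩⟩
    linarith [dist_triangle p q ((γ : Hyp3 ≃ᵢ Hyp3) (z i))]
  have h1 : cell χ (Hyp3.val '' {p | Metric.infDist p S < 1}) ≤
      n * Hyp3.vol (Metric.ball origin (D + 1)) := by
    calc cell χ (Hyp3.val '' {p | Metric.infDist p S < 1})
        ≤ cell χ (⋃ i, Hyp3.val '' B i) := measure_mono (by
          rw [← image_iUnion]; exact image_mono hsub)
      _ ≤ ∑ i, cell χ (Hyp3.val '' B i) := measure_iUnion_fintype_le _ _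
      _ ≤ ∑ _i : Fin n, Hyp3.vol (Metric.ball origin (D + 1)) := Finset.sum_le_sum fun i _ => hB i
      _ = _ := by simp
  have h2 := ENNReal.toReal_mono
    (ENNReal.mul_ne_top (ENNReal.natCast_ne_top n) (vol_ball_lt_top origin (D + 1)).ne) h1
  rwa [ENNReal.toReal_mul, ENNReal.toReal_natCast] at h2

/-- The collar function of a subset of the orbifold: its integral, its square integral and its
energy. -/
theorem exists_collar (hχ : IsPartition Γ χ) {B : Set (Orbifold Γ)}
    (hB : MeasurableSet (proj Γ ⁻¹' B)) {V W : ℝ}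
    (hV : V ≤ (cell χ).real (Hyp3.val '' (proj Γ ⁻¹' B)))
    (hW : (cell χ).real (Hyp3.val '' {p | Metric.infDist p (proj Γ ⁻¹' frontier B) < 1}) ≤ W) :
    ∃ v : energySpace Γ, fn v = inCoords (collar (proj Γ ⁻¹' B)) ∧
      v.1.2 = gradient (inCoords (collar (proj Γ ⁻¹' B))) ∧
      V - W ≤ hχ.total v ∧ V - W ≤ hχ.massForm v v ∧ hχ.energyForm v v ≤ W := by
  have := hχ.isFiniteMeasure_cell
  set A := proj Γ ⁻¹' B with hA
  rw [isOpenMap_proj.preimage_frontier_eq_frontier_preimage continuous_proj] at hW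
  set N := {p | Metric.infDist p (frontier A) < 1}
  have hN : MeasurableSet N :=
    (isOpen_lt (Metric.continuous_infDist_pt _) continuous_const).measurableSet
  obtain ⟨v, hv1, hv2⟩ := energySpace.exists_lipschitz (Γ := Γ) (u := collar A)
    (fun γ p => collar_apply B γ p) fun p q => abs_collar_sub_le
  have hAN := measurableSet_val_image (hB.diff hN)
  -- On A away from the neighbourhood N the collar is 1, which bounds its integral and its square
  -- integral from below.
  have hm : V - W ≤ ∫ x, (Hyp3.val '' (A \ N)).indicator 1 x ∂cell χ := by
    rw [integral_indicator_one hAN, image_sdiff val_injective]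
    have := le_measureReal_sdiff (μ := cell χ) (s₁ := Hyp3.val '' A) (s₂ := Hyp3.val '' N)
    linarith
  have hle : ∀ x, (Hyp3.val '' (A \ N)).indicator 1 x ≤ inCoords (collar A) x := fun x => by
    by_cases hx : x ∈ Hyp3.val '' (A \ N)
    · obtain ⟨p, hp, rfl⟩ := hx
      rw [indicator_of_mem (mem_image_of_mem _ hp), inCoords_val,
        collar_eq_one hp.1 (not_lt.1 hp.2), Pi.one_apply]
    · rw [indicator_of_notMem hx]
      exact (inCoords_collar_mem A x).1
  have hle2 : ∀ x, (Hyp3.val '' (A \ N)).indicator 1 x ≤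
      inCoords (collar A) x * inCoords (collar A) x := fun x => by
    by_cases hx : x ∈ Hyp3.val '' (A \ N)
    · obtain ⟨p, hp, rfl⟩ := hx
      rw [indicator_of_mem (mem_image_of_mem _ hp), inCoords_val,
        collar_eq_one hp.1 (not_lt.1 hp.2), Pi.one_apply, one_mul]
    · rw [indicator_of_notMem hx]
      exact mul_self_nonneg _
  have hint : ∀ {s : Set E3}, MeasurableSet s → Integrable (s.indicator (1 : E3 → ℝ)) (cell χ) :=
    fun hs => (integrable_const (1 : ℝ)).indicator hs
  refine ⟨v, hv1, hv2, hm.trans ?_, hm.trans ?_, ?_⟩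
  · rw [total_apply, hv1]
    exact integral_mono (hint hAN) (hv1 ▸ hχ.integrable_fn v) hle
  · rw [massForm_apply, hv1]
    exact integral_mono (hint hAN) (by simpa only [hv1] using hχ.integrable_fn_mul v v) hle2
  · refine le_trans ?_ hW
    rw [← integral_indicator_one (measurableSet_val_image hN), energyForm_self]
    refine integral_mono_ae
      ((hχ.memLp_cell (memL2Loc_grad v)).integrable_norm_pow two_ne_zero)
      (hint (measurableSet_val_image hN)) ?_
    filter_upwards [ae_mem_cell χ] with x hx
    have hx2 : 0 < x 2 := hx
    rw [grad, hv2]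
    -- On N the Lipschitz bound makes the energy density at most 1; off N the collar has an extreme
    -- value, 0 or 1, and the density vanishes.
    by_cases hxN : x ∈ Hyp3.val '' N
    · rw [indicator_of_mem hxN, Pi.one_apply]
      refine pow_le_one₀ (norm_nonneg _) ?_
      rw [norm_smul, Real.norm_of_nonneg hx2.le]
      exact height_mul_norm_gradient_le zero_le_one
        (fun p q => abs_collar_sub_le.trans_eq (one_mul _).symm) hx
    · have hp : (⟨x, hx⟩ : Hyp3) ∉ N := fun h => hxN ⟨_, h, rfl⟩
      have hg : gradient (inCoords (collar A)) x = 0 := by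
        by_cases hpA : (⟨x, hx⟩ : Hyp3) ∈ A
        · refine gradient_collar_of_eq_one ?_
          rw [inCoords_of_mem _ hx, collar_eq_one hpA (not_lt.1 hp)]
        · refine gradient_collar_of_eq_zero ?_
          rw [inCoords_of_mem _ hx, collar_of_notMem hpA]
      rw [hg, indicator_of_notMem hxN, smul_zero, norm_zero]
      norm_num

/-- Two functions with disjoint supports. -/
theorem le_div_of_disjoint (hχ : IsPartition Γ χ) {c W M : ℝ}
    (hmin : ∀ v, hχ.total v = 0 → c * hχ.massForm v v ≤ hχ.energyForm v v)
    {v₁ v₂ : energySpace Γ} (hm : hχ.massForm v₁ v₂ = 0) (he : hχ.energyForm v₁ v₂ = 0)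
    (hM : 0 < M) (hW : 0 ≤ W) (ht : M ≤ hχ.total v₁)
    (hm₁ : M ≤ hχ.massForm v₁ v₁) (hm₂ : M ≤ hχ.massForm v₂ v₂)
    (he₁ : hχ.energyForm v₁ v₁ ≤ W) (he₂ : hχ.energyForm v₂ v₂ ≤ W) : c ≤ W / M := by
  rcases le_or_gt c 0 with hc | hc
  · exact hc.trans (by positivity)
  set t₁ := hχ.total v₁
  set t₂ := hχ.total v₂ with ht₂
  -- The coefficients make the mean vanish; the mixed terms are zero, so mass and energy are
  -- weighted by the same squares.
  have h1 := hmin (t₂ • v₁ - t₁ • v₂) (by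
    rw [map_sub, map_smul, map_smul, smul_eq_mul, smul_eq_mul, ← ht₂, mul_comm, sub_self])
  have hm' : hχ.massForm v₂ v₁ = 0 := by rw [hχ.massForm_isSymm.eq]; exact hm
  have he' : hχ.energyForm v₂ v₁ = 0 := by rw [hχ.energyForm_isSymm.eq]; exact he
  simp only [map_sub, map_smul, LinearMap.sub_apply, LinearMap.smul_apply, smul_eq_mul, hm, he,
    hm', he', mul_zero, sub_zero, zero_sub] at h1
  have ht₁ : 0 < t₁ := hM.trans_le ht
  have h2 : c * (M * (t₂ ^ 2 + t₁ ^ 2)) ≤ W * (t₂ ^ 2 + t₁ ^ 2) := by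
    calc c * (M * (t₂ ^ 2 + t₁ ^ 2)) ≤ c * (t₂ ^ 2 * hχ.massForm v₁ v₁ +
          t₁ ^ 2 * hχ.massForm v₂ v₂) := by
          refine mul_le_mul_of_nonneg_left ?_ hc.le
          have := mul_le_mul_of_nonneg_left hm₁ (sq_nonneg t₂)
          have := mul_le_mul_of_nonneg_left hm₂ (sq_nonneg t₁)
          linarith
      _ ≤ t₂ ^ 2 * hχ.energyForm v₁ v₁ + t₁ ^ 2 * hχ.energyForm v₂ v₂ := by
          refine le_trans (le_of_eq ?_) (h1.trans (le_of_eq ?_)) <;> ring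
      _ ≤ _ := by
          have := mul_le_mul_of_nonneg_left he₁ (sq_nonneg t₂)
          have := mul_le_mul_of_nonneg_left he₂ (sq_nonneg t₁)
          linarith
  rw [← mul_assoc] at h2
  rw [le_div_iff₀ hM]
  exact le_of_mul_le_mul_right h2 (by positivity)

end IsPartition

theorem mainTheorem12 (Γ : Subgroup (Hyp3 ≃ᵢ Hyp3)) (hΓ : IsDiscreteGroup Γ)
    (hclosed : CompactSpace (Orbifold Γ)) :
    IsLeast {μ : ℝ | μ ≠ 0 ∧ Orbifold.IsEigenvalue Γ μ} (Orbifold.lambdaOne Γ) ∧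
    ∀ (U : Set (Orbifold Γ)) (n : ℕ) (D V : ℝ) (P : Fin n → Set (Orbifold Γ)),
      IsOpen U →
      (Pairwise fun i j => Disjoint (P i) (P j)) →
      ⋃ i, P i = frontier U →
      (∀ i, Orbifold.DiamLE (P i) D) →
      ENNReal.ofReal V ≤ Orbifold.vol U →
      ENNReal.ofReal V ≤ Orbifold.vol Uᶜ →
      n * Hyp3.ballVolume (D + 1) < V →
      Orbifold.lambdaOne Γ ≤
        n * Hyp3.ballVolume (D + 1) / (V - n * Hyp3.ballVolume (D + 1)) := by
  obtain ⟨χ, hχ⟩ := hΓ.exists_isPartition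
  have := hχ.isFiniteMeasure_cell
  obtain ⟨c, hc, hmin⟩ := hχ.exists_isLeast hΓ (hχ.exists_total_eq_zero hΓ)
  have hl : Orbifold.lambdaOne Γ = c := hc.csInf_eq
  rw [hl]
  refine ⟨hc, fun U n D V P hU _ hP hD hVU hVU' hV => ?_⟩
  set W := n * Hyp3.ballVolume (D + 1)
  have hW : 0 ≤ W := mul_nonneg (Nat.cast_nonneg n) ENNReal.toReal_nonneg
  have hUm : MeasurableSet (proj Γ ⁻¹' U) := (hU.preimage continuous_proj).measurableSet
  have hUm' : MeasurableSet (proj Γ ⁻¹' Uᶜ) := hUm.compl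
  have h1 := hχ.ofReal_le_cell hΓ hUm hVU
  have h2 := hχ.ofReal_le_cell hΓ hUm' hVU'
  -- As V > W ≥ 0, both sides are nonempty, so the frontier of U is nonempty; in particular n is not
  -- 0.
  have hne : ∀ {A : Set Hyp3}, V ≤ (cell χ).real (Hyp3.val '' A) → A.Nonempty := fun h => by
    refine nonempty_iff_ne_empty.2 fun hA => ?_
    rw [hA, image_empty, measureReal_empty] at h
    linarith
  obtain ⟨p, hp⟩ := hne h1
  obtain ⟨q, hq⟩ := hne h2
  obtain ⟨s, hs, -⟩ := Hyp3.exists_mem_frontier hp hq (lt_add_one _)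
  rw [← isOpenMap_proj.preimage_frontier_eq_frontier_preimage continuous_proj] at hs
  have hN := hχ.cell_neighbourhood_le hΓ hD ⟨_, hP ▸ hs⟩
  rw [hP] at hN
  obtain ⟨v₁, a1, a2, a3, a4, a5⟩ := hχ.exists_collar hUm (W := W) h1 hN
  -- The complement has the same frontier, so the same neighbourhood bounds the energy of its
  -- collar.
  obtain ⟨v₂, b1, b2, b3, b4, b5⟩ := hχ.exists_collar hUm' (W := W) h2
    (by rwa [frontier_compl])
  have hdisj : ∀ x ∈ upperHalfSpace, fn v₁ x = 0 ∨ fn v₂ x = 0 := fun x hx => by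
    rw [a1, b1, inCoords_of_mem _ hx, inCoords_of_mem _ hx]
    by_cases h : (⟨x, hx⟩ : Hyp3) ∈ proj Γ ⁻¹' U
    · exact Or.inr (collar_of_notMem fun h' => h' h)
    · exact Or.inl (collar_of_notMem h)
  refine hχ.le_div_of_disjoint hmin ?_ ?_ (sub_pos.2 hV) hW a3 a4 b4 a5 b5
  · rw [IsPartition.massForm_apply]
    refine integral_eq_zero_of_ae ?_
    filter_upwards [ae_mem_cell χ] with x hx
    rcases hdisj x hx with h | h <;> simp [h]
  · rw [IsPartition.energyForm_apply]
    refine integral_eq_zero_of_ae ?_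
    filter_upwards [ae_mem_cell χ] with x hx
    rcases hdisj x hx with h | h
    · rw [a1] at h
      simp [grad, a2, gradient_collar_of_eq_zero h]
    · rw [b1] at h
      rw [grad, grad, b2, gradient_collar_of_eq_zero h, smul_zero, inner_zero_right]
      rfl

end
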